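/- Let $d\ge 1$, $\beta,T>0$, let $V:\mathbb{R}^d\to\mathbb{R}$ be twice continuously differentiable and put $$G(u)=\tfrac{\beta}{4}|\nabla V(u)|^2-\tfrac12\Delta V(u),\qquad u\in\mathbb{R}^d .$$ Assume that $G$ is bounded from below and that there are constants $C,p>0$ with $$|G(w)-G(v)|\le C\,(1+|v|^p+|w-v|^p)\,|w-v|\qquad\text{for all }v,w\in\mathbb{R}^d .$$ Consider the spectral approximation of the diffusion bridge $dX=-\nabla V(X)\,dt+\sqrt{2/\beta}\,dW$, $X(0)=X(T)=0$. For $N\ge1$ let $n=dN$, write $x\in\mathbb{R}^n$ as $x=(x_{\cdot,1},\dots,x_{\cdot,N})$ with $x_{\cdot,i}\in\mathbb{R}^d$, and set $$e_i(t)=\sqrt{\tfrac2T}\,\sin(i\pi t/T),\qquad \lambda_i^2=\tfrac{2}{\beta}\tfrac{T^2}{\pi^2}i^{-2},\qquad P_N(x)=\sum_{i=1}^N x_{\cdot,i}e_i,\qquad \phi_n(x)=\int_0^T G\big(P_N(x)(t)\big)\,dt ,$$ $$\tilde\pi_n=\prod_{i=1}^N\prod_{j=1}^d \mathcal N(0,\lambda_i^2),\qquad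 \frac{d\pi_n}{d\tilde\pi_n}(x)\propto e^{-\phi_n(x)} .$$ With target $\pi_n$ consider the Metropolis–Hastings chains with Gaussian proposals, for $Z\sim\mathcal N(0,I_n)$, $$\text{RWM: } y=x+\sigma_nZ,\qquad \text{SLA: } y=x+\tfrac{\sigma_n^2}{2}\nabla\log\tilde\pi_n(x)+\sigma_nZ ,$$ let $a_n(x,y)$ be the Metropolis–Hastings acceptance probability, let $x'$ be the state after one step from $x\sim\pi_n$ ($x'=y$ with probability $a_n(x,y)$ and $x'=x$ otherwise), and for a fixed coordinate $i^*$ let $S_n=E[(x'_{i^*}-x_{i^*})^2]$; all expectations are in stationarity, $x\sim\pi_n$. Let $\sigma_n^2=l^2n^{-\rho}$ with $l,\rho>0$. Put $\kappa=1$, $I=1$ for RWM and $I=1/3$ for SLA, and $$\tau^{\rm RWM}=\frac{\beta\pi^2}{6T^2d^2},\qquad \tau^{\rm SLA}=\frac{\beta^3\pi^6}{56T^6d^6},$$ $$a^{\rm RWM}(l)=2\Phi\Big(-\frac l2\sqrt{K^{\rm RWM}\tau^{\rm RWM}}\Big),\qquad a^{\rm SLA}(l)=2\Phi\Big(-\frac{l^3}2\sqrt{K^{\rm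 SLA}\tau^{\rm SLA}}\Big),$$ where $\Phi$ is the distribution function of $\mathcal N(0,1)$ and, for the standard normal density $f=e^{-g}$, $K^{\rm RWM}=E_f[g'(X)^2]$ and $K^{\rm SLA}=\frac1{48}E_f[3g''(X)^3+5g'''(X)^2]$. Then $\kappa$ and $\tau$ are the decay rate and the limits $$c\,m^{-\kappa}\le\Lambda_{m}\le C\,m^{-\kappa}\ (1\le m\le n)\ \text{ with constants } c,C>0 \text{ not depending on } N,$$ $$\tau^{\rm RWM}=\lim_{N\to\infty} n^{-(2\kappa+1)}\sum_{m=1}^n\Lambda_m^{-2},\qquad \tau^{\rm SLA}=\lim_{N\to\infty} n^{-(6\kappa+1)}\sum_{m=1}^n\Lambda_m^{-6},$$ where $\Lambda_m=\lambda_{\lceil m/d\rceil}$ is the standard deviation of the $m$-th coordinate under $\tilde\pi_n$, and for each of the two algorithms, as $N\to\infty$ (with $n=dN$): 1. if $\rho=2\kappa+I$, then $E[a_n(x,y)]\to a(l)$ and $S_n=l^2a(l)\,n^{-2\kappa-I}+o(n^{-2\kappa-I})$; 2. if $\rho>2\kappa+I$, then $E[a_n(x,y)]\to1$ and $S_n=l^2n^{-\rho}+o(n^{-\rho})$;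 3. if $2\kappa<\rho<2\kappa+I$, then $n^pE[a_n(x,y)]\to0$ and $S_n=\mathcal O(n^{-p})$ for every $p\ge0$. -/

import Mathlib

open MeasureTheory ProbabilityTheory Filter Topology Asymptotics

noncomputable section

namespace DiffusionBridge

/-! ### Metropolis-Hastings chains with Gaussian reference laws on `ℝ^ι` -/

/-- The two local-move algorithms: random-walk Metropolis, and the simplified Langevin algorithm
whose drift is the gradient of the logarithm of the reference density. -/
inductive Algorithm
  | rwm
  | sla

/-- The index `I`: `1` for RWM and `1/3` for SLA. -/
def Algorithm.index : Algorithm → ℝ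
  | .rwm => 1
  | .sla => 1 / 3

section Chain

variable {ι : Type*} [Fintype ι]

/-- The reference law: the product of the centred Gaussians with standard deviations `sd i`. -/
def refMeasure (sd : ι → ℝ) : Measure (ι → ℝ) :=
  Measure.pi fun i => gaussianReal 0 (Real.toNNReal (sd i ^ 2))

/-- The Lebesgue density of the reference law. -/
def refDensity (sd : ι → ℝ) (x : ι → ℝ) : ℝ :=
  ∏ i, gaussianPDFReal 0 (Real.toNNReal (sd i ^ 2)) (x i)

/-- The target law `π` with `dπ/dπ̃ ∝ exp (-φ)`, normalised to be a probability measure. -/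
def targetMeasure (sd : ι → ℝ) (phi : (ι → ℝ) → ℝ) : Measure (ι → ℝ) :=
  (refMeasure sd).tilted fun x => -phi x

/-- The Lebesgue density of the target law. -/
def targetDensity (sd : ι → ℝ) (phi : (ι → ℝ) → ℝ) (x : ι → ℝ) : ℝ :=
  Real.exp (-phi x) / (∫ z, Real.exp (-phi z) ∂(refMeasure sd)) * refDensity sd x

/-- The standard Gaussian law `N(0, I)` of the proposal noise. -/
def noiseMeasure (ι : Type*) [Fintype ι] : Measure (ι → ℝ) :=
  Measure.pi fun _ => gaussianReal 0 1

/-- The mean of the proposal from `x`: it is `x` for RWM and `x + (σ² / 2) ∇ log π̃(x)` for SLA,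
`π̃` being the reference density. -/
def proposalMean [DecidableEq ι] (alg : Algorithm) (sd : ι → ℝ) (σ : ℝ) (x : ι → ℝ) : ι → ℝ :=
  match alg with
  | .rwm => x
  | .sla => fun i => x i + σ ^ 2 / 2 *
      fderiv ℝ (fun z : ι → ℝ => Real.log (refDensity sd z)) x (Pi.single i 1)

/-- The proposal `y` from `x` with noise `z`: the proposal mean plus `σ z`. -/
def proposal [DecidableEq ι] (alg : Algorithm) (sd : ι → ℝ) (σ : ℝ) (x z : ι → ℝ) : ι → ℝ :=
  fun i => proposalMean alg sd σ x i + σ * z i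

/-- The Lebesgue density `q(x, y)` of the proposal from `x`. -/
def proposalDensity [DecidableEq ι] (alg : Algorithm) (sd : ι → ℝ) (σ : ℝ) (x y : ι → ℝ) : ℝ :=
  ∏ i, gaussianPDFReal (proposalMean alg sd σ x i) (Real.toNNReal (σ ^ 2)) (y i)

/-- The Metropolis-Hastings acceptance probability for a target density `p` and a proposal
density `q`. -/
def acceptance (p : (ι → ℝ) → ℝ) (q : (ι → ℝ) → (ι → ℝ) → ℝ) (x y : ι → ℝ) : ℝ :=
  if 0 < p x * q x y then min 1 (p y * q y x / (p x * q x y)) else 0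

/-- The acceptance probability `a(x, y)` of the algorithm `alg` with step-size `σ`. -/
def acceptProb [DecidableEq ι] (alg : Algorithm) (sd : ι → ℝ) (phi : (ι → ℝ) → ℝ) (σ : ℝ)
    (x y : ι → ℝ) : ℝ :=
  acceptance (targetDensity sd phi) (proposalDensity alg sd σ) x y

/-- The average acceptance probability `E[a(x, y)]` in stationarity. -/
def meanAcceptance [DecidableEq ι] (alg : Algorithm) (sd : ι → ℝ) (phi : (ι → ℝ) → ℝ)
    (σ : ℝ) : ℝ :=
  ∫ w, acceptProb alg sd phi σ w.1 (proposal alg sd σ w.1 w.2)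
    ∂((targetMeasure sd phi).prod (noiseMeasure ι))

/-- The position of the chain after one step from `x`, driven by the proposal noise `z` and by
the variable `u`, uniform on `[0, 1]`: the proposal `y` is accepted if `u ≤ a(x, y)`. -/
def nextState [DecidableEq ι] (alg : Algorithm) (sd : ι → ℝ) (phi : (ι → ℝ) → ℝ) (σ : ℝ)
    (x z : ι → ℝ) (u : ℝ) : ι → ℝ :=
  if u ≤ acceptProb alg sd phi σ x (proposal alg sd σ x z) then proposal alg sd σ x z else x

/-- The mean squared-jump-distance `E[(x'ᵢ - xᵢ)²]` of the coordinate `i` in stationarity. -/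
def squaredJump [DecidableEq ι] (alg : Algorithm) (sd : ι → ℝ) (phi : (ι → ℝ) → ℝ) (σ : ℝ)
    (i : ι) : ℝ :=
  ∫ w, (nextState alg sd phi σ w.1 w.2.1 w.2.2 i - w.1 i) ^ 2
    ∂((targetMeasure sd phi).prod
      ((noiseMeasure ι).prod (volume.restrict (Set.Icc (0 : ℝ) 1))))

end Chain

/-! ### The limiting acceptance probability -/

/-- `K^RWM = E_f[g'(X)²]` for the density `f = exp (-g)`. -/
def constRWM (g : ℝ → ℝ) : ℝ :=
  ∫ u, (deriv g u) ^ 2 * Real.exp (-g u)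

/-- `K^SLA = E_f[3 g''(X)³ + 5 g'''(X)²] / 48` for the density `f = exp (-g)`. -/
def constSLA (g : ℝ → ℝ) : ℝ :=
  (∫ u, (3 * (iteratedDeriv 2 g u) ^ 3 + 5 * (iteratedDeriv 3 g u) ^ 2) * Real.exp (-g u)) / 48

/-- The function `g` for which `exp (-g)` is the standard normal density. -/
def gaussianPotential (u : ℝ) : ℝ :=
  u ^ 2 / 2 + Real.log (Real.sqrt (2 * Real.pi))

/-- The distribution function `Φ` of `N(0, 1)`. -/
def stdNormalCDF (u : ℝ) : ℝ :=
  cdf (gaussianReal 0 1) u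

/-- The limiting acceptance probability `a(l)`. Here `τ` is the limit of
`n^{-(2κ+1)} ∑ λᵢ⁻²` for RWM and of `n^{-(6κ+1)} ∑ λᵢ⁻⁶` for SLA, so that it enters as a factor. -/
def limitAcceptance (alg : Algorithm) (τ l : ℝ) : ℝ :=
  match alg with
  | .rwm => 2 * stdNormalCDF (-(l / 2) * Real.sqrt (constRWM gaussianPotential * τ))
  | .sla => 2 * stdNormalCDF (-(l ^ 3 / 2) * Real.sqrt (constSLA gaussianPotential * τ))

/-- The power `r` of `λᵢ⁻¹` in the sum that defines `τ`: `2` for RWM and `6` for SLA. -/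
def Algorithm.power : Algorithm → ℕ
  | .rwm => 2
  | .sla => 6

/-! ### The spectral truncation of the bridge -/

/-- `G = (β / 4) |∇V|² - ΔV / 2`. -/
def pathPotential {d : ℕ} (β : ℝ) (V : EuclideanSpace ℝ (Fin d) → ℝ)
    (u : EuclideanSpace ℝ (Fin d)) : ℝ :=
  β / 4 * ‖gradient V u‖ ^ 2 - 1 / 2 * Laplacian.laplacian V u

/-- `G` is bounded below and locally Lipschitz with a polynomial weight. -/
def GrowthCondition {d : ℕ} (G : EuclideanSpace ℝ (Fin d) → ℝ) : Prop :=
  (∃ m : ℝ, ∀ u, m ≤ G u) ∧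
  ∃ C p : ℝ, 0 < C ∧ 0 < p ∧ ∀ v w : EuclideanSpace ℝ (Fin d),
    |G w - G v| ≤ C * (1 + ‖v‖ ^ p + ‖w - v‖ ^ p) * ‖w - v‖

/-- The sine basis of `L²[0, T]`; the index `k = 0, 1, …` stands for the frequency `k + 1`. -/
def sineBasis (T : ℝ) (k : ℕ) (t : ℝ) : ℝ :=
  Real.sqrt (2 / T) * Real.sin ((k + 1 : ℝ) * Real.pi * t / T)

/-- The truncated path `P_N(x)`, where `x (k, j)` is the coefficient of `sineBasis T k` in the
component `j`. -/
def truncatedPath {d : ℕ} (T : ℝ) (N : ℕ) (x : Fin N × Fin d → ℝ) (t : ℝ) :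
    EuclideanSpace ℝ (Fin d) :=
  WithLp.toLp 2 fun j => ∑ k : Fin N, x (k, j) * sineBasis T k t

/-- `φ(X) = ∫₀ᵀ G(X(t)) dt`. -/
def pathFunctional {d : ℕ} (T : ℝ) (G : EuclideanSpace ℝ (Fin d) → ℝ)
    (X : ℝ → EuclideanSpace ℝ (Fin d)) : ℝ :=
  ∫ t in (0 : ℝ)..T, G (X t)

/-- `φ_n(x) = φ(P_N(x))`, with `n = d N`. -/
def truncatedFunctional {d : ℕ} (T : ℝ) (G : EuclideanSpace ℝ (Fin d) → ℝ) (N : ℕ)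
    (x : Fin N × Fin d → ℝ) : ℝ :=
  pathFunctional T G (truncatedPath T N x)

/-- The standard deviations of the coefficients of the Brownian bridge: the coefficient with
frequency `k + 1` has variance `(2 / β) (T / π)² (k + 1)⁻²`, in each of the `d` components. -/
def bridgeSD (β T : ℝ) (N d : ℕ) (i : Fin N × Fin d) : ℝ :=
  Real.sqrt (2 / β * (T ^ 2 / Real.pi ^ 2) * (((i.1 : ℕ) : ℝ) + 1)⁻¹ ^ 2)

/-- The dimension `n = d N` of the state space, as a real number. -/
def dimension (d N : ℕ) : ℝ := ((d * N : ℕ) : ℝ)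

/-- The step-size `σ_n > 0` with `σ_n² = l² n^{-ρ}`. -/
def stepSize (d : ℕ) (l ρ : ℝ) (N : ℕ) : ℝ :=
  Real.sqrt (l ^ 2 * dimension d N ^ (-ρ))

/-- `E[a_n(x, y)]` for the truncated bridge with `n = d N`. -/
def bridgeAcceptance {d : ℕ} (alg : Algorithm) (β T : ℝ) (G : EuclideanSpace ℝ (Fin d) → ℝ)
    (l ρ : ℝ) (N : ℕ) : ℝ :=
  meanAcceptance alg (bridgeSD β T N d) (truncatedFunctional T G N) (stepSize d l ρ N)

/-- `S_n = E[(x'_{i*} - x_{i*})²]` for the truncated bridge with `n = d N` and for the coordinate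
`i* = (k, j)`, which exists as soon as `k < N` (the value `0` for `N ≤ k` is irrelevant in the
limit `N → ∞`). -/
def bridgeJump {d : ℕ} (alg : Algorithm) (β T : ℝ) (G : EuclideanSpace ℝ (Fin d) → ℝ)
    (l ρ : ℝ) (k : ℕ) (j : Fin d) (N : ℕ) : ℝ :=
  if h : k < N then
    squaredJump alg (bridgeSD β T N d) (truncatedFunctional T G N) (stepSize d l ρ N) (⟨k, h⟩, j)
  else 0

/-- The scaling limits, as `N → ∞` and `n = d N`, of the algorithm `alg` for the truncated bridge
with parameters `κ` and `τ`. -/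
structure ScalingLimits {d : ℕ} (alg : Algorithm) (β T : ℝ)
    (G : EuclideanSpace ℝ (Fin d) → ℝ) (κ τ : ℝ) : Prop where
  /-- `κ` is the rate of decay of the standard deviations; the coordinate `(k, j)` is the one with
  number `d k + j + 1` in the vector `(x_{·,1}, …, x_{·,N})`. -/
  decay : ∃ c C : ℝ, 0 < c ∧ 0 < C ∧ ∀ (N : ℕ) (i : Fin N × Fin d),
    c * ((d * (i.1 : ℕ) + (i.2 : ℕ) + 1 : ℕ) : ℝ) ^ (-κ) ≤ bridgeSD β T N d i ∧
    bridgeSD β T N d i ≤ C * ((d * (i.1 : ℕ) + (i.2 : ℕ) + 1 : ℕ) : ℝ) ^ (-κ)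
  /-- `τ` is the limit of `n^{-(rκ+1)} ∑ λᵢ^{-r}`, with `r = 2` for RWM and `r = 6` for SLA. -/
  tau_limit : Tendsto (fun N : ℕ => dimension d N ^ (-((alg.power : ℝ) * κ + 1)) *
    ∑ i : Fin N × Fin d, (bridgeSD β T N d i)⁻¹ ^ alg.power) atTop (𝓝 τ)
  acceptance_critical : ∀ l ρ : ℝ, 0 < l → 0 < ρ → ρ = 2 * κ + alg.index →
    Tendsto (bridgeAcceptance alg β T G l ρ) atTop (𝓝 (limitAcceptance alg τ l))
  acceptance_small_step : ∀ l ρ : ℝ, 0 < l → 0 < ρ → 2 * κ + alg.index < ρ →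
    Tendsto (bridgeAcceptance alg β T G l ρ) atTop (𝓝 1)
  acceptance_large_step : ∀ l ρ : ℝ, 0 < l → 0 < ρ → 2 * κ < ρ → ρ < 2 * κ + alg.index →
    ∀ p : ℝ, 0 ≤ p →
      Tendsto (fun N => dimension d N ^ p * bridgeAcceptance alg β T G l ρ N) atTop (𝓝 0)
  jump_critical : ∀ l ρ : ℝ, 0 < l → 0 < ρ → ρ = 2 * κ + alg.index →
    ∀ (k : ℕ) (j : Fin d),
      (fun N => bridgeJump alg β T G l ρ k j N -
        l ^ 2 * limitAcceptance alg τ l * dimension d N ^ (-(2 * κ) - alg.index))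
      =o[atTop] fun N => dimension d N ^ (-(2 * κ) - alg.index)
  jump_small_step : ∀ l ρ : ℝ, 0 < l → 0 < ρ → 2 * κ + alg.index < ρ →
    ∀ (k : ℕ) (j : Fin d),
      (fun N => bridgeJump alg β T G l ρ k j N - l ^ 2 * dimension d N ^ (-ρ))
      =o[atTop] fun N => dimension d N ^ (-ρ)
  jump_large_step : ∀ l ρ : ℝ, 0 < l → 0 < ρ → 2 * κ < ρ → ρ < 2 * κ + alg.index →
    ∀ (k : ℕ) (j : Fin d) (p : ℝ), 0 ≤ p →
      (bridgeJump alg β T G l ρ k j) =O[atTop] fun N => dimension d N ^ (-p)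

end DiffusionBridge

end

/-! Put `x = rescale sd ξ`: under the reference law `ξ` is a standard Gaussian vector, independent
of the noise `z`. With `η_k = σ / λ_k`, the acceptance probability is `min 1 (exp R)`, where `R` is
`φ(x) - φ(y)` plus a sum of explicit quadratic polynomials in the pairs `(ξ_k, z_k)`
(`acceptProb_eq`). Stationary expectations become integrals over `noisePair` with the weight
`relDensity`. This weight is bounded uniformly in `N`: the lower bound of `G` bounds `φ` from below,
and Jensen's inequality with a uniform bound on the mean of `φ` keeps the normalising constant away
from zero (`exists_normalization`).

Let `ρ > 2`, so that `max η_k → 0`. The growth condition and Gaussian moments make `φ(x) - φ(y)`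
vanish in `L¹` (`truncatedFunctional_increment`). The quadratic sum is `∑ b_k ξ_k z_k - (∑ b_k²) /
2` plus centred sums controlled by their second moments (`ratioRemainder_bound`), with `b_k = -η_k`
for RWM and `b_k = -η_k³ / 4` for SLA. No central limit theorem is needed: given `ξ`, the linear
form in `z` is exactly Gaussian with variance `∑ b_k² ξ_k²`, which concentrates at `v = ∑ b_k²` as
soon as `∑ b_k⁴` is small. The limiting conditional law does not involve `ξ`, so the target density
integrates out to `1` and the mean acceptance is close to `E min(1, exp N(-v/2, v)) = 2Φ(-√v / 2)`
(`abs_integral_sub_gaussianAcceptance_le`, `gaussianAcceptance_eq`). For the jump, the extra weight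
is close to `z_i²`; deleting the coordinate `i` from the linear form makes this weight independent
of it at negligible cost.

Up to the deleted coordinate, `v` is a constant times `∑ η_k^r`, with `r = 2` or `6`, and
`ratioSum_eq` writes this sum as `l^r n^{(r/2)(2 + I - ρ)}` times a sequence tending to `τ`. The
sign of the exponent separates the three regimes. When it is positive, `min(1, e^t) ≤ e^{t/2}`
reduces the acceptance to a product of Hellinger integrals, each equal to `(1 + c η_k^r)^{-1/2}`
(`Algorithm.hellinger`). The acceptance is therefore at most a constant times `exp(-b n^e)` with `b,
e > 0`, and the Cauchy-Schwarz inequality transfers the decay to the jump. -/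

noncomputable section

namespace DiffusionBridge

/-! ### Gaussian product measures -/

section Gaussian

variable {ι : Type*} [Fintype ι]

instance : IsProbabilityMeasure (noiseMeasure ι) := by
  unfold noiseMeasure; infer_instance

instance (sd : ι → ℝ) : IsProbabilityMeasure (refMeasure sd) := by
  unfold refMeasure; infer_instance

/-- The law of two independent standard Gaussian vectors. -/
def noisePair (ι : Type*) [Fintype ι] : Measure ((ι → ℝ) × (ι → ℝ)) :=
  (noiseMeasure ι).prod (noiseMeasure ι)

instance : IsProbabilityMeasure (noisePair ι) := by
  unfold noisePair; infer_instance

/-- A linear form in a standard Gaussian vector is Gaussian. -/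
theorem map_noise_linear (c : ι → ℝ) :
    (noiseMeasure ι).map (fun z => ∑ i, c i * z i) =
      gaussianReal 0 (Real.toNNReal (∑ i, c i ^ 2)) := by
  have : IsFiniteMeasure ((noiseMeasure ι).map (fun z => ∑ i, c i * z i)) := inferInstance
  refine Measure.ext_of_charFun ?_
  ext t
  have hm : Measurable fun z : ι → ℝ => ∑ i, c i * z i := by fun_prop
  rw [charFun_apply_real, integral_map hm.aemeasurable (by fun_prop), charFun_gaussianReal]
  have h1 : ∀ z : ι → ℝ, Complex.exp (t * ((∑ i, c i * z i : ℝ) : ℂ) * Complex.I) =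
      ∏ i, Complex.exp (((t * c i : ℝ) : ℂ) * (z i : ℂ) * Complex.I) := by
    intro z
    rw [← Complex.exp_sum]
    congr 1
    push_cast
    rw [Finset.mul_sum, Finset.sum_mul]
    exact Finset.sum_congr rfl fun i _ => by ring
  simp_rw [h1]
  rw [noiseMeasure, integral_fintype_prod_eq_prod
    (f := fun i (x : ℝ) => Complex.exp (((t * c i : ℝ) : ℂ) * (x : ℂ) * Complex.I))]
  simp_rw [← charFun_apply_real, charFun_gaussianReal]
  rw [← Complex.exp_sum]
  congr 1
  have hs : 0 ≤ ∑ i, c i ^ 2 := Finset.sum_nonneg fun i _ => sq_nonneg _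
  have : ((Real.toNNReal (∑ i, c i ^ 2) : NNReal) : ℂ) = ((∑ i, c i ^ 2 : ℝ) : ℂ) := by
    rw [← Complex.ofReal_inj.mpr (Real.coe_toNNReal _ hs)]
  rw [this]
  push_cast
  simp only [mul_zero, zero_mul, zero_sub]
  rw [Finset.sum_mul, Finset.sum_div, ← Finset.sum_neg_distrib]
  exact Finset.sum_congr rfl fun i _ => by simp; ring

/-- No sign condition is needed: for `v ≤ 0` both truncations give `0` and both sides are the Dirac
mass at `0`. -/
theorem gaussianReal_eq_map_sqrt (v : ℝ) :
    gaussianReal 0 (Real.toNNReal v) = (gaussianReal 0 1).map (fun u => Real.sqrt v * u) := by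
  rw [gaussianReal_map_const_mul]
  congr 1
  · simp
  · ext
    simp [Real.sq_sqrt']

/-- A linear form in two independent standard Gaussian vectors is Gaussian. -/
theorem map_noisePair_linear (a c : ι → ℝ) :
    (noisePair ι).map (fun w => ∑ i, a i * w.1 i + ∑ i, c i * w.2 i) =
      gaussianReal 0 (Real.toNNReal (∑ i, a i ^ 2 + ∑ i, c i ^ 2)) := by
  have hs : 0 ≤ ∑ i, a i ^ 2 := Finset.sum_nonneg fun i _ => sq_nonneg _
  have hs' : 0 ≤ ∑ i, c i ^ 2 := Finset.sum_nonneg fun i _ => sq_nonneg _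
  have := gaussianReal_conv_gaussianReal (m₁ := 0) (m₂ := 0)
    (v₁ := Real.toNNReal (∑ i, a i ^ 2)) (v₂ := Real.toNNReal (∑ i, c i ^ 2))
  have ha : Measurable fun z : ι → ℝ => ∑ i, a i * z i := by fun_prop
  have hc : Measurable fun z : ι → ℝ => ∑ i, c i * z i := by fun_prop
  rw [add_zero, ← Real.toNNReal_add hs hs', Measure.conv, ← map_noise_linear, ← map_noise_linear,
    Measure.map_prod_map _ _ ha hc, Measure.map_map (by fun_prop) (by fun_prop)] at this
  exact this

theorem integral_noise_linear (c : ι → ℝ) {F : ℝ → ℝ} (hF : Measurable F) :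
    ∫ z, F (∑ i, c i * z i) ∂(noiseMeasure ι) =
      ∫ u, F (Real.sqrt (∑ i, c i ^ 2) * u) ∂(gaussianReal 0 1) := by
  have hm : Measurable fun z : ι → ℝ => ∑ i, c i * z i := by fun_prop
  rw [← integral_map (μ := noiseMeasure ι) (φ := fun z => ∑ i, c i * z i) (f := F) hm.aemeasurable
    hF.aestronglyMeasurable, map_noise_linear, gaussianReal_eq_map_sqrt,
    integral_map (by fun_prop) hF.aestronglyMeasurable]

theorem measurePreserving_pair (i : ι) :
    MeasurePreserving (fun w : (ι → ℝ) × (ι → ℝ) => (w.1 i, w.2 i)) (noisePair ι)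
      ((gaussianReal 0 1).prod (gaussianReal 0 1)) := by
  have := measurePreserving_eval (fun _ : ι => gaussianReal 0 1) i
  exact this.prod this

/-- Regroups the two vectors into one family of independent pairs, so that products over coordinates
factorise and distinct pairs are independent. -/
theorem measurePreserving_arrowPair :
    MeasurePreserving (fun f : ι → ℝ × ℝ => ((fun i => (f i).1), (fun i => (f i).2)))
      (Measure.pi fun _ : ι => (gaussianReal 0 1).prod (gaussianReal 0 1)) (noisePair ι) := by
  exact measurePreserving_arrowProdEquivProdArrow ℝ ℝ ι (fun _ => gaussianReal 0 1)
    (fun _ => gaussianReal 0 1)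

theorem integral_noisePair_eq (F : (ι → ℝ) × (ι → ℝ) → ℝ) (hF : Measurable F) :
    ∫ w, F w ∂(noisePair ι) = ∫ f : ι → ℝ × ℝ, F (fun i => (f i).1, fun i => (f i).2)
      ∂(Measure.pi fun _ : ι => (gaussianReal 0 1).prod (gaussianReal 0 1)) := by
  rw [← (measurePreserving_arrowPair (ι := ι)).map_eq,
    integral_map (by fun_prop) hF.aestronglyMeasurable]

theorem integrable_noisePair_prod (F : ι → ℝ → ℝ → ℝ)
    (hF : ∀ i, Measurable fun q : ℝ × ℝ => F i q.1 q.2)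
    (hi : ∀ i, Integrable (fun q : ℝ × ℝ => F i q.1 q.2)
      ((gaussianReal 0 1).prod (gaussianReal 0 1))) :
    Integrable (fun w : (ι → ℝ) × (ι → ℝ) => ∏ i, F i (w.1 i) (w.2 i)) (noisePair ι) := by
  have hm : Measurable fun w : (ι → ℝ) × (ι → ℝ) => ∏ i, F i (w.1 i) (w.2 i) := by
    refine Finset.measurable_prod _ fun i _ => ?_
    exact (hF i).comp (measurePreserving_pair i).measurable
  exact ((measurePreserving_arrowPair (ι := ι)).integrable_comp hm.aestronglyMeasurable).1
    (Integrable.fintype_prod (f := fun i (q : ℝ × ℝ) => F i q.1 q.2) hi)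

theorem integral_noisePair_prod (F : ι → ℝ → ℝ → ℝ)
    (hF : ∀ i, Measurable fun q : ℝ × ℝ => F i q.1 q.2) :
    ∫ w, ∏ i, F i (w.1 i) (w.2 i) ∂(noisePair ι) =
      ∏ i, ∫ q, F i q.1 q.2 ∂((gaussianReal 0 1).prod (gaussianReal 0 1)) := by
  have hm : Measurable fun w : (ι → ℝ) × (ι → ℝ) => ∏ i, F i (w.1 i) (w.2 i) := by
    refine Finset.measurable_prod _ fun i _ => ?_
    exact (hF i).comp (measurePreserving_pair i).measurable
  rw [integral_noisePair_eq _ hm]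
  exact integral_fintype_prod_eq_prod (f := fun i (q : ℝ × ℝ) => F i q.1 q.2)

theorem integral_pair (i : ι) {S : ℝ × ℝ → ℝ} (hS : Measurable S) :
    ∫ w, S (w.1 i, w.2 i) ∂(noisePair ι) =
      ∫ q, S q ∂((gaussianReal 0 1).prod (gaussianReal 0 1)) := by
  rw [← (measurePreserving_pair i).map_eq,
    integral_map (measurePreserving_pair i).measurable.aemeasurable hS.aestronglyMeasurable]

theorem memLp_pair (i : ι) {S : ℝ × ℝ → ℝ} {p : ENNReal}
    (h : MemLp S p ((gaussianReal 0 1).prod (gaussianReal 0 1))) :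
    MemLp (fun w : (ι → ℝ) × (ι → ℝ) => S (w.1 i, w.2 i)) p (noisePair ι) :=
  h.comp_measurePreserving (measurePreserving_pair i)

/-- Distinct coordinate pairs are uncorrelated. -/
theorem integral_pair_mul_pair {i j : ι} (hij : i ≠ j) {S T : ℝ × ℝ → ℝ} (hS : Measurable S)
    (hT : Measurable T) :
    ∫ w, S (w.1 i, w.2 i) * T (w.1 j, w.2 j) ∂(noisePair ι) =
      (∫ q, S q ∂((gaussianReal 0 1).prod (gaussianReal 0 1))) *
        ∫ q, T q ∂((gaussianReal 0 1).prod (gaussianReal 0 1)) := by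
  have h := (iIndepFun_pi (μ := fun _ : ι => (gaussianReal 0 1).prod (gaussianReal 0 1))
    (X := fun _ q => q) (fun _ => by fun_prop)).indepFun hij
  have h2 := (h.comp hS hT).integral_fun_mul_eq_mul_integral
    (hS.comp (measurable_pi_apply i)).aestronglyMeasurable
    (hT.comp (measurable_pi_apply j)).aestronglyMeasurable
  simp only [Function.comp_def] at h2
  rw [integral_noisePair_eq _ (by fun_prop), ← integral_pair i hS, ← integral_pair j hT,
    integral_noisePair_eq _ (by fun_prop), integral_noisePair_eq _ (by fun_prop)]
  exact h2

/-- After expansion of the square, the off-diagonal terms vanish because distinct pairs are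
independent and `S` is centred. -/
theorem integral_sq_sum_pair (a : ι → ℝ) {S : ℝ × ℝ → ℝ} (hS : Measurable S)
    (hS2 : MemLp S 2 ((gaussianReal 0 1).prod (gaussianReal 0 1)))
    (h0 : ∫ q, S q ∂((gaussianReal 0 1).prod (gaussianReal 0 1)) = 0) :
    ∫ w, (∑ i, a i * S (w.1 i, w.2 i)) ^ 2 ∂(noisePair ι) =
      (∑ i, a i ^ 2) * ∫ q, S q ^ 2 ∂((gaussianReal 0 1).prod (gaussianReal 0 1)) := by
  classical
  have hi : ∀ i j : ι, Integrable (fun w : (ι → ℝ) × (ι → ℝ) =>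
      (a i * S (w.1 i, w.2 i)) * (a j * S (w.1 j, w.2 j))) (noisePair ι) := fun i j =>
    ((memLp_pair i hS2).const_mul (a i)).integrable_mul ((memLp_pair j hS2).const_mul (a j))
  simp_rw [sq (∑ i, _), Finset.sum_mul_sum]
  rw [integral_finsetSum _ fun i _ => integrable_finsetSum _ fun j _ => hi i j]
  simp_rw [integral_finsetSum _ fun j _ => hi _ j]
  rw [Finset.sum_mul]
  refine Finset.sum_congr rfl fun i _ => ?_
  rw [Finset.sum_eq_single i]
  · rw [← integral_pair i (hS.pow_const 2), ← integral_const_mul]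
    congr 1 with w
    ring
  · intro j _ hj
    have := integral_pair_mul_pair hj.symm hS hS
    calc _ = ∫ w, (a i * a j) * (S (w.1 i, w.2 i) * S (w.1 j, w.2 j)) ∂(noisePair ι) := by
          congr 1 with w; ring
      _ = 0 := by rw [integral_const_mul, this, h0]; simp
  · simp

theorem memLp_sum_pair (a : ι → ℝ) {S : ℝ × ℝ → ℝ}
    (hS2 : MemLp S 2 ((gaussianReal 0 1).prod (gaussianReal 0 1))) :
    MemLp (fun w : (ι → ℝ) × (ι → ℝ) => ∑ i, a i * S (w.1 i, w.2 i)) 2 (noisePair ι) :=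
  memLp_finsetSum _ fun i _ => (memLp_pair i hS2).const_mul (a i)

/-- The Cauchy-Schwarz inequality for integrals. -/
theorem integral_mul_le_sqrt {Ω : Type*} [MeasurableSpace Ω] {μ : Measure Ω} {f g : Ω → ℝ}
    (hf : MemLp f 2 μ) (hg : MemLp g 2 μ) :
    ∫ w, f w * g w ∂μ ≤ Real.sqrt (∫ w, f w ^ 2 ∂μ) * Real.sqrt (∫ w, g w ^ 2 ∂μ) := by
  have h1 : ∫ w, f w * g w ∂μ ≤ ∫ w, |f w| * |g w| ∂μ := by
    refine integral_mono (hf.integrable_mul hg) (hf.abs.integrable_mul hg.abs) fun w => ?_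
    rw [← abs_mul]
    exact le_abs_self _
  refine h1.trans ?_
  have := integral_mul_le_Lp_mul_Lq_of_nonneg (μ := μ) (f := fun w => |f w|) (g := fun w => |g w|)
    Real.HolderConjugate.two_two
    (Eventually.of_forall fun w => abs_nonneg _) (Eventually.of_forall fun w => abs_nonneg _)
    (by rw [ENNReal.ofReal_ofNat]; exact hf.abs) (by rw [ENNReal.ofReal_ofNat]; exact hg.abs)
  simpa [Real.sqrt_eq_rpow] using this

theorem integral_abs_le_sqrt {Ω : Type*} [MeasurableSpace Ω] {μ : Measure Ω}
    [IsProbabilityMeasure μ] {f : Ω → ℝ} (hf : MemLp f 2 μ) :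
    ∫ w, |f w| ∂μ ≤ Real.sqrt (∫ w, f w ^ 2 ∂μ) := by
  have := integral_mul_le_sqrt hf.abs (memLp_const (1 : ℝ))
  simpa using this

/-- A weighted sum of centred functions of the coordinate pairs is small. -/
theorem integral_abs_sum_pair_le (a : ι → ℝ) {S : ℝ × ℝ → ℝ} (hS : Measurable S)
    (hS2 : MemLp S 2 ((gaussianReal 0 1).prod (gaussianReal 0 1)))
    (h0 : ∫ q, S q ∂((gaussianReal 0 1).prod (gaussianReal 0 1)) = 0) :
    ∫ w, |∑ i, a i * S (w.1 i, w.2 i)| ∂(noisePair ι) ≤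
      Real.sqrt ((∑ i, a i ^ 2) *
        ∫ q, S q ^ 2 ∂((gaussianReal 0 1).prod (gaussianReal 0 1))) := by
  rw [← integral_sq_sum_pair a hS hS2 h0]
  exact integral_abs_le_sqrt (memLp_sum_pair a hS2)

end Gaussian

/-! ### The acceptance probability in standardised coordinates -/

/-- The contribution of one coordinate to the logarithm of the acceptance ratio of the reference
law, in standardised coordinates: `η` is the step-size divided by the standard deviation. -/
def Algorithm.logRatio (alg : Algorithm) (η ξ z : ℝ) : ℝ :=
  match alg with
  | .rwm => (ξ ^ 2 - (ξ + η * z) ^ 2) / 2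
  | .sla => (ξ ^ 2 - (ξ * (1 - η ^ 2 / 2) + η * z) ^ 2) * (η ^ 2 / 8)

/-- The coefficient of the standardised drift of the proposal. -/
def Algorithm.drift : Algorithm → ℝ
  | .rwm => 0
  | .sla => -1 / 2

section Ratio

/-- Multiplication of the coordinates by the standard deviations. -/
def rescale {ι : Type*} (sd ξ : ι → ℝ) : ι → ℝ := fun k => sd k * ξ k

theorem measurable_rescale {ι : Type*} (sd : ι → ℝ) : Measurable (rescale sd) := by
  unfold rescale; fun_prop

variable {ι : Type*} [Fintype ι]

theorem refDensity_eq (sd : ι → ℝ) (x : ι → ℝ) :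
    refDensity sd x = (∏ i, (Real.sqrt (2 * Real.pi * sd i ^ 2))⁻¹) *
      Real.exp (∑ i, -x i ^ 2 / (2 * sd i ^ 2)) := by
  unfold refDensity
  rw [Real.exp_sum, ← Finset.prod_mul_distrib]
  refine Finset.prod_congr rfl fun i _ => ?_
  simp [gaussianPDFReal, Real.coe_toNNReal _ (sq_nonneg (sd i))]

theorem refDensity_const_pos {sd : ι → ℝ} (hsd : ∀ i, 0 < sd i) :
    0 < ∏ i, (Real.sqrt (2 * Real.pi * sd i ^ 2))⁻¹ :=
  Finset.prod_pos fun i _ => by have := hsd i; positivity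

theorem fderiv_log_refDensity [DecidableEq ι] {sd : ι → ℝ} (hsd : ∀ i, 0 < sd i) (x : ι → ℝ)
    (i : ι) :
    fderiv ℝ (fun z : ι → ℝ => Real.log (refDensity sd z)) x (Pi.single i 1) =
      -x i / sd i ^ 2 := by
  have h1 : (fun z : ι → ℝ => Real.log (refDensity sd z)) = fun z =>
      Real.log (∏ i, (Real.sqrt (2 * Real.pi * sd i ^ 2))⁻¹) +
        ∑ i, -z i ^ 2 / (2 * sd i ^ 2) := by
    ext z
    rw [refDensity_eq, Real.log_mul (refDensity_const_pos hsd).ne' (Real.exp_pos _).ne',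
      Real.log_exp]
  have h2 : ∀ k : ι, HasFDerivAt (fun z : ι → ℝ => -z k ^ 2 / (2 * sd k ^ 2))
      ((-x k / sd k ^ 2) • (ContinuousLinearMap.proj k : (ι → ℝ) →L[ℝ] ℝ)) x := by
    intro k
    have h3 : HasFDerivAt (fun z : ι → ℝ => z k)
      (ContinuousLinearMap.proj k : (ι → ℝ) →L[ℝ] ℝ) x := hasFDerivAt_apply k x
    have h4 : HasDerivAt (fun u : ℝ => -u ^ 2 / (2 * sd k ^ 2)) (-x k / sd k ^ 2) (x k) := by
      have := ((hasDerivAt_pow 2 (x k)).neg).div_const (2 * sd k ^ 2)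
      refine this.congr_deriv ?_
      have := (hsd k).ne'
      field_simp
      simp
    exact h4.comp_hasFDerivAt x h3
  rw [h1]
  have h5 := (HasFDerivAt.fun_sum fun k (_ : k ∈ Finset.univ) => h2 k).const_add
    (Real.log (∏ i, (Real.sqrt (2 * Real.pi * sd i ^ 2))⁻¹))
  rw [h5.fderiv]
  simp [Pi.single_apply]

theorem proposalMean_eq [DecidableEq ι] (alg : Algorithm) {sd : ι → ℝ} (hsd : ∀ i, 0 < sd i)
    (σ : ℝ) (x : ι → ℝ) (i : ι) :
    proposalMean alg sd σ x i = x i + alg.drift * σ ^ 2 * (x i / sd i ^ 2) := by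
  cases alg with
  | rwm => simp [proposalMean, Algorithm.drift]
  | sla =>
    simp only [proposalMean, Algorithm.drift, fderiv_log_refDensity hsd]
    ring

/-- The common form of both algorithms: the increment is `σ` times the noise plus a drift that is
smaller by the factor `σ / sd i`. -/
theorem proposal_eq [DecidableEq ι] (alg : Algorithm) {sd : ι → ℝ} (hsd : ∀ i, 0 < sd i)
    (σ : ℝ) (ξ z : ι → ℝ) (i : ι) :
    proposal alg sd σ (rescale sd ξ) z i =
      sd i * ξ i + σ * (z i + alg.drift * (σ / sd i) * ξ i) := by
  have := (hsd i).ne'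
  rw [proposal, proposalMean_eq alg hsd, rescale]
  field_simp
  ring

theorem proposalDensity_eq [DecidableEq ι] (alg : Algorithm) (sd : ι → ℝ) (σ : ℝ) (x y : ι → ℝ) :
    proposalDensity alg sd σ x y = (∏ _i : ι, (Real.sqrt (2 * Real.pi * σ ^ 2))⁻¹) *
      Real.exp (∑ i, -(y i - proposalMean alg sd σ x i) ^ 2 / (2 * σ ^ 2)) := by
  unfold proposalDensity
  rw [Real.exp_sum, ← Finset.prod_mul_distrib]
  refine Finset.prod_congr rfl fun i _ => ?_
  simp [gaussianPDFReal, Real.coe_toNNReal _ (sq_nonneg σ)]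

/-- The acceptance probability of a proposal, in standardised coordinates. -/
theorem acceptProb_eq [DecidableEq ι] (alg : Algorithm) {sd : ι → ℝ} (hsd : ∀ i, 0 < sd i)
    {σ : ℝ} (hσ : 0 < σ) {phi : (ι → ℝ) → ℝ}
    (hZ : 0 < ∫ x, Real.exp (-phi x) ∂(refMeasure sd)) (ξ z : ι → ℝ) :
    acceptProb alg sd phi σ (rescale sd ξ) (proposal alg sd σ (rescale sd ξ) z) =
      min 1 (Real.exp (phi (rescale sd ξ) -
        phi (proposal alg sd σ (rescale sd ξ) z) +
          ∑ i, alg.logRatio (σ / sd i) (ξ i) (z i))) := by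
  set x : ι → ℝ := rescale sd ξ with hx
  set y := proposal alg sd σ x z with hy
  have hC := refDensity_const_pos hsd
  have hD : 0 < ∏ _i : ι, (Real.sqrt (2 * Real.pi * σ ^ 2))⁻¹ :=
    Finset.prod_pos fun i _ => by positivity
  set Z := ∫ x, Real.exp (-phi x) ∂(refMeasure sd)
  set C := ∏ i, (Real.sqrt (2 * Real.pi * sd i ^ 2))⁻¹
  set D := ∏ _i : ι, (Real.sqrt (2 * Real.pi * σ ^ 2))⁻¹
  -- The prefactor is symmetric in `x` and `y`, so it cancels in the Metropolis-Hastings ratio; only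
  -- a difference of exponents remains, which is compared coordinate by coordinate.
  have key : ∀ x y : ι → ℝ, targetDensity sd phi x * proposalDensity alg sd σ x y =
      (C * D / Z) * Real.exp (-phi x + ∑ i, (-x i ^ 2 / (2 * sd i ^ 2) +
        -(y i - proposalMean alg sd σ x i) ^ 2 / (2 * σ ^ 2))) := by
    intro x y
    rw [targetDensity, refDensity_eq, proposalDensity_eq, Finset.sum_add_distrib, Real.exp_add,
      Real.exp_add]
    ring
  have hE : 0 < C * D / Z := by positivity
  rw [acceptProb, acceptance, key, key, if_pos (by positivity), mul_div_mul_left _ _ hE.ne',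
    ← Real.exp_sub]
  congr 2
  rw [add_sub_add_comm, ← Finset.sum_sub_distrib, neg_sub_neg]
  congr 1
  refine Finset.sum_congr rfl fun i _ => ?_
  have hs := (hsd i).ne'
  have hs' := hσ.ne'
  have e1 : y i = sd i * ξ i + σ * (z i + alg.drift * (σ / sd i) * ξ i) := by
    rw [hy, hx, proposal_eq alg hsd]
  rw [proposalMean_eq alg hsd, proposalMean_eq alg hsd, e1, hx, rescale]
  cases alg with
  | rwm =>
    simp only [Algorithm.drift, Algorithm.logRatio]
    field_simp
    ring
  | sla =>
    simp only [Algorithm.drift, Algorithm.logRatio]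
    field_simp
    ring

end Ratio

/-! ### Stationary expectations as Gaussian integrals -/

/-- The standardised increment of one coordinate of the proposal. -/
def stdIncrement {ι : Type*} (alg : Algorithm) (sd : ι → ℝ) (σ : ℝ) (i : ι) (w : (ι → ℝ) × (ι → ℝ)) : ℝ :=
  w.2 i + alg.drift * (σ / sd i) * w.1 i

theorem measurable_stdIncrement {ι : Type*} (alg : Algorithm) (sd : ι → ℝ) (σ : ℝ) (i : ι) :
    Measurable (stdIncrement alg sd σ i) := by
  unfold stdIncrement; fun_prop

section Stationary

variable {ι : Type*} [Fintype ι]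

theorem refMeasure_eq_map (sd : ι → ℝ) :
    refMeasure sd = (noiseMeasure ι).map (rescale sd) := by
  have h : ∀ i : ι, AEMeasurable (fun u : ℝ => sd i * u) (gaussianReal 0 1) := fun i => by fun_prop
  unfold refMeasure noiseMeasure rescale
  refine Eq.trans ?_ (Measure.pi_map_pi h).symm
  congr 1
  ext1 i
  rw [gaussianReal_map_const_mul]
  congr 1
  · simp
  · ext
    simp [Real.coe_toNNReal _ (sq_nonneg (sd i))]

/-- The density of the target with respect to the reference law, in standardised coordinates. -/
def relDensity (sd : ι → ℝ) (phi : (ι → ℝ) → ℝ) (ξ : ι → ℝ) : ℝ :=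
  Real.exp (-phi (rescale sd ξ)) / ∫ x, Real.exp (-phi x) ∂(refMeasure sd)

/-- The logarithm of the acceptance ratio, in standardised coordinates. -/
def logAccept [DecidableEq ι] (alg : Algorithm) (sd : ι → ℝ) (phi : (ι → ℝ) → ℝ) (σ : ℝ)
    (w : (ι → ℝ) × (ι → ℝ)) : ℝ :=
  phi (rescale sd w.1) - phi (proposal alg sd σ (rescale sd w.1) w.2) +
    ∑ i, alg.logRatio (σ / sd i) (w.1 i) (w.2 i)

theorem measurable_logRatio (alg : Algorithm) (η : ℝ) :
    Measurable fun q : ℝ × ℝ => alg.logRatio η q.1 q.2 := by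
  cases alg <;> simp only [Algorithm.logRatio] <;> fun_prop

theorem measurable_proposal_rescale [DecidableEq ι] (alg : Algorithm) {sd : ι → ℝ}
    (hsd : ∀ i, 0 < sd i) (σ : ℝ) :
    Measurable fun w : (ι → ℝ) × (ι → ℝ) => proposal alg sd σ (rescale sd w.1) w.2 := by
  refine measurable_pi_lambda _ fun i => ?_
  simp_rw [proposal_eq alg hsd]
  fun_prop

theorem measurable_logAccept [DecidableEq ι] (alg : Algorithm) {sd : ι → ℝ}
    (hsd : ∀ i, 0 < sd i) {phi : (ι → ℝ) → ℝ} (hphi : Measurable phi) (σ : ℝ) :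
    Measurable (logAccept alg sd phi σ) := by
  refine ((hphi.comp ((measurable_rescale sd).comp measurable_fst)).sub
    (hphi.comp (measurable_proposal_rescale alg hsd σ))).add
    (Finset.measurable_sum _ fun i _ => ?_)
  exact (measurable_logRatio alg (σ / sd i)).comp (measurePreserving_pair i).measurable

theorem measurable_relDensity (sd : ι → ℝ) {phi : (ι → ℝ) → ℝ} (hphi : Measurable phi) :
    Measurable (relDensity sd phi) := by
  unfold relDensity
  exact ((hphi.comp (measurable_rescale sd)).neg.exp).div_const _

theorem integral_targetMeasure_prod {sd : ι → ℝ} (hsd : ∀ i, 0 < sd i) {phi : (ι → ℝ) → ℝ}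
    (hphi : Measurable phi) {Ω : Type*} [MeasurableSpace Ω] (ν : Measure Ω) [SFinite ν]
    (F : (ι → ℝ) × Ω → ℝ) :
    ∫ w, F w ∂((targetMeasure sd phi).prod ν) =
      ∫ w, relDensity sd phi w.1 * F (rescale sd w.1, w.2) ∂((noiseMeasure ι).prod ν) := by
  -- The change of variables goes through a measurable equivalence, and for this reason no
  -- measurability of `F` is required.
  let e : (ι → ℝ) ≃ᵐ (ι → ℝ) :=
    MeasurableEquiv.piCongrRight fun i => MeasurableEquiv.mulLeft₀ (sd i) (hsd i).ne'
  have he : ∀ ξ, e ξ = rescale sd ξ := fun ξ => rfl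
  let e2 : (ι → ℝ) × Ω ≃ᵐ (ι → ℝ) × Ω := e.prodCongr (MeasurableEquiv.refl Ω)
  have hm : Measurable fun x : ι → ℝ => ENNReal.ofReal (Real.exp (-phi x) /
      ∫ x, Real.exp (-phi x) ∂(refMeasure sd)) := by fun_prop
  have h1 : (targetMeasure sd phi).prod ν =
      (((noiseMeasure ι).prod ν).map e2).withDensity fun w =>
        ENNReal.ofReal (Real.exp (-phi w.1) / ∫ x, Real.exp (-phi x) ∂(refMeasure sd)) := by
    rw [targetMeasure, Measure.tilted, prod_withDensity_left hm]
    congr 1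
    rw [refMeasure_eq_map]
    have := Measure.map_prod_map (noiseMeasure ι) ν (measurable_rescale sd) measurable_id
    rw [Measure.map_id] at this
    rw [this]
    rfl
  rw [h1, integral_withDensity_eq_integral_toReal_smul
    (show Measurable fun w : (ι → ℝ) × Ω => ENNReal.ofReal _ from hm.comp measurable_fst)
    (Eventually.of_forall fun _ => ENNReal.ofReal_lt_top), integral_map_equiv]
  refine integral_congr_ae (Eventually.of_forall fun w => ?_)
  have hZ : 0 ≤ ∫ x, Real.exp (-phi x) ∂(refMeasure sd) :=
    integral_nonneg fun x => (Real.exp_pos _).le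
  have : e2 w = (rescale sd w.1, w.2) := rfl
  simp only [this, relDensity, smul_eq_mul]
  rw [ENNReal.toReal_ofReal (by positivity)]

theorem meanAcceptance_eq [DecidableEq ι] (alg : Algorithm) {sd : ι → ℝ} (hsd : ∀ i, 0 < sd i)
    {σ : ℝ} (hσ : 0 < σ) {phi : (ι → ℝ) → ℝ} (hphi : Measurable phi)
    (hZ : 0 < ∫ x, Real.exp (-phi x) ∂(refMeasure sd)) :
    meanAcceptance alg sd phi σ = ∫ w, relDensity sd phi w.1 *
      min 1 (Real.exp (logAccept alg sd phi σ w)) ∂(noisePair ι) := by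
  rw [meanAcceptance, integral_targetMeasure_prod hsd hphi]
  refine integral_congr_ae (Eventually.of_forall fun w => ?_)
  simp only [logAccept, acceptProb_eq alg hsd hσ hZ]

theorem integral_ite_le_unitInterval {a c : ℝ} (h0 : 0 ≤ a) (h1 : a ≤ 1) :
    ∫ u, (if u ≤ a then c else 0) ∂(volume.restrict (Set.Icc (0 : ℝ) 1)) = c * a := by
  have h2 : (fun u : ℝ => if u ≤ a then c else 0) = (Set.Iic a).indicator fun _ => c := by
    ext u; simp [Set.indicator_apply]
  rw [h2, integral_indicator measurableSet_Iic, Measure.restrict_restrict measurableSet_Iic]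
  have h3 : Set.Iic a ∩ Set.Icc (0 : ℝ) 1 = Set.Icc 0 a := by
    ext u; simp only [Set.mem_inter_iff, Set.mem_Iic, Set.mem_Icc]; constructor
    · rintro ⟨h, h', -⟩; exact ⟨h', h⟩
    · rintro ⟨h, h'⟩; exact ⟨h', h, h'.trans h1⟩
  rw [h3]
  simp [h0, mul_comm]

theorem memLp_coord (p : ENNReal) (hp : p ≠ ⊤) (i : ι) :
    MemLp (fun w : (ι → ℝ) × (ι → ℝ) => w.1 i) p (noisePair ι) ∧
      MemLp (fun w : (ι → ℝ) × (ι → ℝ) => w.2 i) p (noisePair ι) := by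
  have h := memLp_id_gaussianReal' (μ := 0) (v := 1) p hp
  exact ⟨memLp_pair (S := fun q => q.1) i (h.comp_fst _), memLp_pair (S := fun q => q.2) i (h.comp_snd _)⟩

theorem memLp_stdIncrement (alg : Algorithm) (sd : ι → ℝ) (σ : ℝ) (i : ι) (p : ENNReal)
    (hp : p ≠ ⊤) : MemLp (stdIncrement alg sd σ i) p (noisePair ι) :=
  (memLp_coord p hp i).2.add ((memLp_coord p hp i).1.const_mul _)

theorem squaredJump_eq [DecidableEq ι] (alg : Algorithm) {sd : ι → ℝ} (hsd : ∀ i, 0 < sd i)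
    {σ : ℝ} (hσ : 0 < σ) {phi : (ι → ℝ) → ℝ} (hphi : Measurable phi) {K : ℝ}
    (hZ : 0 < ∫ x, Real.exp (-phi x) ∂(refMeasure sd)) (hK : ∀ ξ, relDensity sd phi ξ ≤ K) (i : ι) :
    squaredJump alg sd phi σ i = σ ^ 2 * ∫ w, relDensity sd phi w.1 *
      (stdIncrement alg sd σ i w ^ 2 * min 1 (Real.exp (logAccept alg sd phi σ w)))
        ∂(noisePair ι) := by
  rw [squaredJump, integral_targetMeasure_prod hsd hphi,
    -- Reassociation to `((ξ, z), u)` allows the uniform variable to be integrated out first,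
    -- turning the acceptance event into its probability.
    ← (measurePreserving_prodAssoc (noiseMeasure ι) (noiseMeasure ι)
      (volume.restrict (Set.Icc (0 : ℝ) 1))).map_eq, integral_map_equiv]
  set A : (ι → ℝ) × (ι → ℝ) → ℝ := fun w => min 1 (Real.exp (logAccept alg sd phi σ w)) with hA
  set S : (ι → ℝ) × (ι → ℝ) → ℝ := fun w =>
    relDensity sd phi w.1 * (σ ^ 2 * stdIncrement alg sd σ i w ^ 2) with hS
  have hAm : Measurable A := measurable_const.min (measurable_logAccept alg hsd hphi σ).exp
  have hSm : Measurable S := ((measurable_relDensity sd hphi).comp measurable_fst).mul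
    (((measurable_stdIncrement alg sd σ i).pow_const 2).const_mul _)
  have hD0 : ∀ ξ, 0 ≤ relDensity sd phi ξ := fun ξ => by unfold relDensity; positivity
  have e1 : ∀ w : ((ι → ℝ) × (ι → ℝ)) × ℝ,
      relDensity sd phi (MeasurableEquiv.prodAssoc w).1 *
        (nextState alg sd phi σ (rescale sd (MeasurableEquiv.prodAssoc w).1,
          (MeasurableEquiv.prodAssoc w).2).1 (rescale sd (MeasurableEquiv.prodAssoc w).1,
          (MeasurableEquiv.prodAssoc w).2).2.1 (rescale sd (MeasurableEquiv.prodAssoc w).1,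
          (MeasurableEquiv.prodAssoc w).2).2.2 i - (rescale sd (MeasurableEquiv.prodAssoc w).1,
          (MeasurableEquiv.prodAssoc w).2).1 i) ^ 2 =
        if w.2 ≤ A w.1 then S w.1 else 0 := by
    rintro ⟨⟨ξ, z⟩, u⟩
    have h1 : acceptProb alg sd phi σ (rescale sd ξ) (proposal alg sd σ (rescale sd ξ) z) =
        A (ξ, z) := acceptProb_eq alg hsd hσ hZ ξ z
    have h2 : proposal alg sd σ (rescale sd ξ) z i - rescale sd ξ i =
        σ * stdIncrement alg sd σ i (ξ, z) := by
      simp only [proposal_eq alg hsd, stdIncrement, rescale]; ring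
    simp only [MeasurableEquiv.prodAssoc, MeasurableEquiv.coe_mk, Equiv.prodAssoc_apply,
      nextState, h1]
    split_ifs with h
    · rw [h2, hS]; ring
    · simp
  simp_rw [e1]
  have hint : Integrable (fun w : ((ι → ℝ) × (ι → ℝ)) × ℝ => if w.2 ≤ A w.1 then S w.1 else 0)
      ((noisePair ι).prod (volume.restrict (Set.Icc (0 : ℝ) 1))) := by
    -- The bound `K` of the density supplies the integrable majorant that Fubini's theorem requires.
    have h1 : Integrable (fun w => K * (σ ^ 2 * stdIncrement alg sd σ i w ^ 2)) (noisePair ι) :=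
      (((memLp_stdIncrement alg sd σ i 2 (by simp)).integrable_sq).const_mul _).const_mul _
    refine (h1.comp_fst (volume.restrict (Set.Icc (0 : ℝ) 1))).mono' ?_ ?_
    · refine (Measurable.ite ?_ (hSm.comp measurable_fst) measurable_const).aestronglyMeasurable
      exact measurableSet_le measurable_snd (hAm.comp measurable_fst)
    · refine Eventually.of_forall fun w => ?_
      have h3 : 0 ≤ σ ^ 2 * stdIncrement alg sd σ i w.1 ^ 2 := by positivity
      have h4 : 0 ≤ S w.1 := mul_nonneg (hD0 _) h3
      have h5 : S w.1 ≤ K * (σ ^ 2 * stdIncrement alg sd σ i w.1 ^ 2) :=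
        mul_le_mul_of_nonneg_right (hK _) h3
      split_ifs
      · rw [Real.norm_of_nonneg h4]; exact h5
      · simpa using h4.trans h5
  change ∫ w, _ ∂((noisePair ι).prod _) = _
  rw [integral_prod _ hint, ← integral_const_mul]
  refine integral_congr_ae (Eventually.of_forall fun w => ?_)
  simp only
  rw [integral_ite_le_unitInterval (le_min zero_le_one (Real.exp_pos _).le) (min_le_left _ _)]
  simp only [hS]
  ring

end Stationary

/-! ### The Gaussian limit of the acceptance probability -/

/-- The function `min(1, exp)` is constant on the positive half-line and has slope at most `1` on
the negative one, hence is 1-Lipschitz. -/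
theorem abs_min_one_exp_sub_le (a b : ℝ) :
    |min 1 (Real.exp a) - min 1 (Real.exp b)| ≤ |a - b| := by
  wlog h : b ≤ a generalizing a b
  · rw [abs_sub_comm, abs_sub_comm a]
    exact this b a (le_of_not_ge h)
  have h1 : min 1 (Real.exp b) ≤ min 1 (Real.exp a) := min_le_min_left _ (Real.exp_le_exp.2 h)
  rw [abs_of_nonneg (sub_nonneg.2 h1), abs_of_nonneg (sub_nonneg.2 h)]
  rcases le_total 0 b with hb | hb
  · rw [min_eq_left (Real.one_le_exp hb)]
    linarith [min_le_left 1 (Real.exp a)]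
  · rw [min_eq_right (Real.exp_le_one_iff.2 hb)]
    have h2 : min 1 (Real.exp a) ≤ min 1 (Real.exp b + (a - b)) := by
      rcases le_total 0 a with ha | ha
      · refine le_min (min_le_left _ _) ((min_le_left _ _).trans ?_)
        linarith [Real.add_one_le_exp b]
      · refine le_min (min_le_left _ _) ((min_le_right _ _).trans ?_)
        -- For `a ≤ 0`: `e^a - e^b = e^a (1 - e^{b-a}) ≤ e^a (a - b) ≤ a - b`.
        have h3 := Real.add_one_le_exp (b - a)
        have h4 : Real.exp b = Real.exp a * Real.exp (b - a) := by rw [← Real.exp_add]; ring_nf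
        have h5 : Real.exp a ≤ 1 := Real.exp_le_one_iff.2 ha
        have h6 : 0 ≤ a - b := by linarith
        nlinarith [Real.exp_pos a]
    linarith [min_le_right 1 (Real.exp b + (a - b))]

theorem abs_min_one_exp_sub_le_one (a b : ℝ) :
    |min 1 (Real.exp a) - min 1 (Real.exp b)| ≤ 1 := by
  have ha := Real.exp_pos a
  have hb := Real.exp_pos b
  have h1 : 0 ≤ min 1 (Real.exp a) := le_min zero_le_one ha.le
  have h2 : 0 ≤ min 1 (Real.exp b) := le_min zero_le_one hb.le
  rw [abs_le]
  constructor <;> linarith [min_le_left 1 (Real.exp a), min_le_left 1 (Real.exp b)]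

/-- The mean of `min(1, e^R)` for `R` normal with variance `v` and mean `-v / 2`. -/
def gaussianAcceptance (v : ℝ) : ℝ :=
  ∫ u, min 1 (Real.exp (Real.sqrt v * u - v / 2)) ∂(gaussianReal 0 1)

theorem gaussianReal_neg_preserving (s : Set ℝ) (hs : MeasurableSet s) :
    gaussianReal 0 1 (Neg.neg ⁻¹' s) = gaussianReal 0 1 s := by
  have h := gaussianReal_map_neg (μ := 0) (v := 1)
  rw [neg_zero] at h
  conv_rhs => rw [← h]
  rw [Measure.map_apply measurable_neg hs]

theorem stdNormalCDF_eq (a : ℝ) : stdNormalCDF a = (gaussianReal 0 1).real (Set.Iic a) := by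
  rw [stdNormalCDF, cdf_eq_real]

theorem integrable_min_one_exp {Ω : Type*} [MeasurableSpace Ω] {μ : Measure Ω}
    [IsFiniteMeasure μ] {f : Ω → ℝ} (hf : Measurable f) :
    Integrable (fun w => min 1 (Real.exp (f w))) μ := by
  refine (integrable_const (1 : ℝ)).mono' (measurable_const.min hf.exp).aestronglyMeasurable
    (Eventually.of_forall fun w => ?_)
  rw [Real.norm_of_nonneg (le_min zero_le_one (Real.exp_pos _).le)]
  exact min_le_left _ _

/-- The exponent changes sign at `u = √v / 2`. Above this point the integrand is `1`. Below it,
`exp(√v u - v/2)` is the density of `N(√v, 1)` with respect to `N(0, 1)`. Each half contributes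
`Φ(-√v / 2)`, by symmetry and by translation respectively. -/
theorem gaussianAcceptance_eq {v : ℝ} (hv : 0 ≤ v) :
    gaussianAcceptance v = 2 * stdNormalCDF (-(Real.sqrt v / 2)) := by
  set s := Real.sqrt v with hs
  have hs0 : 0 ≤ s := Real.sqrt_nonneg v
  have hv2 : v = s ^ 2 := (Real.sq_sqrt hv).symm
  have hatom := nullSingletonClass_gaussianReal (μ := 0) one_ne_zero
  have h1 : ∀ u, min 1 (Real.exp (s * u - v / 2)) = (Set.Ici (s / 2)).indicator (fun _ => (1 : ℝ)) u +
      (Set.Iio (s / 2)).indicator (fun u => Real.exp (s * u - v / 2)) u := by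
    intro u
    rcases lt_or_ge u (s / 2) with h | h
    · have : s * u - v / 2 ≤ 0 := by rw [hv2]; nlinarith
      rw [min_eq_right (Real.exp_le_one_iff.2 this)]
      simp [h, not_le.2 h]
    · have : 0 ≤ s * u - v / 2 := by rw [hv2]; nlinarith
      rw [min_eq_left (Real.one_le_exp this)]
      simp [h, not_lt.2 h]
  have hi : Integrable (fun u => Real.exp (s * u - v / 2)) (gaussianReal 0 1) := by
    simp_rw [Real.exp_sub]
    exact (integrable_exp_mul_gaussianReal s).div_const _
  rw [gaussianAcceptance]
  simp_rw [← hs, h1]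
  rw [integral_add ((integrable_const _).indicator measurableSet_Ici)
    (hi.indicator measurableSet_Iio), integral_indicator measurableSet_Ici,
    integral_indicator measurableSet_Iio]
  have e1 : ∫ _ in Set.Ici (s / 2), (1 : ℝ) ∂(gaussianReal 0 1) = stdNormalCDF (-(s / 2)) := by
    rw [stdNormalCDF_eq, integral_const, smul_eq_mul, mul_one, measureReal_restrict_apply_univ,
      measureReal_def, measureReal_def, ← gaussianReal_neg_preserving _ measurableSet_Iic]
    congr 2
    ext u
    simp
  have e2 : ∫ u in Set.Iio (s / 2), Real.exp (s * u - v / 2) ∂(gaussianReal 0 1) =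
      stdNormalCDF (-(s / 2)) := by
    have h2 : (gaussianReal s 1) (Set.Iio (s / 2)) = gaussianReal 0 1 (Set.Iic (-(s / 2))) := by
      have h3 := gaussianReal_map_add_const (μ := 0) (v := 1) s
      rw [zero_add] at h3
      rw [← h3, Measure.map_apply (by fun_prop) measurableSet_Iio, ← measure_congr Iio_ae_eq_Iic]
      congr 1
      ext u
      simp only [Set.mem_preimage, Set.mem_Iio]
      constructor <;> intro h <;> linarith
    rw [stdNormalCDF_eq, measureReal_def, ← h2, gaussianReal_apply_eq_integral _ one_ne_zero,
      ENNReal.toReal_ofReal (setIntegral_nonneg measurableSet_Iio fun u _ =>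
        gaussianPDFReal_nonneg _ _ _), ← integral_indicator measurableSet_Iio,
      ← integral_indicator measurableSet_Iio, integral_gaussianReal_eq_integral_smul one_ne_zero]
    refine integral_congr_ae (Eventually.of_forall fun u => ?_)
    by_cases h : u ∈ Set.Iio (s / 2)
    · simp only [Set.indicator_of_mem h, gaussianPDFReal, smul_eq_mul]
      rw [mul_assoc, ← Real.exp_add]
      congr 2
      rw [hv2]
      simp
      ring
    · simp [Set.indicator_of_notMem h]
  rw [e1, e2]
  ring

theorem integral_abs_gaussian_le : ∫ u, |u| ∂(gaussianReal 0 1) ≤ 1 := by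
  have h := integral_abs_le_sqrt (memLp_id_gaussianReal' (μ := 0) (v := 1) 2 (by simp))
  have h2 := variance_id_gaussianReal (μ := 0) (v := 1)
  rw [variance_of_integral_eq_zero (by fun_prop) (by simp)] at h2
  simp only [id] at h h2
  rw [h2] at h
  simpa using h

/-- Follows from the Lipschitz bound and `E|u| ≤ 1`. It gives the continuity of `gaussianAcceptance`
and also allows a random conditional standard deviation to be replaced by a deterministic one. -/
theorem abs_integral_min_one_exp_sub_le (s t a b : ℝ) :
    |∫ u, min 1 (Real.exp (s * u - a)) ∂(gaussianReal 0 1) -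
      ∫ u, min 1 (Real.exp (t * u - b)) ∂(gaussianReal 0 1)| ≤ |s - t| + |a - b| := by
  have hm : ∀ s a : ℝ, Integrable (fun u => min 1 (Real.exp (s * u - a))) (gaussianReal 0 1) :=
    fun s a => integrable_min_one_exp (by fun_prop)
  have hid : Integrable (fun u : ℝ => |u|) (gaussianReal 0 1) :=
    ((memLp_id_gaussianReal' (μ := 0) (v := 1) 1 (by simp)).integrable le_rfl).abs
  rw [← integral_sub (hm _ _) (hm _ _)]
  refine (abs_integral_le_integral_abs).trans ?_
  calc ∫ u, |min 1 (Real.exp (s * u - a)) - min 1 (Real.exp (t * u - b))| ∂(gaussianReal 0 1)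
      ≤ ∫ u, (|s - t| * |u| + |a - b|) ∂(gaussianReal 0 1) := by
        refine integral_mono ((hm _ _).sub (hm _ _)).abs
          ((hid.const_mul _).add (integrable_const _)) fun u => ?_
        refine (abs_min_one_exp_sub_le _ _).trans ?_
        rw [← abs_mul]
        calc |s * u - a - (t * u - b)| = |(s - t) * u + (b - a)| := by ring_nf
          _ ≤ _ := (abs_add_le _ _).trans (by rw [abs_sub_comm b a])
    _ = |s - t| * ∫ u, |u| ∂(gaussianReal 0 1) + |a - b| := by
        rw [integral_add (hid.const_mul _) (integrable_const _), integral_const_mul]; simp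
    _ ≤ |s - t| + |a - b| := by
        have := mul_le_mul_of_nonneg_left integral_abs_gaussian_le (abs_nonneg (s - t))
        linarith

theorem continuous_gaussianAcceptance : Continuous gaussianAcceptance := by
  rw [continuous_iff_continuousAt]
  intro v
  have h : Tendsto (fun w => |Real.sqrt w - Real.sqrt v| + |w / 2 - v / 2|) (𝓝 v) (𝓝 0) := by
    have : Continuous fun w => |Real.sqrt w - Real.sqrt v| + |w / 2 - v / 2| := by fun_prop
    simpa using this.tendsto v
  rw [ContinuousAt, tendsto_iff_dist_tendsto_zero]
  refine squeeze_zero (fun _ => dist_nonneg) (fun w => ?_) h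
  rw [Real.dist_eq]
  exact abs_integral_min_one_exp_sub_le _ _ _ _

/-- Since `|√a - √b| ≤ √a + √b`, the square of the left side is at most `|a - b|`. No lower bound on
`a` or `b` enters, which matters when the variance tends to `0`. -/
theorem abs_sqrt_sub_sqrt_le {a b : ℝ} (ha : 0 ≤ a) (hb : 0 ≤ b) :
    |Real.sqrt a - Real.sqrt b| ≤ Real.sqrt |a - b| := by
  apply Real.le_sqrt_of_sq_le
  have h1 := Real.sq_sqrt ha
  have h2 := Real.sq_sqrt hb
  have h3 := Real.sqrt_nonneg a
  have h4 := Real.sqrt_nonneg b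
  rw [sq_abs]
  rcases le_total (Real.sqrt a) (Real.sqrt b) with h | h
  · refine le_trans ?_ (neg_le_abs _)
    nlinarith
  · refine le_trans ?_ (le_abs_self _)
    nlinarith

section Estimate

variable {ι : Type*} [Fintype ι]

/-- A coordinate of a standard Gaussian vector is independent of every linear form in which it has
coefficient `0`. -/
theorem integral_noise_coord_mul_linear [DecidableEq ι] (c : ι → ℝ) {i : ι} (hi : c i = 0)
    {g F : ℝ → ℝ} (hg : Measurable g) (hF : Measurable F) :
    ∫ z, g (z i) * F (∑ k, c k * z k) ∂(noiseMeasure ι) =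
      (∫ u, g u ∂(gaussianReal 0 1)) *
        ∫ u, F (Real.sqrt (∑ k, c k ^ 2) * u) ∂(gaussianReal 0 1) := by
  -- Giving the coordinate `i` the coefficient `1` in place of `0` puts `z i` itself in the
  -- independent family; the sum over the other indices is still the linear form.
  have h := iIndepFun_pi (μ := fun _ : ι => gaussianReal 0 1)
    (X := fun k (q : ℝ) => (if k = i then 1 else c k) * q) (fun _ => by fun_prop)
  have h2 := h.indepFun_finsetSum_of_notMem (fun k => by fun_prop)
    (Finset.notMem_erase i Finset.univ)
  have e1 : ∀ z : ι → ℝ, (∑ k ∈ Finset.univ.erase i,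
      fun z : ι → ℝ => (if k = i then 1 else c k) * z k) z = ∑ k, c k * z k := by
    intro z
    rw [Finset.sum_apply, ← Finset.add_sum_erase _ _ (Finset.mem_univ i), hi, zero_mul, zero_add]
    exact Finset.sum_congr rfl fun k hk => by rw [if_neg (Finset.ne_of_mem_erase hk)]
  have h2' : IndepFun (fun z : ι → ℝ => z i) (fun z => ∑ k, c k * z k)
      (Measure.pi fun _ : ι => gaussianReal 0 1) := by
    have := h2.symm
    rw [funext e1] at this
    simpa using this
  have h3 := (h2'.comp hg hF).integral_fun_mul_eq_mul_integral
    (hg.comp (measurable_pi_apply i)).aestronglyMeasurable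
    (hF.comp (by fun_prop)).aestronglyMeasurable
  simp only [Function.comp_def] at h3
  rw [← integral_noise_linear c hF]
  refine h3.trans ?_
  congr 1
  have h4 := measurePreserving_eval (fun _ : ι => gaussianReal 0 1) i
  have h5 := integral_map (μ := Measure.pi fun _ : ι => gaussianReal 0 1) h4.measurable.aemeasurable
    hg.aestronglyMeasurable
  rw [h4.map_eq] at h5
  exact h5.symm

end Estimate

/-- The second moment of `u² - 1` under the standard normal law. -/
def chiSqVar : ℝ :=
  ∫ q : ℝ × ℝ, (q.1 ^ 2 - 1) ^ 2 ∂((gaussianReal 0 1).prod (gaussianReal 0 1))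

/-! ### Moments of quadratic polynomials in a Gaussian pair -/

theorem memLp_poly_gaussian (a b c d : ℝ) (p : ENNReal) (hp : p ≠ ⊤) (k : ℝ) :
    MemLp (fun q : ℝ × ℝ => a * q.1 ^ 2 + b * q.2 ^ 2 + c * (q.1 * q.2) + d * q.1 + k) p
      ((gaussianReal 0 1).prod (gaussianReal 0 1)) := by
  have h2p : 2 * p ≠ ⊤ := ENNReal.mul_ne_top (by simp) hp
  have h := memLp_id_gaussianReal' (μ := 0) (v := 1) (2 * p) h2p
  have h1 : MemLp (fun q : ℝ × ℝ => q.1) (2 * p)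
    ((gaussianReal 0 1).prod (gaussianReal 0 1)) := h.comp_fst _
  have h2 : MemLp (fun q : ℝ × ℝ => q.2) (2 * p)
    ((gaussianReal 0 1).prod (gaussianReal 0 1)) := h.comp_snd _
  -- Every quadratic monomial is a product of two functions in `L^{2p}`, hence lies in `L^p` by
  -- Hölder's inequality.
  have hT : ENNReal.HolderTriple (2 * p) (2 * p) p := by
    refine ⟨?_⟩
    rw [ENNReal.mul_inv (by simp) (by simp), ← two_mul, ← mul_assoc,
      ENNReal.mul_inv_cancel (by simp) (by simp), one_mul]
  have h0 : MemLp (fun q : ℝ × ℝ => q.1) p ((gaussianReal 0 1).prod (gaussianReal 0 1)) :=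
    (memLp_id_gaussianReal' (μ := 0) (v := 1) p hp).comp_fst _
  have e1 := (h1.mul h1 (r := p)).const_mul a
  have e2 := (h2.mul h2 (r := p)).const_mul b
  have e3 := (h2.mul h1 (r := p)).const_mul c
  have := (((e1.add e2).add e3).add (h0.const_mul d)).add
    (memLp_const (μ := (gaussianReal 0 1).prod (gaussianReal 0 1)) (p := p) k)
  refine this.congr_norm ?_ (Eventually.of_forall fun q => ?_)
  · fun_prop
  · simp only [Pi.add_apply, Pi.mul_apply]
    congr 1
    ring

theorem integral_fst_sq_gaussian :
    ∫ q : ℝ × ℝ, q.1 ^ 2 ∂((gaussianReal 0 1).prod (gaussianReal 0 1)) = 1 := by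
  have h2 := variance_id_gaussianReal (μ := 0) (v := 1)
  rw [variance_of_integral_eq_zero (by fun_prop) (by simp)] at h2
  rw [integral_fun_fst (μ := gaussianReal 0 1) (ν := gaussianReal 0 1) (fun u : ℝ => u ^ 2)]
  simpa using h2

theorem integral_snd_sq_gaussian :
    ∫ q : ℝ × ℝ, q.2 ^ 2 ∂((gaussianReal 0 1).prod (gaussianReal 0 1)) = 1 := by
  have h2 := variance_id_gaussianReal (μ := 0) (v := 1)
  rw [variance_of_integral_eq_zero (by fun_prop) (by simp)] at h2
  rw [integral_fun_snd (μ := gaussianReal 0 1) (ν := gaussianReal 0 1) (fun u : ℝ => u ^ 2)]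
  simpa using h2

theorem integral_mul_gaussian :
    ∫ q : ℝ × ℝ, q.1 * q.2 ∂((gaussianReal 0 1).prod (gaussianReal 0 1)) = 0 := by
  rw [integral_prod_mul (μ := gaussianReal 0 1) (ν := gaussianReal 0 1) (fun u => u) (fun u => u)]
  simp

/-! ### Comparison with a conditionally Gaussian acceptance ratio -/

section Estimate

variable {ι : Type*} [Fintype ι]

/-- A quantitative law of large numbers for the conditional variance. The difference `X = ∑ b_k²
(ξ_k² - 1)` is centred with second moment `(∑ b_k⁴) * chiSqVar`. The square root inequality followed
by Cauchy-Schwarz twice, `E√|X| ≤ √(E|X|) ≤ √√(E X²)`, produces the fourth root. -/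
theorem integral_sqrt_sub_sqrt_le (b : ι → ℝ) :
    ∫ w, |Real.sqrt (∑ k, (b k * w.1 k) ^ 2) - Real.sqrt (∑ k, b k ^ 2)| ∂(noisePair ι) ≤
      Real.sqrt (Real.sqrt ((∑ k, b k ^ 4) * chiSqVar)) := by
  set S : ℝ × ℝ → ℝ := fun q => q.1 ^ 2 - 1 with hS
  have hSm : Measurable S := by fun_prop
  have hS2 : MemLp S 2 ((gaussianReal 0 1).prod (gaussianReal 0 1)) := by
    simpa [hS, sub_eq_add_neg] using memLp_poly_gaussian 1 0 0 0 2 (by simp) (-1)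
  have hS0 : ∫ q, S q ∂((gaussianReal 0 1).prod (gaussianReal 0 1)) = 0 := by
    have h1 : Integrable (fun q : ℝ × ℝ => q.1 ^ 2)
        ((gaussianReal 0 1).prod (gaussianReal 0 1)) := by
      simpa using (memLp_poly_gaussian 1 0 0 0 1 (by simp) 0).integrable le_rfl
    rw [hS, integral_sub h1 (integrable_const _), integral_fst_sq_gaussian]
    simp
  set X : (ι → ℝ) × (ι → ℝ) → ℝ := fun w => ∑ k, b k ^ 2 * S (w.1 k, w.2 k) with hX
  have hXL : MemLp X 2 (noisePair ι) := memLp_sum_pair _ hS2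
  have hXe : ∀ w : (ι → ℝ) × (ι → ℝ), X w = ∑ k, (b k * w.1 k) ^ 2 - ∑ k, b k ^ 2 := by
    intro w
    rw [← Finset.sum_sub_distrib]
    exact Finset.sum_congr rfl fun k _ => by simp only [hS]; ring
  have h1 : MemLp (fun w => Real.sqrt |X w|) 2 (noisePair ι) := by
    rw [memLp_two_iff_integrable_sq]
    · refine (hXL.integrable one_le_two).abs.congr (Eventually.of_forall fun w => ?_)
      simp [Real.sq_sqrt]
    · exact (Real.continuous_sqrt.comp_aestronglyMeasurable hXL.aestronglyMeasurable.norm)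
  have h2 : ∫ w, |Real.sqrt (∑ k, (b k * w.1 k) ^ 2) - Real.sqrt (∑ k, b k ^ 2)| ∂(noisePair ι) ≤
      ∫ w, |Real.sqrt (|X w|)| ∂(noisePair ι) := by
    refine integral_mono_of_nonneg (Eventually.of_forall fun _ => abs_nonneg _)
      (h1.integrable one_le_two).abs (Eventually.of_forall fun w => ?_)
    simp only
    rw [abs_of_nonneg (Real.sqrt_nonneg _), hXe]
    exact abs_sqrt_sub_sqrt_le (Finset.sum_nonneg fun _ _ => sq_nonneg _)
      (Finset.sum_nonneg fun _ _ => sq_nonneg _)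
  refine h2.trans ((integral_abs_le_sqrt h1).trans (Real.sqrt_le_sqrt ?_))
  simp_rw [Real.sq_sqrt (abs_nonneg _)]
  refine (integral_abs_sum_pair_le (fun k => b k ^ 2) hSm hS2 hS0).trans (le_of_eq ?_)
  congr 2
  exact Finset.sum_congr rfl fun k _ => by ring

/-- If the logarithm `R` of the acceptance ratio is close to a conditionally Gaussian variable and
the weight `W` is close to a function of one coordinate of the noise, then the stationary mean of
`W min(1, e^R)` is close to its Gaussian value. -/
theorem abs_integral_sub_gaussianAcceptance_le [DecidableEq ι] {D : (ι → ℝ) → ℝ} {K : ℝ}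
    (hDm : Measurable D) (hD0 : ∀ ξ, 0 ≤ D ξ) (hDK : ∀ ξ, D ξ ≤ K)
    (hD1 : ∫ ξ, D ξ ∂(noiseMeasure ι) = 1)
    {R W : (ι → ℝ) × (ι → ℝ) → ℝ} (hRm : Measurable R)
    (hWi : Integrable W (noisePair ι)) {g : ℝ → ℝ} (hgm : Measurable g)
    (hg2 : MemLp g 2 (gaussianReal 0 1)) (hg0 : ∀ u, 0 ≤ g u)
    (hg1 : ∫ u, g u ∂(gaussianReal 0 1) = 1)
    {b : ι → ℝ} {i : ι} (hbi : b i = 0)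
    (hint : Integrable (fun w => R w - (∑ k, b k * (w.1 k * w.2 k) - (∑ k, b k ^ 2) / 2))
      (noisePair ι)) :
    |∫ w, D w.1 * (W w * min 1 (Real.exp (R w))) ∂(noisePair ι) -
      gaussianAcceptance (∑ k, b k ^ 2)| ≤
      K * ((∫ w, |W w - g (w.2 i)| ∂(noisePair ι)) +
        Real.sqrt (∫ u, g u ^ 2 ∂(gaussianReal 0 1)) * Real.sqrt (∫ w,
          |R w - (∑ k, b k * (w.1 k * w.2 k) - (∑ k, b k ^ 2) / 2)| ∂(noisePair ι)) +
        Real.sqrt (Real.sqrt ((∑ k, b k ^ 4) * chiSqVar))) := by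
  set v := ∑ k, b k ^ 2 with hv
  set A : (ι → ℝ) × (ι → ℝ) → ℝ := fun w => ∑ k, b k * (w.1 k * w.2 k) - v / 2 with hA
  set h : ℝ → ℝ := fun r => min 1 (Real.exp r) with hh
  have hh0 : ∀ r, 0 ≤ h r := fun r => le_min zero_le_one (Real.exp_pos _).le
  have hh1 : ∀ r, h r ≤ 1 := fun r => min_le_left _ _
  have hhm : Measurable h := measurable_const.min Real.measurable_exp
  have hAm : Measurable A := by fun_prop
  have hK0 : 0 ≤ K := (hD0 0).trans (hDK 0)
  have hg2' : MemLp (fun w : (ι → ℝ) × (ι → ℝ) => g (w.2 i)) 2 (noisePair ι) :=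
    memLp_pair (S := fun q => g q.2) i (hg2.comp_snd _)
  have hgi : Integrable (fun w : (ι → ℝ) × (ι → ℝ) => g (w.2 i)) (noisePair ι) :=
    hg2'.integrable one_le_two
  have hgm' : Measurable fun w : (ι → ℝ) × (ι → ℝ) => g (w.2 i) := by fun_prop
  have bd : ∀ {f : (ι → ℝ) × (ι → ℝ) → ℝ}, Integrable f (noisePair ι) →
      Integrable (fun w => D w.1 * f w) (noisePair ι) := fun {f} hf =>
    hf.bdd_mul (c := K) (hDm.comp measurable_fst).aestronglyMeasurable
      (Eventually.of_forall fun w => by rw [Real.norm_of_nonneg (hD0 _)]; exact hDK _)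
  have bh : ∀ {f R : (ι → ℝ) × (ι → ℝ) → ℝ}, Measurable R → Integrable f (noisePair ι) →
      Integrable (fun w => f w * h (R w)) (noisePair ι) := fun {f R} hR hf =>
    hf.mul_bdd (c := 1) (hhm.comp hR).aestronglyMeasurable
      (Eventually.of_forall fun w => by rw [Real.norm_of_nonneg (hh0 _)]; exact hh1 _)
  have bdle : ∀ {f : (ι → ℝ) × (ι → ℝ) → ℝ}, Integrable f (noisePair ι) →
      |∫ w, D w.1 * f w ∂(noisePair ι)| ≤ K * ∫ w, |f w| ∂(noisePair ι) := by
    intro f hf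
    refine abs_integral_le_integral_abs.trans ?_
    rw [← integral_const_mul]
    refine integral_mono (bd hf).abs (hf.abs.const_mul K) fun w => ?_
    simp only [abs_mul, abs_of_nonneg (hD0 w.1)]
    exact mul_le_mul_of_nonneg_right (hDK _) (abs_nonneg _)
  set s : (ι → ℝ) × (ι → ℝ) → ℝ := fun w => Real.sqrt (∑ k, (b k * w.1 k) ^ 2) with hs
  -- `s` is the conditional standard deviation of the linear form given `ξ`, and `J` is the
  -- conditional mean of `min(1, e^A)`; both depend on `w` through `w.1` only.
  set J : (ι → ℝ) × (ι → ℝ) → ℝ := fun w => ∫ u, h (s w * u - v / 2) ∂(gaussianReal 0 1) with hJ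
  have hJm : StronglyMeasurable J := by
    refine StronglyMeasurable.integral_prod_right
      (f := fun (w : (ι → ℝ) × (ι → ℝ)) (u : ℝ) => h (s w * u - v / 2)) ?_
    exact (hhm.comp (by fun_prop)).stronglyMeasurable
  have hJi : Integrable J (noisePair ι) := by
    refine (integrable_const (1 : ℝ)).mono' hJm.aestronglyMeasurable
      (Eventually.of_forall fun w => ?_)
    rw [Real.norm_of_nonneg (integral_nonneg fun u => hh0 _)]
    have : ∫ u, h (s w * u - v / 2) ∂(gaussianReal 0 1) ≤ ∫ u, (1 : ℝ) ∂(gaussianReal 0 1) :=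
      integral_mono (integrable_min_one_exp (by fun_prop)) (integrable_const _) fun u => hh1 _
    simpa using this
  -- Conditioning on `ξ`: since `b i = 0`, the factor `g (z i)` is independent of the linear form
  -- and contributes its mean `1`.
  have eB : ∫ w, D w.1 * (g (w.2 i) * h (A w)) ∂(noisePair ι) =
      ∫ w, D w.1 * J w ∂(noisePair ι) := by
    rw [noisePair, integral_prod _ (bd (bh hAm hgi)), integral_prod _ (bd hJi)]
    refine integral_congr_ae (Eventually.of_forall fun ξ => ?_)
    simp only [integral_const_mul]
    congr 1
    have := integral_noise_coord_mul_linear (fun k => b k * ξ k) (i := i) (by simp [hbi]) hgm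
      (F := fun r => h (r - v / 2)) (by fun_prop)
    rw [hg1, one_mul] at this
    simp only [hA, hJ, hs, integral_const, probReal_univ, one_smul]
    rw [← this]
    refine integral_congr_ae (Eventually.of_forall fun z => ?_)
    simp only [mul_assoc]
  have eD : ∫ w, D w.1 ∂(noisePair ι) = 1 := by
    rw [noisePair, integral_fun_fst, hD1]; simp
  have i1 := bh hRm hWi
  have i2 := bh hAm hgi
  have iD : Integrable (fun w : (ι → ℝ) × (ι → ℝ) => D w.1 * 1) (noisePair ι) :=
    bd (integrable_const _)
  set Ψ := gaussianAcceptance v with hΨ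
  -- Two errors: replacing `W, R` by their leading parts, and replacing the conditional variance by
  -- `v`. Since `D` has integral `1`, the constant `Ψ` can be moved under the integral.
  have split : ∫ w, D w.1 * (W w * h (R w)) ∂(noisePair ι) - Ψ =
      ∫ w, D w.1 * (W w * h (R w) - g (w.2 i) * h (A w)) ∂(noisePair ι) +
        ∫ w, D w.1 * (J w - Ψ) ∂(noisePair ι) := by
    simp_rw [mul_sub]
    rw [integral_sub (bd i1) (bd i2), integral_sub (bd hJi) (bd (integrable_const _)), eB,
      integral_mul_const, eD]
    ring
  rw [split]
  refine (abs_add_le _ _).trans ((add_le_add (bdle (i1.sub i2))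
    (bdle (hJi.sub (integrable_const _)))).trans ?_)
  rw [← mul_add]
  refine mul_le_mul_of_nonneg_left ?_ hK0
  refine add_le_add ?_ ?_
  · have p1 : MemLp (fun w => |h (R w) - h (A w)|) 2 (noisePair ι) := by
      refine MemLp.of_bound ((hhm.comp hRm).sub (hhm.comp hAm)).abs.aestronglyMeasurable 1
        (Eventually.of_forall fun w => ?_)
      rw [Real.norm_of_nonneg (abs_nonneg _)]
      exact abs_min_one_exp_sub_le_one _ _
    -- The difference is at most `1` and at most `|R - A|`, so its square is at most `|R - A|`. An
    -- `L¹` bound of `R - A` therefore suffices although the unbounded weight `g` forces the use of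
    -- Cauchy-Schwarz.
    have p2 : ∫ w, |h (R w) - h (A w)| ^ 2 ∂(noisePair ι) ≤
        ∫ w, |R w - A w| ∂(noisePair ι) := by
      refine integral_mono p1.integrable_sq hint.abs fun w => ?_
      have q1 := abs_min_one_exp_sub_le (R w) (A w)
      have q2 := abs_min_one_exp_sub_le_one (R w) (A w)
      simp only [hh]
      rw [sq]
      nlinarith [abs_nonneg (min 1 (Real.exp (R w)) - min 1 (Real.exp (A w)))]
    calc ∫ w, |W w * h (R w) - g (w.2 i) * h (A w)| ∂(noisePair ι)
        ≤ ∫ w, (|W w - g (w.2 i)| + g (w.2 i) * |h (R w) - h (A w)|) ∂(noisePair ι) := by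
          refine integral_mono (i1.sub i2).abs
            ((hWi.sub hgi).abs.add (hg2'.integrable_mul p1)) fun w => ?_
          calc |W w * h (R w) - g (w.2 i) * h (A w)|
              = |(W w - g (w.2 i)) * h (R w) + g (w.2 i) * (h (R w) - h (A w))| := by ring_nf
            _ ≤ |W w - g (w.2 i)| * h (R w) + g (w.2 i) * |h (R w) - h (A w)| := by
                refine (abs_add_le _ _).trans ?_
                rw [abs_mul, abs_mul, abs_of_nonneg (hh0 _), abs_of_nonneg (hg0 _)]
            _ ≤ _ := by
                have := mul_le_mul_of_nonneg_left (hh1 (R w)) (abs_nonneg (W w - g (w.2 i)))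
                simp only [mul_one] at this
                simpa using this
      _ = ∫ w, |W w - g (w.2 i)| ∂(noisePair ι) +
          ∫ w, g (w.2 i) * |h (R w) - h (A w)| ∂(noisePair ι) :=
          integral_add (hWi.sub hgi).abs (hg2'.integrable_mul p1)
      _ ≤ _ := by
          gcongr
          refine (integral_mul_le_sqrt hg2' p1).trans ?_
          have e3 : ∫ w : (ι → ℝ) × (ι → ℝ), g (w.2 i) ^ 2 ∂(noisePair ι) =
              ∫ u, g u ^ 2 ∂(gaussianReal 0 1) := by
            rw [integral_pair i (S := fun q => g q.2 ^ 2) (by fun_prop),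
              integral_fun_snd (μ := gaussianReal 0 1) (ν := gaussianReal 0 1) (fun u => g u ^ 2)]
            simp
          rw [e3]
          gcongr
  · refine le_trans ?_ (integral_sqrt_sub_sqrt_le b)
    refine integral_mono_of_nonneg (Eventually.of_forall fun _ => abs_nonneg _) ?_
      (Eventually.of_forall fun w => ?_)
    · have hs2 : MemLp s 2 (noisePair ι) := by
        rw [memLp_two_iff_integrable_sq (by fun_prop)]
        have : Integrable (fun w : (ι → ℝ) × (ι → ℝ) => ∑ k, (b k * w.1 k) ^ 2)
            (noisePair ι) := by
          refine integrable_finsetSum _ fun k _ => ?_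
          exact (((memLp_coord 2 (by simp) k).1).const_mul (b k)).integrable_sq
        refine this.congr (Eventually.of_forall fun w => ?_)
        simp only [hs]
        rw [Real.sq_sqrt (Finset.sum_nonneg fun _ _ => sq_nonneg _)]
      exact ((hs2.integrable one_le_two).sub (integrable_const _)).abs
    · have := abs_integral_min_one_exp_sub_le (s w) (Real.sqrt v) (v / 2) (v / 2)
      simp only [sub_self, abs_zero, add_zero] at this
      exact this

end Estimate

/-- The coefficient of `ξ z` in the leading part of the logarithm of the acceptance ratio. -/
def Algorithm.lead (alg : Algorithm) (η : ℝ) : ℝ :=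
  match alg with
  | .rwm => -η
  | .sla => -(η ^ 3 / 4)

/-- The factor of `η ^ r` in the limiting variance. -/
def Algorithm.varFactor : Algorithm → ℝ
  | .rwm => 1
  | .sla => 1 / 16

theorem Algorithm.lead_sq (alg : Algorithm) (η : ℝ) :
    alg.lead η ^ 2 = alg.varFactor * η ^ alg.power := by
  cases alg <;> simp only [lead, varFactor, power] <;> ring

theorem Algorithm.abs_lead_le (alg : Algorithm) {η : ℝ} (h0 : 0 ≤ η) (h1 : η ≤ 1) :
    |alg.lead η| ≤ η := by
  cases alg with
  | rwm => simp [lead, abs_of_nonneg h0]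
  | sla =>
    simp only [lead, abs_neg]
    rw [abs_of_nonneg (by positivity)]
    have : η ^ 3 ≤ η ^ 1 := pow_le_pow_of_le_one h0 h1 (by norm_num)
    linarith

/-- Fourth powers gain a factor `m²` over the variance terms `η ^ r`; this is what makes the
conditional variance concentrate. -/
theorem Algorithm.lead_pow_four_le (alg : Algorithm) {η m : ℝ} (h0 : 0 ≤ η) (h1 : η ≤ m)
    (hm : m ≤ 1) : alg.lead η ^ 4 ≤ m ^ 2 * η ^ alg.power := by
  have hη := h1.trans hm
  have e : alg.lead η ^ 4 = |alg.lead η| ^ 2 * alg.lead η ^ 2 := by rw [sq_abs]; ring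
  have h2 : |alg.lead η| ^ 2 ≤ m ^ 2 :=
    pow_le_pow_left₀ (abs_nonneg _) ((alg.abs_lead_le h0 hη).trans h1) 2
  have h3 : alg.lead η ^ 2 ≤ η ^ alg.power := by
    rw [alg.lead_sq]
    have : 0 ≤ η ^ alg.power := pow_nonneg h0 _
    cases alg <;> simp only [varFactor] <;> linarith
  rw [e]
  gcongr

theorem integral_abs_add_three_le {Ω : Type*} [MeasurableSpace Ω] {μ : Measure Ω}
    {f g h : Ω → ℝ} (hf : Integrable f μ) (hg : Integrable g μ) (hh : Integrable h μ) :
    ∫ w, |f w + g w + h w| ∂μ ≤ ∫ w, |f w| ∂μ + ∫ w, |g w| ∂μ + ∫ w, |h w| ∂μ := by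
  have hfg : Integrable (fun w => |f w| + |g w|) μ := hf.abs.add hg.abs
  rw [← integral_add hf.abs hg.abs, ← integral_add hfg hh.abs]
  exact integral_mono ((hf.add hg).add hh).abs (hfg.add hh.abs) fun w => abs_add_three _ _ _

/-! ### The remainder of the acceptance ratio and the error bounds for acceptance and jump -/

section Remainder

variable {ι : Type*} [Fintype ι]

/-- The logarithm of the acceptance ratio of the reference law minus its leading part. -/
def ratioRemainder (alg : Algorithm) (η : ι → ℝ) (w : (ι → ℝ) × (ι → ℝ)) : ℝ :=
  ∑ k, alg.logRatio (η k) (w.1 k) (w.2 k) -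
    (∑ k, alg.lead (η k) * (w.1 k * w.2 k) - (∑ k, alg.lead (η k) ^ 2) / 2)

/-- The constant in the bound of the remainder. -/
def remainderConst : ℝ :=
  Real.sqrt (∫ q : ℝ × ℝ, (q.2 ^ 2 - 1) ^ 2 ∂((gaussianReal 0 1).prod (gaussianReal 0 1))) +
  Real.sqrt (∫ q : ℝ × ℝ, (q.1 ^ 2 - q.2 ^ 2) ^ 2 ∂((gaussianReal 0 1).prod (gaussianReal 0 1))) +
  Real.sqrt (∫ q : ℝ × ℝ, (q.1 * q.2) ^ 2 ∂((gaussianReal 0 1).prod (gaussianReal 0 1))) +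
  Real.sqrt (∫ q : ℝ × ℝ, (q.1 ^ 2 - 1) ^ 2 ∂((gaussianReal 0 1).prod (gaussianReal 0 1)))

theorem memLp_gaussian_fst_sq_sub_one :
    MemLp (fun q : ℝ × ℝ => q.1 ^ 2 - 1) 2 ((gaussianReal 0 1).prod (gaussianReal 0 1)) := by
  simpa [sub_eq_add_neg] using memLp_poly_gaussian 1 0 0 0 2 (by simp) (-1)

theorem memLp_gaussian_snd_sq_sub_one :
    MemLp (fun q : ℝ × ℝ => q.2 ^ 2 - 1) 2 ((gaussianReal 0 1).prod (gaussianReal 0 1)) := by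
  simpa [sub_eq_add_neg] using memLp_poly_gaussian 0 1 0 0 2 (by simp) (-1)

theorem memLp_gaussian_sq_sub_sq :
    MemLp (fun q : ℝ × ℝ => q.1 ^ 2 - q.2 ^ 2) 2
      ((gaussianReal 0 1).prod (gaussianReal 0 1)) := by
  simpa [sub_eq_add_neg] using memLp_poly_gaussian 1 (-1) 0 0 2 (by simp) 0

theorem memLp_gaussian_mul :
    MemLp (fun q : ℝ × ℝ => q.1 * q.2) 2 ((gaussianReal 0 1).prod (gaussianReal 0 1)) := by
  simpa using memLp_poly_gaussian 0 0 1 0 2 (by simp) 0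

theorem integrable_gaussian_fst_sq :
    Integrable (fun q : ℝ × ℝ => q.1 ^ 2) ((gaussianReal 0 1).prod (gaussianReal 0 1)) := by
  simpa using (memLp_poly_gaussian 1 0 0 0 1 (by simp) 0).integrable le_rfl

theorem integrable_gaussian_snd_sq :
    Integrable (fun q : ℝ × ℝ => q.2 ^ 2) ((gaussianReal 0 1).prod (gaussianReal 0 1)) := by
  simpa using (memLp_poly_gaussian 0 1 0 0 1 (by simp) 0).integrable le_rfl

theorem integral_gaussian_fst_sq_sub_one :
    ∫ q : ℝ × ℝ, (q.1 ^ 2 - 1) ∂((gaussianReal 0 1).prod (gaussianReal 0 1)) = 0 := by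
  rw [integral_sub integrable_gaussian_fst_sq (integrable_const _), integral_fst_sq_gaussian]
  simp

theorem integral_gaussian_snd_sq_sub_one :
    ∫ q : ℝ × ℝ, (q.2 ^ 2 - 1) ∂((gaussianReal 0 1).prod (gaussianReal 0 1)) = 0 := by
  rw [integral_sub integrable_gaussian_snd_sq (integrable_const _), integral_snd_sq_gaussian]
  simp

theorem integral_gaussian_sq_sub_sq :
    ∫ q : ℝ × ℝ, (q.1 ^ 2 - q.2 ^ 2) ∂((gaussianReal 0 1).prod (gaussianReal 0 1)) = 0 := by
  rw [integral_sub integrable_gaussian_fst_sq integrable_gaussian_snd_sq,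
    integral_fst_sq_gaussian, integral_snd_sq_gaussian]
  simp

theorem integral_abs_sum_pair_le_of_le {a : ι → ℝ} {S : ℝ × ℝ → ℝ} (hS : Measurable S)
    (hS2 : MemLp S 2 ((gaussianReal 0 1).prod (gaussianReal 0 1)))
    (h0 : ∫ q, S q ∂((gaussianReal 0 1).prod (gaussianReal 0 1)) = 0) {m s : ℝ} (hm : 0 ≤ m)
    (ha : ∑ i, a i ^ 2 ≤ m ^ 2 * s) :
    ∫ w, |∑ i, a i * S (w.1 i, w.2 i)| ∂(noisePair ι) ≤ m * Real.sqrt s *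
      Real.sqrt (∫ q, S q ^ 2 ∂((gaussianReal 0 1).prod (gaussianReal 0 1))) := by
  refine (integral_abs_sum_pair_le a hS hS2 h0).trans ?_
  rw [Real.sqrt_mul (Finset.sum_nonneg fun _ _ => sq_nonneg _)]
  gcongr
  refine (Real.sqrt_le_sqrt ha).trans (le_of_eq ?_)
  rw [Real.sqrt_mul (sq_nonneg m), Real.sqrt_sq hm]

/-- The term `-lead² / 2` absorbs exactly the mean of each coordinate, so the remainder consists of
centred weighted sums. Their `L¹` norms are bounded by their `L²` norms, where only the squares of
the weights are summed. -/
theorem ratioRemainder_bound (alg : Algorithm) {η : ι → ℝ} {m : ℝ} (h0 : ∀ k, 0 ≤ η k)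
    (h1 : ∀ k, η k ≤ m) (hm0 : 0 ≤ m) (hm : m ≤ 1) :
    Integrable (ratioRemainder alg η) (noisePair ι) ∧
      ∫ w, |ratioRemainder alg η w| ∂(noisePair ι) ≤
        remainderConst * (m * Real.sqrt (∑ k, η k ^ alg.power)) := by
  set s := ∑ k, η k ^ alg.power with hs
  have hs0 : 0 ≤ s := Finset.sum_nonneg fun k _ => pow_nonneg (h0 k) _
  -- The condition on `n` says that the squared weight `η^{2n}` has at least two powers more than `η
  -- ^ r`; these give the factor `m²`. Equality holds for `n = 2` in RWM and `n = 4` in SLA.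
  have hle : ∀ (c : ℝ) (n : ℕ), c ^ 2 ≤ 1 → alg.power + 2 ≤ 2 * n →
      ∑ k, (c * η k ^ n) ^ 2 ≤ m ^ 2 * s := by
    intro c n hc hn
    rw [hs, Finset.mul_sum]
    refine Finset.sum_le_sum fun k _ => ?_
    have e1 : (c * η k ^ n) ^ 2 = c ^ 2 * η k ^ (2 * n) := by ring
    have e2 : η k ^ (2 * n) ≤ η k ^ (alg.power + 2) :=
      pow_le_pow_of_le_one (h0 k) ((h1 k).trans hm) hn
    have e3 : η k ^ (alg.power + 2) ≤ m ^ 2 * η k ^ alg.power := by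
      rw [pow_add, mul_comm]
      exact mul_le_mul_of_nonneg_right (pow_le_pow_left₀ (h0 k) (h1 k) 2) (pow_nonneg (h0 k) _)
    have e4 : 0 ≤ η k ^ (2 * n) := pow_nonneg (h0 k) _
    rw [e1]
    nlinarith
  have hq : 0 ≤ m * Real.sqrt s := by positivity
  cases alg with
  | rwm =>
    set X : (ι → ℝ) × (ι → ℝ) → ℝ := fun w =>
      ∑ k, ((-1 / 2) * η k ^ 2) * ((fun q : ℝ × ℝ => q.2 ^ 2 - 1) (w.1 k, w.2 k)) with hX
    have hXe : ratioRemainder .rwm η = X := by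
      ext w
      simp only [ratioRemainder, hX, Algorithm.logRatio, Algorithm.lead, Finset.sum_div,
        ← Finset.sum_sub_distrib]
      exact Finset.sum_congr rfl fun k _ => by ring
    rw [hXe]
    refine ⟨(memLp_sum_pair _ memLp_gaussian_snd_sq_sub_one).integrable one_le_two,
      (integral_abs_sum_pair_le_of_le (by fun_prop) memLp_gaussian_snd_sq_sub_one
        integral_gaussian_snd_sq_sub_one hm0 (hle (-1 / 2) 2 (by norm_num) (by
          simp [Algorithm.power]))).trans ?_⟩
    rw [mul_comm]
    refine mul_le_mul_of_nonneg_right ?_ hq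
    rw [remainderConst, add_assoc, add_assoc]
    exact le_add_of_nonneg_right (by positivity)
  | sla =>
    -- The exact expansion for SLA. The term in `η⁴` is centred because `ξ` and `z` have the same
    -- variance; it does not enter the limit although its order is lower than that of `lead² = η⁶ /
    -- 16`.
    set X : (ι → ℝ) × (ι → ℝ) → ℝ := fun w =>
      ∑ k, ((1 / 8) * η k ^ 4) * ((fun q : ℝ × ℝ => q.1 ^ 2 - q.2 ^ 2) (w.1 k, w.2 k)) with hX
    set Y : (ι → ℝ) × (ι → ℝ) → ℝ := fun w =>
      ∑ k, ((1 / 8) * η k ^ 5) * ((fun q : ℝ × ℝ => q.1 * q.2) (w.1 k, w.2 k)) with hY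
    set Z : (ι → ℝ) × (ι → ℝ) → ℝ := fun w =>
      ∑ k, ((-1 / 32) * η k ^ 6) * ((fun q : ℝ × ℝ => q.1 ^ 2 - 1) (w.1 k, w.2 k)) with hZ
    have hXe : ratioRemainder .sla η = fun w => X w + Y w + Z w := by
      ext w
      simp only [ratioRemainder, hX, hY, hZ, Algorithm.logRatio, Algorithm.lead, Finset.sum_div,
        ← Finset.sum_sub_distrib, ← Finset.sum_add_distrib]
      exact Finset.sum_congr rfl fun k _ => by ring
    have iX : Integrable X (noisePair ι) :=
      (memLp_sum_pair _ memLp_gaussian_sq_sub_sq).integrable one_le_two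
    have iY : Integrable Y (noisePair ι) :=
      (memLp_sum_pair _ memLp_gaussian_mul).integrable one_le_two
    have iZ : Integrable Z (noisePair ι) :=
      (memLp_sum_pair _ memLp_gaussian_fst_sq_sub_one).integrable one_le_two
    have bX := integral_abs_sum_pair_le_of_le (by fun_prop) memLp_gaussian_sq_sub_sq
      integral_gaussian_sq_sub_sq hm0 (hle (1 / 8) 4 (by norm_num) (by simp [Algorithm.power]))
    have bY := integral_abs_sum_pair_le_of_le (by fun_prop) memLp_gaussian_mul
      integral_mul_gaussian hm0 (hle (1 / 8) 5 (by norm_num) (by simp [Algorithm.power]))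
    have bZ := integral_abs_sum_pair_le_of_le (by fun_prop) memLp_gaussian_fst_sq_sub_one
      integral_gaussian_fst_sq_sub_one hm0
      (hle (-1 / 32) 6 (by norm_num) (by simp [Algorithm.power]))
    rw [hXe]
    refine ⟨(iX.add iY).add iZ, ?_⟩
    calc ∫ w, |X w + Y w + Z w| ∂(noisePair ι)
        ≤ ∫ w, |X w| ∂(noisePair ι) + ∫ w, |Y w| ∂(noisePair ι) + ∫ w, |Z w| ∂(noisePair ι) :=
          integral_abs_add_three_le iX iY iZ
      _ ≤ _ := add_le_add (add_le_add bX bY) bZ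
      _ ≤ _ := by
          rw [← mul_add, ← mul_add, mul_comm]
          refine mul_le_mul_of_nonneg_right ?_ hq
          rw [remainderConst, add_assoc, add_assoc, add_assoc]
          exact le_add_of_nonneg_left (by positivity)

theorem integral_abs_coord_mul_le (i : ι) :
    ∫ w : (ι → ℝ) × (ι → ℝ), |w.1 i * w.2 i| ∂(noisePair ι) ≤ 1 := by
  have h := integral_pair (ι := ι) i (S := fun q => |q.1 * q.2|) (by fun_prop)
  simp only at h
  rw [h]
  simp_rw [abs_mul]
  rw [integral_prod_mul (μ := gaussianReal 0 1) (ν := gaussianReal 0 1) (fun u => |u|)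
    (fun u => |u|)]
  have h1 := integral_abs_gaussian_le
  have h2 : 0 ≤ ∫ u, |u| ∂(gaussianReal 0 1) := integral_nonneg fun u => abs_nonneg u
  exact mul_le_one₀ h1 h2 h1

theorem integral_coord_sq (i : ι) :
    ∫ w : (ι → ℝ) × (ι → ℝ), w.1 i ^ 2 ∂(noisePair ι) = 1 :=
  (integral_pair (ι := ι) i (S := fun q => q.1 ^ 2) (by fun_prop)).trans integral_fst_sq_gaussian

theorem integrable_coord_mul (i : ι) :
    Integrable (fun w : (ι → ℝ) × (ι → ℝ) => w.1 i * w.2 i) (noisePair ι) :=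
  (memLp_coord 2 (by simp) i).1.integrable_mul (memLp_coord 2 (by simp) i).2

/-- The bound of `abs_weighted_acceptance_sub_le`. -/
def acceptanceError (K G ε m s : ℝ) : ℝ :=
  K * (2 * m + Real.sqrt G * Real.sqrt (ε + 2 * m + remainderConst * (m * Real.sqrt s)) +
    Real.sqrt (Real.sqrt (m ^ 2 * s * chiSqVar)))

/-- The common source of the two estimates that follow: `W = 1` for the acceptance and `W` the
squared standardised increment for the jump. The coordinate `i` is removed from the leading form,
which changes `R` by at most `2 * m` in `L¹` and subtracts one `lead²` from the variance. -/
theorem abs_weighted_acceptance_sub_le [DecidableEq ι] (alg : Algorithm) {sd : ι → ℝ}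
    (hsd : ∀ i, 0 < sd i) {σ : ℝ} (hσ : 0 < σ) {phi : (ι → ℝ) → ℝ} (hphi : Measurable phi) {K : ℝ}
    (hK : ∀ ξ, relDensity sd phi ξ ≤ K)
    (hD1 : ∫ ξ, relDensity sd phi ξ ∂(noiseMeasure ι) = 1)
    {m ε : ℝ} (hm : m ≤ 1) (hη : ∀ k, σ / sd k ≤ m)
    (hφi : Integrable (fun w => phi (rescale sd w.1) -
      phi (proposal alg sd σ (rescale sd w.1) w.2)) (noisePair ι))
    (hφ : ∫ w, |phi (rescale sd w.1) - phi (proposal alg sd σ (rescale sd w.1) w.2)|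
      ∂(noisePair ι) ≤ ε) (i : ι)
    {W : (ι → ℝ) × (ι → ℝ) → ℝ} (hWi : Integrable W (noisePair ι)) {g : ℝ → ℝ} (hgm : Measurable g)
    (hg2 : MemLp g 2 (gaussianReal 0 1)) (hg0 : ∀ u, 0 ≤ g u)
    (hg1 : ∫ u, g u ∂(gaussianReal 0 1) = 1)
    (hWg : ∫ w, |W w - g (w.2 i)| ∂(noisePair ι) ≤ 2 * m) :
    |∫ w, relDensity sd phi w.1 * (W w * min 1 (Real.exp (logAccept alg sd phi σ w)))
        ∂(noisePair ι) -
      gaussianAcceptance (alg.varFactor * ∑ k, (σ / sd k) ^ alg.power - alg.lead (σ / sd i) ^ 2)| ≤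
      acceptanceError K (∫ u, g u ^ 2 ∂(gaussianReal 0 1)) ε m
        (∑ k, (σ / sd k) ^ alg.power) := by
  set η : ι → ℝ := fun k => σ / sd k with hηdef
  have hη0 : ∀ k, 0 ≤ η k := fun k => (div_pos hσ (hsd k)).le
  have hm0 : 0 ≤ m := (hη0 i).trans (hη i)
  set s := ∑ k, η k ^ alg.power with hs
  set b : ι → ℝ := Function.update (fun k => alg.lead (η k)) i 0 with hb
  have hbi : b i = 0 := by simp [hb]
  have sum_upd : ∀ F : ι → ℝ → ℝ, F i 0 = 0 → ∑ k, F k (b k) =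
      ∑ k, F k (alg.lead (η k)) - F i (alg.lead (η i)) := by
    intro F hF
    rw [← Finset.add_sum_erase _ _ (Finset.mem_univ i), ← Finset.add_sum_erase _
      (fun k => F k (alg.lead (η k))) (Finset.mem_univ i), hbi, hF, zero_add, add_sub_cancel_left]
    refine Finset.sum_congr rfl fun k hk => ?_
    rw [hb, Function.update_of_ne (Finset.ne_of_mem_erase hk)]
  have hv : ∑ k, b k ^ 2 = alg.varFactor * s - alg.lead (η i) ^ 2 := by
    rw [sum_upd (fun _ r => r ^ 2) (by simp), hs, Finset.mul_sum]
    simp_rw [alg.lead_sq]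
  have hR : ∀ w : (ι → ℝ) × (ι → ℝ), logAccept alg sd phi σ w -
      (∑ k, b k * (w.1 k * w.2 k) - (∑ k, b k ^ 2) / 2) =
      (phi (rescale sd w.1) - phi (proposal alg sd σ (rescale sd w.1) w.2)) +
        ratioRemainder alg η w + (alg.lead (η i) * (w.1 i * w.2 i) - alg.lead (η i) ^ 2 / 2) := by
    intro w
    rw [logAccept, ratioRemainder, sum_upd (fun _ r => r ^ 2) (by simp),
      sum_upd (fun k r => r * (w.1 k * w.2 k)) (by simp)]
    ring
  have hrem := ratioRemainder_bound alg hη0 hη hm0 hm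
  have i3 : Integrable (fun w : (ι → ℝ) × (ι → ℝ) =>
      alg.lead (η i) * (w.1 i * w.2 i) - alg.lead (η i) ^ 2 / 2) (noisePair ι) :=
    ((integrable_coord_mul i).const_mul _).sub (integrable_const _)
  have hL : |alg.lead (η i)| ≤ m := (alg.abs_lead_le (hη0 i) ((hη i).trans hm)).trans (hη i)
  have b3 : ∫ w : (ι → ℝ) × (ι → ℝ),
      |alg.lead (η i) * (w.1 i * w.2 i) - alg.lead (η i) ^ 2 / 2| ∂(noisePair ι) ≤ 2 * m := by
    calc _ ≤ ∫ w : (ι → ℝ) × (ι → ℝ), (|alg.lead (η i)| * |w.1 i * w.2 i| +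
          |alg.lead (η i) ^ 2 / 2|) ∂(noisePair ι) := by
          refine integral_mono i3.abs (((integrable_coord_mul i).abs.const_mul _).add
            (integrable_const _)) fun w => ?_
          simp only [← abs_mul]
          exact abs_sub _ _
      _ = |alg.lead (η i)| * ∫ w : (ι → ℝ) × (ι → ℝ), |w.1 i * w.2 i| ∂(noisePair ι) +
          |alg.lead (η i) ^ 2 / 2| := by
          rw [integral_add ((integrable_coord_mul i).abs.const_mul _) (integrable_const _),
            integral_const_mul]
          simp
      _ ≤ m * 1 + m := by
          refine add_le_add (mul_le_mul hL (integral_abs_coord_mul_le i)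
            (integral_nonneg fun _ => abs_nonneg _) hm0) ?_
          rw [abs_of_nonneg (by positivity), ← sq_abs]
          nlinarith [abs_nonneg (alg.lead (η i))]
      _ = 2 * m := by ring
  have hint : Integrable (fun w => logAccept alg sd phi σ w -
      (∑ k, b k * (w.1 k * w.2 k) - (∑ k, b k ^ 2) / 2)) (noisePair ι) := by
    simp_rw [hR]
    exact (hφi.add hrem.1).add i3
  have hbound : ∫ w, |logAccept alg sd phi σ w -
      (∑ k, b k * (w.1 k * w.2 k) - (∑ k, b k ^ 2) / 2)| ∂(noisePair ι) ≤
      ε + 2 * m + remainderConst * (m * Real.sqrt s) := by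
    simp_rw [hR]
    calc _ ≤ _ := integral_abs_add_three_le hφi hrem.1 i3
      _ ≤ ε + remainderConst * (m * Real.sqrt s) + 2 * m := add_le_add (add_le_add hφ hrem.2) b3
      _ = _ := by ring
  have hb4 : ∑ k, b k ^ 4 ≤ m ^ 2 * s := by
    rw [hs, Finset.mul_sum]
    refine Finset.sum_le_sum fun k _ => ?_
    by_cases hk : k = i
    · subst hk
      rw [hbi, zero_pow (by norm_num)]
      have := pow_nonneg (hη0 k) alg.power
      positivity
    · rw [hb, Function.update_of_ne hk]
      exact alg.lead_pow_four_le (hη0 k) (hη k) hm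
  have hK0 : 0 ≤ K := le_trans (by unfold relDensity; positivity) (hK 0)
  have main := abs_integral_sub_gaussianAcceptance_le (measurable_relDensity sd hphi)
    (fun ξ => by unfold relDensity; positivity) hK hD1 (measurable_logAccept alg hsd hphi σ) hWi hgm
    hg2 hg0 hg1 hbi hint
  rw [hv] at main
  refine main.trans ?_
  rw [acceptanceError]
  have hc : 0 ≤ chiSqVar := integral_nonneg fun _ => sq_nonneg _
  rw [hv] at hbound
  gcongr

theorem abs_acceptance_sub_le [DecidableEq ι] (alg : Algorithm) {sd : ι → ℝ}
    (hsd : ∀ i, 0 < sd i) {σ : ℝ} (hσ : 0 < σ) {phi : (ι → ℝ) → ℝ} (hphi : Measurable phi) {K : ℝ}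
    (hZ : 0 < ∫ x, Real.exp (-phi x) ∂(refMeasure sd))
    (hK : ∀ ξ, relDensity sd phi ξ ≤ K)
    (hD1 : ∫ ξ, relDensity sd phi ξ ∂(noiseMeasure ι) = 1)
    {m ε : ℝ} (hm : m ≤ 1) (hη : ∀ k, σ / sd k ≤ m)
    (hφi : Integrable (fun w => phi (rescale sd w.1) -
      phi (proposal alg sd σ (rescale sd w.1) w.2)) (noisePair ι))
    (hφ : ∫ w, |phi (rescale sd w.1) - phi (proposal alg sd σ (rescale sd w.1) w.2)|
      ∂(noisePair ι) ≤ ε) (i : ι) :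
    |meanAcceptance alg sd phi σ -
      gaussianAcceptance (alg.varFactor * ∑ k, (σ / sd k) ^ alg.power - alg.lead (σ / sd i) ^ 2)| ≤
      acceptanceError K 1 ε m (∑ k, (σ / sd k) ^ alg.power) := by
  have hm0 : 0 ≤ m := (div_pos hσ (hsd i)).le.trans (hη i)
  have := abs_weighted_acceptance_sub_le alg hsd hσ hphi hK hD1 hm hη hφi hφ i
    (W := fun _ => 1) (integrable_const _) (g := fun _ => 1) measurable_const (memLp_const _)
    (fun _ => zero_le_one) (by simp) (by simpa using hm0)
  rw [meanAcceptance_eq alg hsd hσ hphi hZ]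
  simpa using this

/-- The fourth moment of the standard normal law. -/
def fourthMoment : ℝ := ∫ u, (u ^ 2) ^ 2 ∂(gaussianReal 0 1)

theorem abs_squaredJump_sub_le [DecidableEq ι] (alg : Algorithm) {sd : ι → ℝ}
    (hsd : ∀ i, 0 < sd i) {σ : ℝ} (hσ : 0 < σ) {phi : (ι → ℝ) → ℝ} (hphi : Measurable phi) {K : ℝ}
    (hZ : 0 < ∫ x, Real.exp (-phi x) ∂(refMeasure sd))
    (hK : ∀ ξ, relDensity sd phi ξ ≤ K)
    (hD1 : ∫ ξ, relDensity sd phi ξ ∂(noiseMeasure ι) = 1)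
    {m ε : ℝ} (hm : m ≤ 1) (hη : ∀ k, σ / sd k ≤ m)
    (hφi : Integrable (fun w => phi (rescale sd w.1) -
      phi (proposal alg sd σ (rescale sd w.1) w.2)) (noisePair ι))
    (hφ : ∫ w, |phi (rescale sd w.1) - phi (proposal alg sd σ (rescale sd w.1) w.2)|
      ∂(noisePair ι) ≤ ε) (i : ι) :
    |squaredJump alg sd phi σ i - σ ^ 2 *
      gaussianAcceptance (alg.varFactor * ∑ k, (σ / sd k) ^ alg.power - alg.lead (σ / sd i) ^ 2)| ≤
      σ ^ 2 * acceptanceError K fourthMoment ε m (∑ k, (σ / sd k) ^ alg.power) := by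
  have hη0 : 0 ≤ σ / sd i := (div_pos hσ (hsd i)).le
  have hm0 : 0 ≤ m := hη0.trans (hη i)
  have hd : |alg.drift| ≤ 1 / 2 := by
    cases alg <;> simp only [Algorithm.drift] <;> norm_num [abs_of_nonneg]
  have hu : ∫ u, u ^ 2 ∂(gaussianReal 0 1) = 1 := by
    have h2 := variance_id_gaussianReal (μ := 0) (v := 1)
    rw [variance_of_integral_eq_zero (by fun_prop) (by simp)] at h2
    simpa using h2
  -- The drift perturbs `z_i²` by `2c ξ_i z_i + c² ξ_i²`, of `L¹` norm at most `2|c| + c² ≤ 2m`.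
  have hc : |alg.drift * (σ / sd i)| ≤ m / 2 := by
    rw [abs_mul, abs_of_nonneg hη0]
    nlinarith [hη i, abs_nonneg alg.drift]
  set c := alg.drift * (σ / sd i) with hcdef
  have i1 : Integrable (fun w : (ι → ℝ) × (ι → ℝ) => w.1 i ^ 2) (noisePair ι) :=
    (memLp_coord 2 (by simp) i).1.integrable_sq
  have hWg : ∫ w : (ι → ℝ) × (ι → ℝ), |stdIncrement alg sd σ i w ^ 2 - w.2 i ^ 2| ∂(noisePair ι) ≤
      2 * m := by
    calc _ ≤ ∫ w : (ι → ℝ) × (ι → ℝ), (2 * |c| * |w.1 i * w.2 i| + c ^ 2 * w.1 i ^ 2)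
          ∂(noisePair ι) := by
          refine integral_mono (((memLp_stdIncrement alg sd σ i 2 (by simp)).integrable_sq).sub
            (memLp_coord 2 (by simp) i).2.integrable_sq).abs
            (((integrable_coord_mul i).abs.const_mul _).add (i1.const_mul _)) fun w => ?_
          have e : stdIncrement alg sd σ i w ^ 2 - w.2 i ^ 2 =
              2 * c * (w.1 i * w.2 i) + c ^ 2 * w.1 i ^ 2 := by
            rw [stdIncrement, ← hcdef]; ring
          simp only [e]
          refine (abs_add_le _ _).trans ?_
          rw [abs_mul, abs_mul 2 c, abs_two, abs_of_nonneg (by positivity : 0 ≤ c ^ 2 * w.1 i ^ 2)]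
      _ = 2 * |c| * ∫ w : (ι → ℝ) × (ι → ℝ), |w.1 i * w.2 i| ∂(noisePair ι) + c ^ 2 := by
          rw [integral_add ((integrable_coord_mul i).abs.const_mul _) (i1.const_mul _),
            integral_const_mul, integral_const_mul, integral_coord_sq, mul_one]
      _ ≤ 2 * (m / 2) * 1 + m := by
          refine add_le_add (mul_le_mul (by linarith) (integral_abs_coord_mul_le i)
            (integral_nonneg fun _ => abs_nonneg _) (by linarith)) ?_
          rw [← sq_abs]
          nlinarith [abs_nonneg c]
      _ = 2 * m := by ring
  have hg2 : MemLp (fun u : ℝ => u ^ 2) 2 (gaussianReal 0 1) := by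
    have h4 := memLp_id_gaussianReal' (μ := 0) (v := 1) 4 (by simp)
    have hT : ENNReal.HolderTriple 4 4 2 := by
      refine ⟨?_⟩
      rw [show (4 : ENNReal) = 2 * 2 by norm_num, ENNReal.mul_inv (by simp) (by simp), ← two_mul,
        ← mul_assoc, ENNReal.mul_inv_cancel (by simp) (by simp), one_mul]
    refine (h4.mul h4 (r := 2)).congr_norm (by fun_prop) (Eventually.of_forall fun u => ?_)
    simp [sq]
  have := abs_weighted_acceptance_sub_le alg hsd hσ hphi hK hD1 hm hη hφi hφ i
    (W := fun w => stdIncrement alg sd σ i w ^ 2)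
    (memLp_stdIncrement alg sd σ i 2 (by simp)).integrable_sq
    (g := fun u => u ^ 2) (by fun_prop) hg2 (fun u => sq_nonneg u) hu hWg
  rw [squaredJump_eq alg hsd hσ hphi hZ hK i, ← mul_sub, abs_mul, abs_of_nonneg (sq_nonneg σ)]
  exact mul_le_mul_of_nonneg_left this (sq_nonneg σ)

end Remainder

/-! ### Exponential bounds for large steps -/

/-- Completing the square turns the integrand times the standard normal density into a multiple of
the density of `N(t / k, 1 / k)` with `k = 1 - 2c`. -/
theorem integral_exp_quadratic_gaussian {c : ℝ} (hc : 0 < 1 - 2 * c) (t : ℝ) :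
    ∫ z, Real.exp (c * z ^ 2 + t * z) ∂(gaussianReal 0 1) =
      (Real.sqrt (1 - 2 * c))⁻¹ * Real.exp (t ^ 2 / (2 * (1 - 2 * c))) := by
  set k := 1 - 2 * c with hk
  have hv : Real.toNNReal k⁻¹ ≠ 0 := by
    rw [Ne, Real.toNNReal_eq_zero, not_le]; positivity
  have hvc : ((Real.toNNReal k⁻¹ : NNReal) : ℝ) = k⁻¹ := Real.coe_toNNReal _ (by positivity)
  rw [integral_gaussianReal_eq_integral_smul one_ne_zero]
  have e : ∀ z : ℝ, gaussianPDFReal 0 1 z • Real.exp (c * z ^ 2 + t * z) =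
      ((Real.sqrt k)⁻¹ * Real.exp (t ^ 2 / (2 * k))) *
        gaussianPDFReal (t / k) (Real.toNNReal k⁻¹) z := by
    intro z
    simp only [gaussianPDFReal, hvc, smul_eq_mul, NNReal.coe_one, mul_one]
    rw [Real.sqrt_mul (by positivity : (0 : ℝ) ≤ 2 * Real.pi) k⁻¹, Real.sqrt_inv, mul_inv, inv_inv]
    have hs : Real.sqrt k ≠ 0 := (Real.sqrt_pos.2 hc).ne'
    rw [mul_assoc, ← Real.exp_add]
    have : (Real.sqrt k)⁻¹ * Real.exp (t ^ 2 / (2 * k)) * ((Real.sqrt (2 * Real.pi))⁻¹ *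
        Real.sqrt k * Real.exp (-(z - t / k) ^ 2 / (2 * k⁻¹))) =
        (Real.sqrt (2 * Real.pi))⁻¹ * (Real.exp (t ^ 2 / (2 * k)) *
          Real.exp (-(z - t / k) ^ 2 / (2 * k⁻¹))) := by
      field_simp
    rw [this, ← Real.exp_add]
    congr 2
    have hk0 := hc.ne'
    have hc' : c = (1 - k) / 2 := by rw [hk]; ring
    rw [hc']
    field_simp
    ring
  simp_rw [e]
  rw [integral_const_mul, integral_gaussianPDFReal_eq_one _ hv, mul_one]

theorem integrable_exp_quadratic_gaussian {c : ℝ} (hc : 0 < 1 - 2 * c) (t : ℝ) :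
    Integrable (fun z => Real.exp (c * z ^ 2 + t * z)) (gaussianReal 0 1) := by
  -- A nonintegrable function has integral `0` by convention, so the nonzero value already computed
  -- proves integrability.
  refine Integrable.of_integral_ne_zero ?_
  rw [integral_exp_quadratic_gaussian hc]
  have := Real.sqrt_pos.2 hc
  positivity

theorem exp_quadratic_gaussian_pair {a b c : ℝ} (hc : 0 < 1 - 2 * c)
    (hd : 0 < (1 - 2 * a) * (1 - 2 * c) - b ^ 2) :
    Integrable (fun q : ℝ × ℝ => Real.exp (a * q.1 ^ 2 + b * (q.1 * q.2) + c * q.2 ^ 2))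
      ((gaussianReal 0 1).prod (gaussianReal 0 1)) ∧
    ∫ q : ℝ × ℝ, Real.exp (a * q.1 ^ 2 + b * (q.1 * q.2) + c * q.2 ^ 2)
      ∂((gaussianReal 0 1).prod (gaussianReal 0 1)) =
      (Real.sqrt ((1 - 2 * a) * (1 - 2 * c) - b ^ 2))⁻¹ := by
  -- The coefficient of `x²` left after integrating out `z`; `1 - 2a'` is the Schur complement, so
  -- its product with `1 - 2c` is the determinant in the statement.
  set a' := a + b ^ 2 / (2 * (1 - 2 * c)) with ha'
  have hprod : (1 - 2 * c) * (1 - 2 * a') = (1 - 2 * a) * (1 - 2 * c) - b ^ 2 := by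
    rw [ha']; field_simp; ring
  have hpos : 0 < 1 - 2 * a' := by
    by_contra h
    have := mul_nonpos_of_nonneg_of_nonpos hc.le (not_lt.1 h)
    linarith
  have e : ∀ x z : ℝ, Real.exp (a * x ^ 2 + b * (x * z) + c * z ^ 2) =
      Real.exp (a * x ^ 2) * Real.exp (c * z ^ 2 + (b * x) * z) := by
    intro x z; rw [← Real.exp_add]; ring_nf
  have inner : ∀ x : ℝ, ∫ z, Real.exp (a * x ^ 2 + b * (x * z) + c * z ^ 2) ∂(gaussianReal 0 1) =
      (Real.sqrt (1 - 2 * c))⁻¹ * Real.exp (a' * x ^ 2 + 0 * x) := by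
    intro x
    simp_rw [e]
    rw [integral_const_mul, integral_exp_quadratic_gaussian hc, mul_left_comm, ← Real.exp_add]
    congr 2
    rw [ha']; field_simp; ring
  have hint : Integrable (fun q : ℝ × ℝ => Real.exp (a * q.1 ^ 2 + b * (q.1 * q.2) + c * q.2 ^ 2))
      ((gaussianReal 0 1).prod (gaussianReal 0 1)) := by
    rw [integrable_prod_iff (by fun_prop)]
    refine ⟨Eventually.of_forall fun x => ?_, ?_⟩
    · simp only [e]
      exact (integrable_exp_quadratic_gaussian hc _).const_mul _
    · simp only [Real.norm_of_nonneg (Real.exp_pos _).le, inner]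
      exact (integrable_exp_quadratic_gaussian hpos 0).const_mul _
  refine ⟨hint, ?_⟩
  rw [integral_prod _ hint]
  simp only [inner]
  rw [integral_const_mul, integral_exp_quadratic_gaussian hpos, ← hprod, Real.sqrt_mul hc.le,
    mul_inv]
  simp

/-- The coefficient of `η ^ r` in the Hellinger integral of one coordinate. -/
def Algorithm.hellingerFactor : Algorithm → ℝ
  | .rwm => 1 / 4
  | .sla => 1 / 64

/-- Half the log-ratio is a quadratic form in `(ξ, z)`, and the determinant of the resulting
Gaussian integral collapses to `1 + η² / 4`, respectively `1 + η⁶ / 64`: all other powers cancel. -/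
theorem Algorithm.hellinger (alg : Algorithm) (η : ℝ) :
    Integrable (fun q : ℝ × ℝ => Real.exp (alg.logRatio η q.1 q.2 / 2))
      ((gaussianReal 0 1).prod (gaussianReal 0 1)) ∧
    ∫ q : ℝ × ℝ, Real.exp (alg.logRatio η q.1 q.2 / 2)
      ∂((gaussianReal 0 1).prod (gaussianReal 0 1)) =
      (Real.sqrt (1 + alg.hellingerFactor * η ^ alg.power))⁻¹ := by
  cases alg with
  | rwm =>
    have e : ∀ q : ℝ × ℝ, Algorithm.rwm.logRatio η q.1 q.2 / 2 =
        0 * q.1 ^ 2 + (-η / 2) * (q.1 * q.2) + (-η ^ 2 / 4) * q.2 ^ 2 := by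
      intro q; simp only [Algorithm.logRatio]; ring
    have hd : (1 - 2 * (0 : ℝ)) * (1 - 2 * (-η ^ 2 / 4)) - (-η / 2) ^ 2 =
        1 + Algorithm.rwm.hellingerFactor * η ^ Algorithm.rwm.power := by
      simp only [hellingerFactor, power]; ring
    simp_rw [e]
    rw [← hd]
    exact exp_quadratic_gaussian_pair (by nlinarith [sq_nonneg η]) (by nlinarith [sq_nonneg η])
  | sla =>
    set B := η ^ 2 / 16 with hB
    set M := 1 - η ^ 2 / 2 with hM
    have e : ∀ q : ℝ × ℝ, Algorithm.sla.logRatio η q.1 q.2 / 2 =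
        (B * (1 - M ^ 2)) * q.1 ^ 2 + (-2 * B * M * η) * (q.1 * q.2) + (-B * η ^ 2) * q.2 ^ 2 := by
      intro q; simp only [Algorithm.logRatio, hB, hM]; ring
    have hd : (1 - 2 * (B * (1 - M ^ 2))) * (1 - 2 * (-B * η ^ 2)) - (-2 * B * M * η) ^ 2 =
        1 + Algorithm.sla.hellingerFactor * η ^ Algorithm.sla.power := by
      simp only [hellingerFactor, power, hB, hM]; ring
    have h6 : 0 ≤ η ^ 6 := by positivity
    have h4 : 0 ≤ B * η ^ 2 := by positivity
    simp_rw [e]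
    rw [← hd]
    refine exp_quadratic_gaussian_pair (by nlinarith) ?_
    rw [hd]
    simp only [hellingerFactor, power]
    linarith

theorem inv_sqrt_one_add_le_exp {x : ℝ} (h0 : 0 ≤ x) (h1 : x ≤ 1) :
    (Real.sqrt (1 + x))⁻¹ ≤ Real.exp (-x / 4) := by
  have h2 : Real.exp (x / 4) ≤ Real.sqrt (1 + x) := by
    apply Real.le_sqrt_of_sq_le
    have h3 : Real.exp (x / 4) ^ 2 * Real.exp (-x / 2) = 1 := by
      rw [sq, ← Real.exp_add, ← Real.exp_add]
      ring_nf
      exact Real.exp_zero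
    have h4 := Real.add_one_le_exp (-x / 2)
    have h5 : 0 < Real.exp (x / 4) ^ 2 := by positivity
    -- With `(1 + x)(1 - x/2) ≥ 1` on `[0, 1]` this yields `e^{x/2} ≤ 1 + x`.
    have h6 : Real.exp (x / 4) ^ 2 * (1 - x / 2) ≤ 1 := by
      rw [← h3]; exact mul_le_mul_of_nonneg_left (by linarith) h5.le
    nlinarith
  rw [neg_div, Real.exp_neg]
  exact inv_anti₀ (Real.exp_pos _) h2

section LargeStep

variable {ι : Type*} [Fintype ι]

/-- The integral factorises over coordinates. The constant is `256 = 64 * 4`, from the smaller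
Hellinger factor and from the exponent `x / 4` above. -/
theorem hellinger_bound (alg : Algorithm) {η : ι → ℝ} (h0 : ∀ k, 0 ≤ η k) (h1 : ∀ k, η k ≤ 1) :
    Integrable (fun w => Real.exp ((∑ k, alg.logRatio (η k) (w.1 k) (w.2 k)) / 2)) (noisePair ι) ∧
      ∫ w, Real.exp ((∑ k, alg.logRatio (η k) (w.1 k) (w.2 k)) / 2) ∂(noisePair ι) ≤
        Real.exp (-(∑ k, η k ^ alg.power) / 256) := by
  have e : ∀ w : (ι → ℝ) × (ι → ℝ), Real.exp ((∑ k, alg.logRatio (η k) (w.1 k) (w.2 k)) / 2) =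
      ∏ k, Real.exp (alg.logRatio (η k) (w.1 k) (w.2 k) / 2) := by
    intro w; rw [Finset.sum_div, Real.exp_sum]
  simp_rw [e]
  have hm : ∀ k, Measurable fun q : ℝ × ℝ => Real.exp (alg.logRatio (η k) q.1 q.2 / 2) :=
    fun k => ((measurable_logRatio alg (η k)).div_const 2).exp
  constructor
  · exact integrable_noisePair_prod (fun k ξ z => Real.exp (alg.logRatio (η k) ξ z / 2)) hm
      fun k => (alg.hellinger (η k)).1
  · rw [integral_noisePair_prod (fun k ξ z => Real.exp (alg.logRatio (η k) ξ z / 2)) hm,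
      neg_div, Finset.sum_div, ← Finset.sum_neg_distrib, Real.exp_sum]
    refine Finset.prod_le_prod (fun k _ => integral_nonneg fun q => (Real.exp_pos _).le) fun k _ => ?_
    rw [(alg.hellinger (η k)).2]
    have hp0 : 0 ≤ η k ^ alg.power := pow_nonneg (h0 k) _
    have hp1 : η k ^ alg.power ≤ 1 := pow_le_one₀ (h0 k) (h1 k)
    have hf : 1 / 64 ≤ alg.hellingerFactor ∧ alg.hellingerFactor ≤ 1 := by
      cases alg <;> simp only [Algorithm.hellingerFactor] <;> norm_num
    refine (inv_sqrt_one_add_le_exp (mul_nonneg (by linarith [hf.1]) hp0)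
      (by nlinarith [hf.2])).trans (Real.exp_le_exp.2 ?_)
    nlinarith [hf.1]

theorem meanAcceptance_nonneg_le [DecidableEq ι] (alg : Algorithm) {sd : ι → ℝ}
    (hsd : ∀ i, 0 < sd i) {σ : ℝ} (hσ : 0 < σ) {phi : (ι → ℝ) → ℝ} (hphi : Measurable phi) {c : ℝ}
    (hc : ∀ x, c ≤ phi x) (hZ : 0 < ∫ x, Real.exp (-phi x) ∂(refMeasure sd))
    (hη : ∀ k, σ / sd k ≤ 1) :
    0 ≤ meanAcceptance alg sd phi σ ∧ meanAcceptance alg sd phi σ ≤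
      Real.exp (-c) / (∫ x, Real.exp (-phi x) ∂(refMeasure sd)) *
        Real.exp (-(∑ k, (σ / sd k) ^ alg.power) / 256) := by
  have hb := hellinger_bound alg (fun k => (div_pos hσ (hsd k)).le) hη
  rw [meanAcceptance_eq alg hsd hσ hphi hZ]
  set Z := ∫ x, Real.exp (-phi x) ∂(refMeasure sd) with hZd
  constructor
  · exact integral_nonneg fun w => mul_nonneg (by unfold relDensity; positivity)
      (le_min zero_le_one (Real.exp_pos _).le)
  refine le_trans ?_ (mul_le_mul_of_nonneg_left hb.2 (by positivity))
  rw [← integral_const_mul]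
  refine integral_mono_of_nonneg (Eventually.of_forall fun w => mul_nonneg
    (by unfold relDensity; positivity) (le_min zero_le_one (Real.exp_pos _).le))
    (hb.1.const_mul _) (Eventually.of_forall fun w => ?_)
  simp only [relDensity, ← hZd, div_mul_eq_mul_div, logAccept]
  refine div_le_div_of_nonneg_right ?_ hZ.le
  set r := ∑ k, alg.logRatio (σ / sd k) (w.1 k) (w.2 k)
  set p := phi (rescale sd w.1) with hp
  set p' := phi (proposal alg sd σ (rescale sd w.1) w.2) with hp'
  -- Absorbing `exp(-φ(x))` into the minimum leaves `min(e^{-φ(x)}, e^{-φ(y) + r})`. The lower bound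
  -- of `φ` and `min(1, e^r) ≤ e^{r/2}` then suffice, with no control of `φ(x) - φ(y)`.
  rw [mul_min_of_nonneg _ _ (Real.exp_pos _).le, mul_one, ← Real.exp_add, ← Real.exp_add]
  rcases le_total 0 r with hr | hr
  · refine (min_le_left _ _).trans (Real.exp_le_exp.2 ?_)
    linarith [hc (rescale sd w.1)]
  · refine (min_le_right _ _).trans (Real.exp_le_exp.2 ?_)
    linarith [hc (proposal alg sd σ (rescale sd w.1) w.2)]

/-- Cauchy-Schwarz between the squared increment and `H`, together with `H² ≤ K H`; the integral of
`H` is the mean acceptance. The factor `16` comes from `(z + c x)⁴ ≤ 8 z⁴ + 8 x⁴` for `|c| ≤ 1`. -/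
theorem squaredJump_nonneg_le [DecidableEq ι] (alg : Algorithm) {sd : ι → ℝ}
    (hsd : ∀ i, 0 < sd i) {σ : ℝ} (hσ : 0 < σ) {phi : (ι → ℝ) → ℝ} (hphi : Measurable phi) {K : ℝ}
    (hZ : 0 < ∫ x, Real.exp (-phi x) ∂(refMeasure sd))
    (hK : ∀ ξ, relDensity sd phi ξ ≤ K) (i : ι) (hη : σ / sd i ≤ 1) :
    0 ≤ squaredJump alg sd phi σ i ∧ squaredJump alg sd phi σ i ≤
      σ ^ 2 * (Real.sqrt (16 * fourthMoment) *
        Real.sqrt (K * meanAcceptance alg sd phi σ)) := by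
  have hη0 : 0 ≤ σ / sd i := (div_pos hσ (hsd i)).le
  have hD0 : ∀ ξ, 0 ≤ relDensity sd phi ξ := fun ξ => by unfold relDensity; positivity
  have hK0 : 0 ≤ K := (hD0 0).trans (hK 0)
  rw [squaredJump_eq alg hsd hσ hphi hZ hK i, meanAcceptance_eq alg hsd hσ hphi hZ]
  set H : (ι → ℝ) × (ι → ℝ) → ℝ := fun w =>
    relDensity sd phi w.1 * min 1 (Real.exp (logAccept alg sd phi σ w)) with hH
  set Q : (ι → ℝ) × (ι → ℝ) → ℝ := fun w => stdIncrement alg sd σ i w ^ 2 with hQ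
  have e : ∀ w : (ι → ℝ) × (ι → ℝ), relDensity sd phi w.1 * (stdIncrement alg sd σ i w ^ 2 *
      min 1 (Real.exp (logAccept alg sd phi σ w))) = Q w * H w := fun w => by
    simp only [hH, hQ]; ring
  have hH0 : ∀ w, 0 ≤ H w := fun w => mul_nonneg (hD0 _) (le_min zero_le_one (Real.exp_pos _).le)
  have hHK : ∀ w, H w ≤ K := fun w =>
    (mul_le_of_le_one_right (hD0 _) (min_le_left _ _)).trans (hK _)
  have hHm : Measurable H := ((measurable_relDensity sd hphi).comp measurable_fst).mul
    (measurable_const.min (measurable_logAccept alg hsd hphi σ).exp)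
  have hHL : ∀ p : ENNReal, MemLp H p (noisePair ι) := fun p =>
    MemLp.of_bound hHm.aestronglyMeasurable K (Eventually.of_forall fun w => by
      rw [Real.norm_of_nonneg (hH0 w)]; exact hHK w)
  have h4 : ∀ {f : (ι → ℝ) × (ι → ℝ) → ℝ}, MemLp f 4 (noisePair ι) →
      MemLp (fun w => f w ^ 2) 2 (noisePair ι) := by
    intro f hf
    have hT : ENNReal.HolderTriple 4 4 2 := by
      refine ⟨?_⟩
      rw [show (4 : ENNReal) = 2 * 2 by norm_num, ENNReal.mul_inv (by simp) (by simp), ← two_mul,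
        ← mul_assoc, ENNReal.mul_inv_cancel (by simp) (by simp), one_mul]
    refine (hf.mul hf (r := 2)).congr_norm (hf.aestronglyMeasurable.pow 2)
      (Eventually.of_forall fun u => ?_)
    simp [sq]
  have hQL : MemLp Q 2 (noisePair ι) := h4 (memLp_stdIncrement alg sd σ i 4 (by simp))
  have h1L := (h4 (memLp_coord (ι := ι) 4 (by simp) i).1).integrable_sq
  have h2L := (h4 (memLp_coord (ι := ι) 4 (by simp) i).2).integrable_sq
  have hd : |alg.drift * (σ / sd i)| ≤ 1 := by
    have : |alg.drift| ≤ 1 := by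
      cases alg <;> simp only [Algorithm.drift] <;> norm_num [abs_of_nonneg]
    rw [abs_mul, abs_of_nonneg hη0]
    exact mul_le_one₀ this hη0 hη
  have hQ2 : ∫ w, Q w ^ 2 ∂(noisePair ι) ≤ 16 * fourthMoment := by
    have m1 : ∫ w : (ι → ℝ) × (ι → ℝ), (w.1 i ^ 2) ^ 2 ∂(noisePair ι) = fourthMoment := by
      rw [integral_pair i (S := fun q => (q.1 ^ 2) ^ 2) (by fun_prop),
        integral_fun_fst (μ := gaussianReal 0 1) (ν := gaussianReal 0 1) (fun u => (u ^ 2) ^ 2)]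
      simp [fourthMoment]
    have m2 : ∫ w : (ι → ℝ) × (ι → ℝ), (w.2 i ^ 2) ^ 2 ∂(noisePair ι) = fourthMoment := by
      rw [integral_pair i (S := fun q => (q.2 ^ 2) ^ 2) (by fun_prop),
        integral_fun_snd (μ := gaussianReal 0 1) (ν := gaussianReal 0 1) (fun u => (u ^ 2) ^ 2)]
      simp [fourthMoment]
    calc ∫ w, Q w ^ 2 ∂(noisePair ι)
        ≤ ∫ w : (ι → ℝ) × (ι → ℝ), (8 * (w.1 i ^ 2) ^ 2 + 8 * (w.2 i ^ 2) ^ 2) ∂(noisePair ι) := by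
          refine integral_mono hQL.integrable_sq ((h1L.const_mul 8).add (h2L.const_mul 8))
            fun w => ?_
          simp only [hQ, stdIncrement]
          set c := alg.drift * (σ / sd i)
          set x := w.1 i
          set z := w.2 i
          have hc2 : c ^ 2 ≤ 1 := by rw [← sq_abs]; exact pow_le_one₀ (abs_nonneg _) hd
          have q1 : (z + c * x) ^ 2 ≤ 2 * z ^ 2 + 2 * x ^ 2 := by
            nlinarith [sq_nonneg (z - c * x), sq_nonneg x]
          have q2 : ((z + c * x) ^ 2) ^ 2 ≤ (2 * z ^ 2 + 2 * x ^ 2) ^ 2 :=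
            pow_le_pow_left₀ (sq_nonneg _) q1 2
          nlinarith [sq_nonneg (z ^ 2 - x ^ 2)]
      _ = 16 * fourthMoment := by
          rw [integral_add (h1L.const_mul 8) (h2L.const_mul 8), integral_const_mul,
            integral_const_mul, m1, m2]
          ring
  simp_rw [e]
  refine ⟨mul_nonneg (sq_nonneg σ) (integral_nonneg fun w => mul_nonneg (sq_nonneg _) (hH0 w)),
    mul_le_mul_of_nonneg_left ((integral_mul_le_sqrt hQL (hHL 2)).trans ?_) (sq_nonneg σ)⟩
  refine mul_le_mul (Real.sqrt_le_sqrt hQ2) (Real.sqrt_le_sqrt ?_) (Real.sqrt_nonneg _)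
    (Real.sqrt_nonneg _)
  rw [← integral_const_mul]
  refine integral_mono (hHL 2).integrable_sq (((hHL 1).integrable le_rfl).const_mul K) fun w => ?_
  simp only
  rw [sq]
  exact mul_le_mul_of_nonneg_right (hHK w) (hH0 w)

end LargeStep

/-! ### Moments of the path functional -/

section Path

variable {d : ℕ}

theorem continuous_of_growthCondition {G : EuclideanSpace ℝ (Fin d) → ℝ}
    (hG : GrowthCondition G) : Continuous G := by
  obtain ⟨-, C, p, hC, hp, h⟩ := hG
  rw [continuous_iff_continuousAt]
  intro v
  have h1 : Tendsto (fun w => C * (1 + ‖v‖ ^ p + ‖w - v‖ ^ p) * ‖w - v‖) (𝓝 v) (𝓝 0) := by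
    have : Continuous fun w => C * (1 + ‖v‖ ^ p + ‖w - v‖ ^ p) * ‖w - v‖ := by
      have h2 : Continuous fun w : EuclideanSpace ℝ (Fin d) => ‖w - v‖ ^ p :=
        (continuous_id.sub continuous_const).norm.rpow_const fun _ => Or.inr hp.le
      fun_prop
    simpa using this.tendsto v
  rw [ContinuousAt, tendsto_iff_dist_tendsto_zero]
  exact squeeze_zero (fun _ => dist_nonneg) (fun w => by rw [Real.dist_eq]; exact h v w) h1

theorem truncatedPath_apply (T : ℝ) (N : ℕ) (x : Fin N × Fin d → ℝ) (t : ℝ) (j : Fin d) :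
    truncatedPath T N x t j = ∑ k : Fin N, x (k, j) * sineBasis T k t := rfl

theorem truncatedPath_add (T : ℝ) (N : ℕ) (x y : Fin N × Fin d → ℝ) (t : ℝ) :
    truncatedPath T N (fun i => x i + y i) t = truncatedPath T N x t + truncatedPath T N y t := by
  ext j
  simp only [PiLp.add_apply, truncatedPath_apply, ← Finset.sum_add_distrib, add_mul]

theorem truncatedPath_zero (T : ℝ) (N : ℕ) (t : ℝ) :
    truncatedPath T N (fun _ : Fin N × Fin d => 0) t = 0 := by
  ext j
  simp [truncatedPath_apply]

theorem continuous_truncatedPath (T : ℝ) (N : ℕ) :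
    Continuous fun q : (Fin N × Fin d → ℝ) × ℝ => truncatedPath T N q.1 q.2 := by
  unfold truncatedPath sineBasis
  refine (PiLp.continuous_toLp 2 _).comp (continuous_pi fun j => ?_)
  fun_prop

theorem sineBasis_sq_le {T : ℝ} (hT : 0 < T) (k : ℕ) (t : ℝ) : sineBasis T k t ^ 2 ≤ 2 / T := by
  rw [sineBasis, mul_pow, Real.sq_sqrt (by positivity)]
  exact mul_le_of_le_one_right (by positivity) (Real.sin_sq_le_one _)

/-- The absolute moments of the standard normal law. -/
def absMoment (q : ℕ) : ℝ := ∫ u, |u| ^ q ∂(gaussianReal 0 1)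

theorem absMoment_nonneg (q : ℕ) : 0 ≤ absMoment q := integral_nonneg fun u => by positivity

theorem integrable_abs_pow_linear {ι : Type*} [Fintype ι] (a c : ι → ℝ) (q : ℕ) :
    Integrable (fun w : (ι → ℝ) × (ι → ℝ) => |∑ i, a i * w.1 i + ∑ i, c i * w.2 i| ^ q)
      (noisePair ι) := by
  have h : MemLp (fun w : (ι → ℝ) × (ι → ℝ) => ∑ i, a i * w.1 i + ∑ i, c i * w.2 i) q
      (noisePair ι) :=
    (memLp_finsetSum _ fun i _ => (memLp_coord q (by simp) i).1.const_mul (a i)).add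
      (memLp_finsetSum _ fun i _ => (memLp_coord q (by simp) i).2.const_mul (c i))
  simpa using h.integrable_norm_pow'

theorem integral_abs_pow_linear {ι : Type*} [Fintype ι] (a c : ι → ℝ) (q : ℕ) :
    ∫ w : (ι → ℝ) × (ι → ℝ), |∑ i, a i * w.1 i + ∑ i, c i * w.2 i| ^ q ∂(noisePair ι) =
      Real.sqrt (∑ i, a i ^ 2 + ∑ i, c i ^ 2) ^ q * absMoment q := by
  have hm : Measurable fun w : (ι → ℝ) × (ι → ℝ) => ∑ i, a i * w.1 i + ∑ i, c i * w.2 i := by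
    fun_prop
  have hF : Measurable fun u : ℝ => |u| ^ q := by fun_prop
  rw [← integral_map (μ := noisePair ι) hm.aemeasurable (f := fun u : ℝ => |u| ^ q)
    hF.aestronglyMeasurable, map_noisePair_linear, gaussianReal_eq_map_sqrt,
    integral_map (by fun_prop) hF.aestronglyMeasurable, absMoment, ← integral_const_mul]
  refine integral_congr_ae (Eventually.of_forall fun u => ?_)
  simp only
  rw [abs_mul, mul_pow, abs_of_nonneg (Real.sqrt_nonneg _)]

theorem norm_pow_le_sum (u : EuclideanSpace ℝ (Fin d)) (q : ℕ) :
    ‖u‖ ^ (q + 1) ≤ (d : ℝ) ^ q * ∑ j, |u j| ^ (q + 1) := by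
  have h0 : ∀ j ∈ Finset.univ, 0 ≤ |u j| := fun j _ => abs_nonneg _
  have h1 : ‖u‖ ≤ ∑ j, |u j| := by
    rw [EuclideanSpace.norm_eq]
    refine Real.sqrt_le_iff.2 ⟨Finset.sum_nonneg h0, ?_⟩
    exact Finset.sum_sq_le_sq_sum_of_nonneg h0
  refine (pow_le_pow_left₀ (norm_nonneg u) h1 _).trans ?_
  rcases Nat.eq_zero_or_pos d with hd | hd
  · subst hd; simp
  · have h2 := pow_sum_div_card_le_sum_pow (s := Finset.univ) (f := fun j => |u j|)
      (n := q) h0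
    rw [Finset.card_univ, Fintype.card_fin, div_le_iff₀ (by positivity)] at h2
    linarith

/-- The linear combination of two vectors with coordinatewise coefficients. -/
def combine {ι : Type*} (a c : ι → ℝ) (w : (ι → ℝ) × (ι → ℝ)) : ι → ℝ :=
  fun i => a i * w.1 i + c i * w.2 i

theorem continuous_combine {ι : Type*} (a c : ι → ℝ) : Continuous (combine a c) := by
  unfold combine; fun_prop

/-- At a fixed time each component of the path is thus a linear form in the Gaussian pair, so its
law is a centred Gaussian with explicit variance. -/
theorem truncatedPath_combine (T : ℝ) (N : ℕ) (a c : Fin N × Fin d → ℝ) (t : ℝ) (j : Fin d)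
    (w : (Fin N × Fin d → ℝ) × (Fin N × Fin d → ℝ)) :
    truncatedPath T N (combine a c w) t j =
      ∑ i, (if i.2 = j then a i * sineBasis T i.1 t else 0) * w.1 i +
        ∑ i, (if i.2 = j then c i * sineBasis T i.1 t else 0) * w.2 i := by
  simp only [truncatedPath_apply, combine, Fintype.sum_prod_type, ite_mul, zero_mul,
    Finset.sum_ite_eq', Finset.mem_univ, if_true, ← Finset.sum_add_distrib]
  exact Finset.sum_congr rfl fun k _ => by ring

theorem pathVariance_le {T : ℝ} (hT : 0 < T) (N : ℕ) (a : Fin N × Fin d → ℝ) (t : ℝ) (j : Fin d) :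
    ∑ i : Fin N × Fin d, (if i.2 = j then a i * sineBasis T i.1 t else 0) ^ 2 ≤
      2 / T * ∑ i, a i ^ 2 := by
  rw [Finset.mul_sum]
  refine Finset.sum_le_sum fun i _ => ?_
  split_ifs
  · rw [mul_pow, mul_comm]
    exact mul_le_mul_of_nonneg_right (sineBasis_sq_le hT _ _) (sq_nonneg _)
  · have : 0 ≤ 2 / T * a i ^ 2 := by positivity
    simpa using this

/-- Each component has variance at most `r²` because the sine basis is uniformly bounded; the
resulting moment bound is uniform in `t` and `N`. -/
theorem moment_truncatedPath {T : ℝ} (hT : 0 < T) (N : ℕ) (a c : Fin N × Fin d → ℝ) {r : ℝ}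
    (hr : 0 ≤ r) (h : 2 / T * (∑ i, a i ^ 2 + ∑ i, c i ^ 2) ≤ r ^ 2) (t : ℝ) (q : ℕ) :
    Integrable (fun w => ‖truncatedPath T N (combine a c w) t‖ ^ (q + 1))
      (noisePair (Fin N × Fin d)) ∧
    ∫ w, ‖truncatedPath T N (combine a c w) t‖ ^ (q + 1) ∂(noisePair (Fin N × Fin d)) ≤
      (d : ℝ) ^ (q + 1) * absMoment (q + 1) * r ^ (q + 1) := by
  have hi : ∀ j : Fin d, Integrable
      (fun w => |truncatedPath T N (combine a c w) t j| ^ (q + 1))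
      (noisePair (Fin N × Fin d)) := by
    intro j
    simp_rw [truncatedPath_combine]
    exact integrable_abs_pow_linear _ _ _
  have hI : ∀ j : Fin d, ∫ w, |truncatedPath T N (combine a c w) t j| ^ (q + 1)
      ∂(noisePair (Fin N × Fin d)) ≤ r ^ (q + 1) * absMoment (q + 1) := by
    intro j
    simp_rw [truncatedPath_combine]
    rw [integral_abs_pow_linear]
    refine mul_le_mul_of_nonneg_right ?_ (absMoment_nonneg _)
    refine pow_le_pow_left₀ (Real.sqrt_nonneg _) (Real.sqrt_le_iff.2 ⟨hr, ?_⟩) _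
    refine le_trans ?_ h
    rw [mul_add]
    exact add_le_add (pathVariance_le hT N a t j) (pathVariance_le hT N c t j)
  have hs : Integrable (fun w => (d : ℝ) ^ q * ∑ j, |truncatedPath T N (combine a c w) t j| ^ (q + 1))
      (noisePair (Fin N × Fin d)) := (integrable_finsetSum _ fun j _ => hi j).const_mul _
  have hc : Continuous fun w => truncatedPath T N (combine a c w) t :=
    (continuous_truncatedPath T N).comp ((continuous_combine a c).prodMk continuous_const)
  have hint : Integrable (fun w => ‖truncatedPath T N (combine a c w) t‖ ^ (q + 1))
      (noisePair (Fin N × Fin d)) :=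
    hs.mono' (hc.norm.pow _).aestronglyMeasurable (Eventually.of_forall fun w => by
      rw [Real.norm_of_nonneg (by positivity)]; exact norm_pow_le_sum _ q)
  refine ⟨hint, (integral_mono hint hs fun w => norm_pow_le_sum _ q).trans ?_⟩
  rw [integral_const_mul, integral_finsetSum _ fun j _ => hi j]
  calc (d : ℝ) ^ q * ∑ j : Fin d, ∫ w, |truncatedPath T N (combine a c w) t j| ^ (q + 1)
        ∂(noisePair (Fin N × Fin d))
      ≤ (d : ℝ) ^ q * ∑ _j : Fin d, r ^ (q + 1) * absMoment (q + 1) := by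
        gcongr with j
        exact hI j
    _ = _ := by simp; ring

/-- The bound of `moment_increment`. -/
def incrementBound (d q : ℕ) (C R r : ℝ) : ℝ :=
  C * (3 * ((d : ℝ) ^ 1 * absMoment 1 * r ^ 1) +
    (d : ℝ) ^ (q + 2) * absMoment (q + 2) * r ^ (q + 2) +
    (r * ((d : ℝ) ^ (2 * q + 2) * absMoment (2 * q + 2) * R ^ (2 * q + 2)) +
      r⁻¹ * ((d : ℝ) ^ 2 * absMoment 2 * r ^ 2)) / 2)

theorem rpow_le_one_add_pow {a p : ℝ} {q : ℕ} (ha : 0 ≤ a) (hp : 0 < p) (hpq : p ≤ q + 1) :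
    a ^ p ≤ 1 + a ^ (q + 1) := by
  rcases le_total a 1 with h | h
  · have h1 := Real.rpow_le_one ha h hp.le
    have h2 : 0 ≤ a ^ (q + 1) := by positivity
    linarith
  · have h1 := Real.rpow_le_rpow_of_exponent_le h hpq
    have h2 : a ^ ((q : ℝ) + 1) = a ^ (q + 1) := by
      rw [← Real.rpow_natCast]; push_cast; rfl
    rw [h2] at h1
    linarith

/-- `X` is the size of the path, of order `R`, and `D` that of its increment, of order `r`. The real
exponent `p` is dominated by an integer one so that Gaussian moments apply. -/
theorem moment_increment {G : EuclideanSpace ℝ (Fin d) → ℝ} {C p : ℝ}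
    (hC : 0 < C) (hp : 0 < p) {q : ℕ} (hpq : p ≤ q + 1)
    (hG : ∀ v w, |G w - G v| ≤ C * (1 + ‖v‖ ^ p + ‖w - v‖ ^ p) * ‖w - v‖)
    {T : ℝ} (hT : 0 < T) (N : ℕ) (a c a' c' : Fin N × Fin d → ℝ) {R r : ℝ} (hR : 0 ≤ R)
    (hr : 0 < r) (h : 2 / T * (∑ i, a i ^ 2 + ∑ i, c i ^ 2) ≤ R ^ 2)
    (h' : 2 / T * (∑ i, a' i ^ 2 + ∑ i, c' i ^ 2) ≤ r ^ 2) (t : ℝ) :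
    ∫⁻ w, ‖G (truncatedPath T N (fun i => combine a c w i + combine a' c' w i) t) -
      G (truncatedPath T N (combine a c w) t)‖ₑ ∂(noisePair (Fin N × Fin d)) ≤
      ENNReal.ofReal (incrementBound d q C R r) := by
  set μ := noisePair (Fin N × Fin d)
  set X := fun w => ‖truncatedPath T N (combine a c w) t‖ with hX
  set D := fun w => ‖truncatedPath T N (combine a' c' w) t‖ with hD
  have m1 := moment_truncatedPath hT N a' c' hr.le h' t 0
  have m2 := moment_truncatedPath hT N a' c' hr.le h' t (q + 1)
  have m3 := moment_truncatedPath hT N a c hR h t (2 * q + 1)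
  have m4 := moment_truncatedPath hT N a' c' hr.le h' t 1
  set F := fun w => C * (3 * D w ^ (0 + 1) + D w ^ (q + 1 + 1) +
    (r * X w ^ (2 * q + 1 + 1) + r⁻¹ * D w ^ (1 + 1)) / 2) with hF
  have iF1 : Integrable (fun w => 3 * D w ^ (0 + 1) + D w ^ (q + 1 + 1)) μ :=
    (m1.1.const_mul 3).add m2.1
  have iF2 : Integrable (fun w => r * X w ^ (2 * q + 1 + 1) + r⁻¹ * D w ^ (1 + 1)) μ :=
    (m3.1.const_mul r).add (m4.1.const_mul r⁻¹)
  have iF : Integrable F μ := (iF1.add (iF2.div_const 2)).const_mul C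
  have hle : ∀ w, |G (truncatedPath T N (fun i => combine a c w i + combine a' c' w i) t) -
      G (truncatedPath T N (combine a c w) t)| ≤ F w := by
    intro w
    have e := hG (truncatedPath T N (combine a c w) t)
      (truncatedPath T N (fun i => combine a c w i + combine a' c' w i) t)
    rw [truncatedPath_add, add_sub_cancel_left] at e
    rw [truncatedPath_add]
    refine e.trans ?_
    change C * (1 + X w ^ p + D w ^ p) * D w ≤ F w
    have hX0 : 0 ≤ X w := norm_nonneg _
    have hD0 : 0 ≤ D w := norm_nonneg _
    have e1 := rpow_le_one_add_pow hX0 hp hpq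
    have e2 := rpow_le_one_add_pow hD0 hp hpq
    rw [hF, mul_assoc]
    refine mul_le_mul_of_nonneg_left ?_ hC.le
    have e3 : (1 + X w ^ p + D w ^ p) * D w ≤ (1 + (1 + X w ^ (q + 1)) + (1 + D w ^ (q + 1))) * D w := by
      gcongr
    -- Young's inequality with weight `r`: as `D²` has mean of order `r²`, both terms have mean of
    -- order `r`.
    have e4 : X w ^ (q + 1) * D w ≤ (r * X w ^ (2 * q + 1 + 1) + r⁻¹ * D w ^ (1 + 1)) / 2 := by
      have e5 : (r * X w ^ (2 * q + 1 + 1) + r⁻¹ * D w ^ (1 + 1)) / 2 - X w ^ (q + 1) * D w =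
          r⁻¹ * (r * X w ^ (q + 1) - D w) ^ 2 / 2 := by
        field_simp
        ring
      have : 0 ≤ r⁻¹ * (r * X w ^ (q + 1) - D w) ^ 2 / 2 := by positivity
      linarith
    have e6 : (1 + (1 + X w ^ (q + 1)) + (1 + D w ^ (q + 1))) * D w =
      3 * D w ^ (0 + 1) + D w ^ (q + 1 + 1) + X w ^ (q + 1) * D w := by ring
    exact (e3.trans_eq e6).trans (add_le_add le_rfl e4)
  calc _ ≤ ∫⁻ w, ENNReal.ofReal (F w) ∂μ := by
        refine lintegral_mono fun w => ?_
        rw [Real.enorm_eq_ofReal_abs]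
        exact ENNReal.ofReal_le_ofReal (hle w)
    _ = ENNReal.ofReal (∫ w, F w ∂μ) :=
        (ofReal_integral_eq_lintegral_ofReal iF (Eventually.of_forall fun w =>
          (abs_nonneg _).trans (hle w))).symm
    _ ≤ _ := by
        refine ENNReal.ofReal_le_ofReal ?_
        rw [hF, integral_const_mul, integral_add iF1 (iF2.div_const 2),
          integral_add (m1.1.const_mul 3) m2.1, integral_div,
          integral_add (m3.1.const_mul r) (m4.1.const_mul r⁻¹), integral_const_mul,
          integral_const_mul, integral_const_mul, incrementBound]
        have hri : 0 ≤ r⁻¹ := (inv_pos.2 hr).le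
        refine mul_le_mul_of_nonneg_left (add_le_add (add_le_add ?_ m2.2) ?_) hC.le
        · exact mul_le_mul_of_nonneg_left m1.2 (by norm_num)
        · refine div_le_div_of_nonneg_right (add_le_add ?_ ?_) (by norm_num)
          · exact mul_le_mul_of_nonneg_left m3.2 hr.le
          · exact mul_le_mul_of_nonneg_left m4.2 hri

theorem measurable_truncatedFunctional {G : EuclideanSpace ℝ (Fin d) → ℝ} (hG : Continuous G)
    (T : ℝ) (N : ℕ) : Measurable (truncatedFunctional T G N) := by
  unfold truncatedFunctional pathFunctional intervalIntegral
  have hc : StronglyMeasurable (Function.uncurry fun (x : Fin N × Fin d → ℝ) (t : ℝ) =>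
      G (truncatedPath T N x t)) := (hG.comp (continuous_truncatedPath T N)).stronglyMeasurable
  exact (hc.integral_prod_right.sub hc.integral_prod_right).measurable

theorem intervalIntegrable_path {G : EuclideanSpace ℝ (Fin d) → ℝ} (hG : Continuous G)
    (T : ℝ) (N : ℕ) (x : Fin N × Fin d → ℝ) :
    IntervalIntegrable (fun t => G (truncatedPath T N x t)) volume 0 T := by
  have : Continuous fun t => G (truncatedPath T N x t) :=
    hG.comp ((continuous_truncatedPath T N).comp (continuous_const.prodMk continuous_id))
  exact this.intervalIntegrable 0 T

theorem le_truncatedFunctional {G : EuclideanSpace ℝ (Fin d) → ℝ} (hG : Continuous G)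
    {c : ℝ} (hc : ∀ u, c ≤ G u) {T : ℝ} (hT : 0 < T) (N : ℕ) (x : Fin N × Fin d → ℝ) :
    c * T ≤ truncatedFunctional T G N x := by
  have h := intervalIntegral.integral_mono_on hT.le
    (intervalIntegrable_const (c := c) (μ := volume)) (intervalIntegrable_path hG T N x)
    fun t _ => hc _
  rw [intervalIntegral.integral_const, smul_eq_mul, sub_zero, mul_comm] at h
  exact h

/-- Tonelli's theorem exchanges the time integral with the expectation, and the pointwise bound is
uniform in `t`. Lower integrals give integrability and the estimate at once. -/
theorem truncatedFunctional_increment {G : EuclideanSpace ℝ (Fin d) → ℝ} (hGc : Continuous G)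
    {C p : ℝ} (hC : 0 < C) (hp : 0 < p) {q : ℕ} (hpq : p ≤ q + 1)
    (hG : ∀ v w, |G w - G v| ≤ C * (1 + ‖v‖ ^ p + ‖w - v‖ ^ p) * ‖w - v‖)
    {T : ℝ} (hT : 0 < T) (N : ℕ) (a c a' c' : Fin N × Fin d → ℝ) {R r : ℝ} (hR : 0 ≤ R)
    (hr : 0 < r) (h : 2 / T * (∑ i, a i ^ 2 + ∑ i, c i ^ 2) ≤ R ^ 2)
    (h' : 2 / T * (∑ i, a' i ^ 2 + ∑ i, c' i ^ 2) ≤ r ^ 2) :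
    Integrable (fun w => truncatedFunctional T G N (fun i => combine a c w i + combine a' c' w i) -
      truncatedFunctional T G N (combine a c w)) (noisePair (Fin N × Fin d)) ∧
    ∫ w, |truncatedFunctional T G N (fun i => combine a c w i + combine a' c' w i) -
      truncatedFunctional T G N (combine a c w)| ∂(noisePair (Fin N × Fin d)) ≤
      T * incrementBound d q C R r := by
  set μ := noisePair (Fin N × Fin d)
  set ν := volume.restrict (Set.Ioc 0 T) with hν
  set Y : (Fin N × Fin d → ℝ) × (Fin N × Fin d → ℝ) → Fin N × Fin d → ℝ :=
    fun w i => combine a c w i + combine a' c' w i with hY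
  have hYc : Continuous Y := (continuous_combine a c).add (continuous_combine a' c')
  have hm := measurable_truncatedFunctional hGc T N
  have hB0 : 0 ≤ incrementBound d q C R r := by
    have := absMoment_nonneg
    have h1 := this 1
    have h2 := this (q + 2)
    have h3 := this (2 * q + 2)
    have h4 := this 2
    unfold incrementBound
    positivity
  have hmeas : Measurable fun w => truncatedFunctional T G N (Y w) -
      truncatedFunctional T G N (combine a c w) :=
    (hm.comp hYc.measurable).sub (hm.comp (continuous_combine a c).measurable)
  have hL : ∫⁻ w, ‖truncatedFunctional T G N (Y w) - truncatedFunctional T G N (combine a c w)‖ₑ ∂μ ≤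
      ENNReal.ofReal (T * incrementBound d q C R r) := by
    calc _ ≤ ∫⁻ w, ∫⁻ t, ‖G (truncatedPath T N (Y w) t) -
          G (truncatedPath T N (combine a c w) t)‖ₑ ∂ν ∂μ := by
          refine lintegral_mono fun w => ?_
          simp only [truncatedFunctional, pathFunctional]
          rw [← intervalIntegral.integral_sub (intervalIntegrable_path hGc T N _)
            (intervalIntegrable_path hGc T N _), intervalIntegral.integral_of_le hT.le]
          exact enorm_integral_le_lintegral_enorm _
      _ = ∫⁻ t, ∫⁻ w, ‖G (truncatedPath T N (Y w) t) -
          G (truncatedPath T N (combine a c w) t)‖ₑ ∂μ ∂ν := by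
          refine lintegral_lintegral_swap ?_
          have h1 : Continuous fun q : ((Fin N × Fin d → ℝ) × (Fin N × Fin d → ℝ)) × ℝ =>
              truncatedPath T N (Y q.1) q.2 := (continuous_truncatedPath T N).comp
            ((hYc.comp continuous_fst).prodMk continuous_snd)
          have h2 : Continuous fun q : ((Fin N × Fin d → ℝ) × (Fin N × Fin d → ℝ)) × ℝ =>
              truncatedPath T N (combine a c q.1) q.2 := (continuous_truncatedPath T N).comp
            (((continuous_combine a c).comp continuous_fst).prodMk continuous_snd)
          exact ((hGc.comp h1).sub (hGc.comp h2)).enorm.aemeasurable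
      _ ≤ ∫⁻ _t, ENNReal.ofReal (incrementBound d q C R r) ∂ν :=
          lintegral_mono fun t => moment_increment hC hp hpq hG hT N a c a' c' hR hr h h' t
      _ = _ := by
          rw [lintegral_const, hν, Measure.restrict_apply_univ, Real.volume_Ioc, sub_zero,
            ENNReal.ofReal_mul hT.le, mul_comm]
  refine ⟨⟨hmeas.aestronglyMeasurable, lt_of_le_of_lt hL ENNReal.ofReal_lt_top⟩, ?_⟩
  have := integral_norm_eq_lintegral_enorm (μ := μ) hmeas.aestronglyMeasurable
  simp only [Real.norm_eq_abs] at this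
  rw [this]
  refine (ENNReal.toReal_mono ENNReal.ofReal_ne_top hL).trans (le_of_eq ?_)
  rw [ENNReal.toReal_ofReal (by positivity)]

end Path

/-! ### The limiting constants -/

theorem exp_neg_gaussianPotential (u : ℝ) :
    Real.exp (-gaussianPotential u) = gaussianPDFReal 0 1 u := by
  have h : 0 < Real.sqrt (2 * Real.pi) := by positivity
  rw [gaussianPotential, neg_add, Real.exp_add, Real.exp_neg (Real.log _), Real.exp_log h,
    gaussianPDFReal, mul_comm]
  simp [neg_div]

theorem hasDerivAt_gaussianPotential (u : ℝ) : HasDerivAt gaussianPotential u u := by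
  have := ((hasDerivAt_pow 2 u).div_const 2).add_const (Real.log (Real.sqrt (2 * Real.pi)))
  refine this.congr_deriv ?_
  simp

theorem deriv_gaussianPotential : deriv gaussianPotential = fun u => u :=
  funext fun u => (hasDerivAt_gaussianPotential u).deriv

theorem constRWM_gaussianPotential : constRWM gaussianPotential = 1 := by
  have h := integral_fst_sq_gaussian
  rw [integral_fun_fst (μ := gaussianReal 0 1) (ν := gaussianReal 0 1) (fun u : ℝ => u ^ 2),
    integral_gaussianReal_eq_integral_smul one_ne_zero] at h
  simp only [probReal_univ, smul_eq_mul, one_mul] at h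
  rw [constRWM, deriv_gaussianPotential, ← h]
  simp_rw [exp_neg_gaussianPotential, mul_comm]

theorem constSLA_gaussianPotential : constSLA gaussianPotential = 1 / 16 := by
  have h2 : iteratedDeriv 2 gaussianPotential = fun _ => 1 := by
    rw [iteratedDeriv_succ, iteratedDeriv_one, deriv_gaussianPotential]
    simp
  have h3 : iteratedDeriv 3 gaussianPotential = fun _ => 0 := by
    rw [iteratedDeriv_succ, h2]
    simp
  rw [constSLA, h2, h3]
  simp_rw [exp_neg_gaussianPotential]
  rw [integral_const_mul, integral_gaussianPDFReal_eq_one _ one_ne_zero]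
  norm_num

/-- For the standard normal density the constants `K` are `1` and `3 / 48 = 1 / 16`, which are the
values of `varFactor`. -/
theorem limitAcceptance_eq (alg : Algorithm) {τ l : ℝ} (hτ : 0 ≤ τ) (hl : 0 < l) :
    limitAcceptance alg τ l = gaussianAcceptance (alg.varFactor * (l ^ alg.power * τ)) := by
  cases alg with
  | rwm =>
    simp only [limitAcceptance, Algorithm.varFactor, Algorithm.power, constRWM_gaussianPotential]
    rw [gaussianAcceptance_eq (by positivity), one_mul, one_mul, Real.sqrt_mul (by positivity),
      Real.sqrt_sq hl.le]
    ring_nf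
  | sla =>
    simp only [limitAcceptance, Algorithm.varFactor, Algorithm.power, constSLA_gaussianPotential]
    have e : (1 / 16 : ℝ) * (l ^ 6 * τ) = (l ^ 3) ^ 2 * (1 / 16 * τ) := by ring
    rw [gaussianAcceptance_eq (by positivity), e,
      Real.sqrt_mul (by positivity : 0 ≤ (l ^ 3) ^ 2) (1 / 16 * τ), Real.sqrt_sq (by positivity)]
    ring_nf

theorem gaussianAcceptance_zero : gaussianAcceptance 0 = 1 := by
  simp [gaussianAcceptance]

/-! ### Power sums -/

theorem sum_range_succ_sq (N : ℕ) :
    ∑ k ∈ Finset.range N, ((k : ℝ) + 1) ^ 2 = (N : ℝ) * ((N : ℝ) + 1) * (2 * (N : ℝ) + 1) / 6 := by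
  induction N with
  | zero => simp
  | succ n ih => rw [Finset.sum_range_succ, ih]; push_cast; ring

theorem sum_range_succ_pow_six (N : ℕ) :
    ∑ k ∈ Finset.range N, ((k : ℝ) + 1) ^ 6 =
      (N : ℝ) * ((N : ℝ) + 1) * (2 * (N : ℝ) + 1) *
        (3 * (N : ℝ) ^ 4 + 6 * (N : ℝ) ^ 3 - 3 * (N : ℝ) + 1) / 42 := by
  induction N with
  | zero => simp
  | succ n ih => rw [Finset.sum_range_succ, ih]; push_cast; ring

/-- After division by `N ^ (r + 1)` the closed formula is a polynomial in `1 / N`, evaluated at `0`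
in the limit. -/
theorem tendsto_power_sum (alg : Algorithm) :
    Tendsto (fun N : ℕ => (∑ k ∈ Finset.range N, ((k : ℝ) + 1) ^ alg.power) /
      (N : ℝ) ^ (alg.power + 1)) atTop (𝓝 (1 / (alg.power + 1))) := by
  have hx : Tendsto (fun N : ℕ => ((N : ℝ))⁻¹) atTop (𝓝 0) := tendsto_inv_atTop_nhds_zero_nat
  cases alg with
  | rwm =>
    have hc : Continuous fun x : ℝ => (1 + x) * (2 + x) / 6 := by fun_prop
    have h := (hc.tendsto 0).comp hx
    have e : (1 + (0 : ℝ)) * (2 + 0) / 6 = 1 / (((Algorithm.rwm.power : ℕ) : ℝ) + 1) := by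
      simp only [Algorithm.power]; norm_num
    rw [← e]
    refine h.congr' ?_
    filter_upwards [eventually_gt_atTop 0] with N hN
    have hN' : (N : ℝ) ≠ 0 := by exact_mod_cast hN.ne'
    simp only [Algorithm.power, sum_range_succ_sq, Function.comp_apply]
    field_simp
  | sla =>
    have hc : Continuous fun x : ℝ => (1 + x) * (2 + x) * (3 + 6 * x - 3 * x ^ 3 + x ^ 4) / 42 := by
      fun_prop
    have h := (hc.tendsto 0).comp hx
    have e : (1 + (0 : ℝ)) * (2 + 0) * (3 + 6 * 0 - 3 * 0 ^ 3 + 0 ^ 4) / 42 =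
        1 / (((Algorithm.sla.power : ℕ) : ℝ) + 1) := by
      simp only [Algorithm.power]; norm_num
    rw [← e]
    refine h.congr' ?_
    filter_upwards [eventually_gt_atTop 0] with N hN
    have hN' : (N : ℝ) ≠ 0 := by exact_mod_cast hN.ne'
    simp only [Algorithm.power, sum_range_succ_pow_six, Function.comp_apply]
    field_simp
    ring

theorem sum_inv_sq_le (N : ℕ) :
    ∑ k ∈ Finset.range N, (((k : ℝ) + 1)⁻¹) ^ 2 ≤ 2 - 1 / (N : ℝ) := by
  induction N with
  | zero => norm_num
  | succ n ih =>
    rw [Finset.sum_range_succ]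
    rcases Nat.eq_zero_or_pos n with hn | hn
    · subst hn; norm_num
    have hn' : (0 : ℝ) < n := by exact_mod_cast hn
    -- The telescoping bound needs `n > 0`; at `n = 0` the convention `1 / 0 = 0` forces the
    -- separate case.
    have h : (((n : ℝ) + 1)⁻¹) ^ 2 ≤ 1 / (n : ℝ) - 1 / ((n : ℝ) + 1) := by
      rw [div_sub_div _ _ hn'.ne' (by positivity), inv_pow, inv_eq_one_div,
        div_le_div_iff₀ (by positivity) (by positivity)]
      nlinarith
    push_cast
    linarith

/-! ### The standard deviations of the bridge -/

/-- The standard deviation of the coefficients with frequency `1`. -/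
def bridgeScale (β T : ℝ) : ℝ := Real.sqrt (2 / β * (T ^ 2 / Real.pi ^ 2))

section Bridge

variable {β T : ℝ}

theorem bridgeScale_pos (hβ : 0 < β) (hT : 0 < T) : 0 < bridgeScale β T := by
  have := Real.pi_pos
  exact Real.sqrt_pos.2 (by positivity)

theorem bridgeScale_sq (hβ : 0 < β) : bridgeScale β T ^ 2 = 2 / β * (T ^ 2 / Real.pi ^ 2) := by
  have := Real.pi_pos
  exact Real.sq_sqrt (by positivity)

theorem bridgeSD_eq (hβ : 0 < β) (N d : ℕ) (i : Fin N × Fin d) :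
    bridgeSD β T N d i = bridgeScale β T / (((i.1 : ℕ) : ℝ) + 1) := by
  have := Real.pi_pos
  rw [bridgeSD, Real.sqrt_mul (by positivity), Real.sqrt_sq (by positivity)]
  rfl

theorem bridgeSD_pos (hβ : 0 < β) (hT : 0 < T) (N d : ℕ) (i : Fin N × Fin d) :
    0 < bridgeSD β T N d i := by
  have := bridgeScale_pos hβ hT
  rw [bridgeSD_eq hβ]
  positivity

theorem bridgeSD_decay (hβ : 0 < β) (hT : 0 < T) {d : ℕ} (hd : 0 < d) :
    ∃ c C : ℝ, 0 < c ∧ 0 < C ∧ ∀ (N : ℕ) (i : Fin N × Fin d),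
      c * ((d * (i.1 : ℕ) + (i.2 : ℕ) + 1 : ℕ) : ℝ) ^ (-(1 : ℝ)) ≤ bridgeSD β T N d i ∧
      bridgeSD β T N d i ≤ C * ((d * (i.1 : ℕ) + (i.2 : ℕ) + 1 : ℕ) : ℝ) ^ (-(1 : ℝ)) := by
  have h0 := bridgeScale_pos hβ hT
  have hd' : (0 : ℝ) < d := by exact_mod_cast hd
  refine ⟨bridgeScale β T, d * bridgeScale β T, h0, by positivity, fun N i => ?_⟩
  rw [bridgeSD_eq hβ, Real.rpow_neg_one, ← div_eq_mul_inv, ← div_eq_mul_inv]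
  -- The coordinates of frequency `k + 1` carry the numbers `d k + 1, …, d (k + 1)`, so number and
  -- frequency are comparable up to the factor `d`.
  have h1 : (i.1 : ℕ) + 1 ≤ d * (i.1 : ℕ) + (i.2 : ℕ) + 1 := by nlinarith [(i.1 : ℕ).zero_le]
  have h2 : d * (i.1 : ℕ) + (i.2 : ℕ) + 1 ≤ d * ((i.1 : ℕ) + 1) := by
    have := i.2.isLt
    nlinarith
  have h1' : (((i.1 : ℕ) : ℝ) + 1) ≤ ((d * (i.1 : ℕ) + (i.2 : ℕ) + 1 : ℕ) : ℝ) := by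
    exact_mod_cast h1
  have h2' : ((d * (i.1 : ℕ) + (i.2 : ℕ) + 1 : ℕ) : ℝ) ≤ d * (((i.1 : ℕ) : ℝ) + 1) := by
    exact_mod_cast h2
  have h3 : (0 : ℝ) < ((d * (i.1 : ℕ) + (i.2 : ℕ) + 1 : ℕ) : ℝ) := by positivity
  constructor
  · exact div_le_div_of_nonneg_left h0.le (by positivity) h1'
  · rw [div_le_div_iff₀ (by positivity) h3]
    nlinarith

theorem sum_bridge (N d : ℕ) (F : ℕ → ℝ) :
    ∑ i : Fin N × Fin d, F i.1 = d * ∑ k ∈ Finset.range N, F k := by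
  rw [Fintype.sum_prod_type, Finset.sum_range, Finset.mul_sum]
  simp

theorem sum_bridgeSD_sq_le (hβ : 0 < β) (N d : ℕ) :
    ∑ i : Fin N × Fin d, bridgeSD β T N d i ^ 2 ≤ 2 * d * bridgeScale β T ^ 2 := by
  simp_rw [bridgeSD_eq hβ]
  rw [sum_bridge N d (fun k => (bridgeScale β T / ((k : ℝ) + 1)) ^ 2)]
  simp_rw [div_eq_mul_inv, mul_pow]
  rw [← Finset.mul_sum]
  have h := sum_inv_sq_le N
  have h1 : 0 ≤ 1 / (N : ℝ) := by positivity
  have h2 : 0 ≤ (d : ℝ) * bridgeScale β T ^ 2 := by positivity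
  nlinarith

/-- The scaled sum of inverse powers that defines `τ`. -/
def tauSeq (alg : Algorithm) (β T : ℝ) (d N : ℕ) : ℝ :=
  dimension d N ^ (-((alg.power : ℝ) * 1 + 1)) *
    ∑ i : Fin N × Fin d, (bridgeSD β T N d i)⁻¹ ^ alg.power

/-- The sum is `d` times a sum of `r`-th powers up to `N`, against `n ^ (r + 1) = d ^ (r + 1) N ^ (r
+ 1)`; hence the factors `d ^ (-r)` and `1 / (r + 1)`. -/
theorem tendsto_tauSeq (alg : Algorithm) (hβ : 0 < β) (hT : 0 < T) {d : ℕ} (hd : 0 < d) :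
    Tendsto (tauSeq alg β T d) atTop
      (𝓝 ((bridgeScale β T)⁻¹ ^ alg.power / d ^ alg.power * (1 / (alg.power + 1)))) := by
  have h0 := bridgeScale_pos hβ hT
  have hd' : (d : ℝ) ≠ 0 := by exact_mod_cast hd.ne'
  refine ((tendsto_power_sum alg).const_mul
    ((bridgeScale β T)⁻¹ ^ alg.power / d ^ alg.power)).congr' ?_
  filter_upwards [eventually_gt_atTop 0] with N hN
  have hN' : (N : ℝ) ≠ 0 := by exact_mod_cast hN.ne'
  have e1 : dimension d N ^ (-((alg.power : ℝ) * 1 + 1)) = (((d : ℝ) * N) ^ (alg.power + 1))⁻¹ := by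
    rw [dimension, Real.rpow_neg (by positivity), mul_one, ← Real.rpow_natCast]
    push_cast
    rfl
  rw [tauSeq, e1]
  simp_rw [bridgeSD_eq hβ]
  rw [sum_bridge N d (fun k => (bridgeScale β T / ((k : ℝ) + 1))⁻¹ ^ alg.power)]
  simp_rw [inv_div, div_pow]
  rw [← Finset.sum_div, inv_pow, mul_pow]
  field_simp
  ring

end Bridge

/-! ### Uniform estimates for the truncated bridge -/

section Uniform

variable {d : ℕ} {G : EuclideanSpace ℝ (Fin d) → ℝ} {β T : ℝ}

theorem rescale_eq_combine {ι : Type*} (sd : ι → ℝ) (w : (ι → ℝ) × (ι → ℝ)) :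
    rescale sd w.1 = combine sd (fun _ => 0) w := by
  ext i; simp [rescale, combine]

/-- A bound of the standard deviation of the truncated paths under the reference law. -/
def pathScale (β T : ℝ) (d : ℕ) : ℝ := Real.sqrt (2 / T * (2 * d * bridgeScale β T ^ 2))

theorem pathScale_pos (hβ : 0 < β) (hT : 0 < T) (hd : 0 < d) : 0 < pathScale β T d := by
  have := bridgeScale_pos hβ hT
  have hd' : (0 : ℝ) < d := by exact_mod_cast hd
  exact Real.sqrt_pos.2 (by positivity)

theorem pathScale_sq_ge (hβ : 0 < β) (hT : 0 < T) (N : ℕ) :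
    2 / T * (∑ i, bridgeSD β T N d i ^ 2 + ∑ _i : Fin N × Fin d, (0 : ℝ) ^ 2) ≤
      pathScale β T d ^ 2 := by
  rw [pathScale, Real.sq_sqrt (by positivity)]
  have := sum_bridgeSD_sq_le (T := T) hβ N d
  simp only [ne_eq, OfNat.ofNat_ne_zero, not_false_eq_true, zero_pow, Finset.sum_const_zero,
    add_zero]
  gcongr

theorem truncatedFunctional_zero (T : ℝ) (N : ℕ) :
    truncatedFunctional T G N (fun _ => 0) = T * G 0 := by
  simp [truncatedFunctional, pathFunctional, truncatedPath_zero]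

theorem integral_comp_rescale {ι : Type*} [Fintype ι] (sd : ι → ℝ) {F : (ι → ℝ) → ℝ}
    (hF : Measurable F) : ∫ x, F x ∂(refMeasure sd) = ∫ ξ, F (rescale sd ξ) ∂(noiseMeasure ι) := by
  rw [refMeasure_eq_map, integral_map (measurable_rescale sd).aemeasurable hF.aestronglyMeasurable]

/-- The normalising constants are bounded away from zero. -/
theorem exists_normalization (hβ : 0 < β) (hT : 0 < T) (hd : 0 < d) (hG : GrowthCondition G) :
    ∃ c z : ℝ, 0 < z ∧ (∀ N x, c ≤ truncatedFunctional T G N x) ∧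
      ∀ N, z ≤ ∫ x, Real.exp (-truncatedFunctional T G N x) ∂(refMeasure (bridgeSD β T N d)) := by
  have hGc := continuous_of_growthCondition hG
  obtain ⟨⟨c, hc⟩, C, p, hC, hp, h⟩ := hG
  obtain ⟨q, hq⟩ := exists_nat_ge p
  have hpq : p ≤ (q : ℝ) + 1 := by linarith
  have hR := pathScale_pos hβ hT hd
  set B := T * G 0 + T * incrementBound d q C 0 (pathScale β T d) with hB
  refine ⟨c * T, Real.exp (-B), Real.exp_pos _, fun N x => le_truncatedFunctional hGc hc hT N x,
    fun N => ?_⟩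
  set phi := truncatedFunctional T G N with hphi
  have hm : Measurable phi := measurable_truncatedFunctional hGc T N
  -- The whole path is treated as an increment from the zero path (`R = 0`), which bounds the mean
  -- of `φ` by `B` uniformly in `N`.
  have hinc := truncatedFunctional_increment hGc hC hp hpq h hT N (fun _ => 0) (fun _ => 0)
    (bridgeSD β T N d) (fun _ => 0) le_rfl hR (by simp) (pathScale_sq_ge hβ hT N)
  have e1 : ∀ w : (Fin N × Fin d → ℝ) × (Fin N × Fin d → ℝ),
      truncatedFunctional T G N (fun i => combine (fun _ => 0) (fun _ => 0) w i +
        combine (bridgeSD β T N d) (fun _ => 0) w i) -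
        truncatedFunctional T G N (combine (fun _ => 0) (fun _ => 0) w) =
      phi (rescale (bridgeSD β T N d) w.1) - T * G 0 := by
    intro w
    have e2 : combine (fun _ => 0) (fun _ => 0) w = fun _ : Fin N × Fin d => 0 := by
      ext i; simp [combine]
    rw [e2, truncatedFunctional_zero, rescale_eq_combine]
    simp [hphi]
  simp_rw [e1] at hinc
  have hi : Integrable (fun w : (Fin N × Fin d → ℝ) × (Fin N × Fin d → ℝ) =>
      phi (rescale (bridgeSD β T N d) w.1)) (noisePair (Fin N × Fin d)) := by
    have := hinc.1.add (integrable_const (T * G 0))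
    refine this.congr (Eventually.of_forall fun w => ?_)
    simp
  have hE : ∫ w, phi (rescale (bridgeSD β T N d) w.1) ∂(noisePair (Fin N × Fin d)) ≤ B := by
    have h1 : ∫ w, (phi (rescale (bridgeSD β T N d) w.1) - T * G 0) ∂(noisePair (Fin N × Fin d)) ≤
        T * incrementBound d q C 0 (pathScale β T d) :=
      (integral_mono hinc.1 hinc.1.abs fun w => le_abs_self _).trans hinc.2
    rw [integral_sub hi (integrable_const _)] at h1
    simp only [integral_const, probReal_univ, one_smul] at h1
    linarith
  have hZ : ∫ x, Real.exp (-phi x) ∂(refMeasure (bridgeSD β T N d)) =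
      ∫ w, Real.exp (-phi (rescale (bridgeSD β T N d) w.1)) ∂(noisePair (Fin N × Fin d)) := by
    rw [integral_comp_rescale _ (F := fun x => Real.exp (-phi x)) hm.neg.exp, noisePair,
      integral_fun_fst (μ := noiseMeasure (Fin N × Fin d)) (ν := noiseMeasure (Fin N × Fin d))
        (fun ξ => Real.exp (-phi (rescale (bridgeSD β T N d) ξ)))]
    simp
  rw [hZ]
  have hme : Measurable fun w : (Fin N × Fin d → ℝ) × (Fin N × Fin d → ℝ) =>
      Real.exp (-phi (rescale (bridgeSD β T N d) w.1)) :=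
    (hm.comp ((measurable_rescale _).comp measurable_fst)).neg.exp
  have hie : Integrable (fun w : (Fin N × Fin d → ℝ) × (Fin N × Fin d → ℝ) =>
      Real.exp (-phi (rescale (bridgeSD β T N d) w.1))) (noisePair (Fin N × Fin d)) := by
    refine (integrable_const (Real.exp (-(c * T)))).mono' hme.aestronglyMeasurable
      (Eventually.of_forall fun w => ?_)
    rw [Real.norm_of_nonneg (Real.exp_pos _).le]
    exact Real.exp_le_exp.2 (neg_le_neg (le_truncatedFunctional hGc hc hT N _))
  have hil : Integrable (fun w : (Fin N × Fin d → ℝ) × (Fin N × Fin d → ℝ) =>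
      Real.exp (-B) * (1 + B - phi (rescale (bridgeSD β T N d) w.1)))
      (noisePair (Fin N × Fin d)) := ((integrable_const _).sub hi).const_mul _
  -- Jensen's inequality through the tangent line at `B`: `e^{-φ} ≥ e^{-B} (1 + B - φ)`.
  calc Real.exp (-B) ≤ Real.exp (-B) *
        (1 + B - ∫ w, phi (rescale (bridgeSD β T N d) w.1) ∂(noisePair (Fin N × Fin d))) :=
        le_mul_of_one_le_right (Real.exp_pos _).le (by linarith)
    _ = ∫ w, Real.exp (-B) * (1 + B - phi (rescale (bridgeSD β T N d) w.1))
        ∂(noisePair (Fin N × Fin d)) := by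
        rw [integral_const_mul, integral_sub (integrable_const _) hi]
        simp
    _ ≤ _ := by
        refine integral_mono hil hie fun w => ?_
        have h1 := Real.add_one_le_exp (B - phi (rescale (bridgeSD β T N d) w.1))
        have h2 : Real.exp (-phi (rescale (bridgeSD β T N d) w.1)) =
            Real.exp (-B) * Real.exp (B - phi (rescale (bridgeSD β T N d) w.1)) := by
          rw [← Real.exp_add]; ring_nf
        simp only [h2]
        exact mul_le_mul_of_nonneg_left (by linarith) (Real.exp_pos _).le

theorem integral_relDensity {ι : Type*} [Fintype ι] (sd : ι → ℝ) {phi : (ι → ℝ) → ℝ}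
    (hphi : Measurable phi) (hZ : 0 < ∫ x, Real.exp (-phi x) ∂(refMeasure sd)) :
    ∫ ξ, relDensity sd phi ξ ∂(noiseMeasure ι) = 1 := by
  unfold relDensity
  rw [integral_div, ← integral_comp_rescale sd (F := fun x => Real.exp (-phi x)) hphi.neg.exp,
    div_self hZ.ne']

theorem functional_step_bound (alg : Algorithm) (hβ : 0 < β) (hT : 0 < T) (hGc : Continuous G)
    {C p : ℝ} (hC : 0 < C) (hp : 0 < p) {q : ℕ} (hpq : p ≤ q + 1)
    (hG : ∀ v w, |G w - G v| ≤ C * (1 + ‖v‖ ^ p + ‖w - v‖ ^ p) * ‖w - v‖) (N : ℕ) {σ r : ℝ}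
    (hσ : 0 < σ) (hη : ∀ i, σ / bridgeSD β T N d i ≤ 1) (hr : 0 < r)
    (hr2 : 4 / T * (dimension d N * σ ^ 2) ≤ r ^ 2) :
    Integrable (fun w => truncatedFunctional T G N (rescale (bridgeSD β T N d) w.1) -
      truncatedFunctional T G N (proposal alg (bridgeSD β T N d) σ
        (rescale (bridgeSD β T N d) w.1) w.2)) (noisePair (Fin N × Fin d)) ∧
    ∫ w, |truncatedFunctional T G N (rescale (bridgeSD β T N d) w.1) -
      truncatedFunctional T G N (proposal alg (bridgeSD β T N d) σ
        (rescale (bridgeSD β T N d) w.1) w.2)| ∂(noisePair (Fin N × Fin d)) ≤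
      T * incrementBound d q C (pathScale β T d) r := by
  set sd := bridgeSD β T N d with hsd
  have hsd0 := fun i => bridgeSD_pos hβ hT N d i
  -- The coefficient of `ξ i` in the increment. Like that of `z i`, its square is at most `σ²`; the
  -- total `2 n σ²` times `2 / T` explains the constant `4 / T`.
  set a' : Fin N × Fin d → ℝ := fun i => σ * (alg.drift * (σ / sd i)) with ha'
  have ha2 : ∀ i, a' i ^ 2 ≤ σ ^ 2 := by
    intro i
    have h1 : alg.drift ^ 2 ≤ 1 := by cases alg <;> simp only [Algorithm.drift] <;> norm_num
    have h2 : (σ / sd i) ^ 2 ≤ 1 := pow_le_one₀ (div_pos hσ (hsd0 i)).le (hη i)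
    rw [ha', mul_pow, mul_pow]
    exact mul_le_of_le_one_right (sq_nonneg σ) (mul_le_one₀ h1 (sq_nonneg _) h2)
  have h' : 2 / T * (∑ i, a' i ^ 2 + ∑ _i : Fin N × Fin d, σ ^ 2) ≤ r ^ 2 := by
    refine le_trans ?_ hr2
    have h3 : ∑ i, a' i ^ 2 ≤ ∑ _i : Fin N × Fin d, σ ^ 2 := Finset.sum_le_sum fun i _ => ha2 i
    have h4 : ∑ _i : Fin N × Fin d, σ ^ 2 = dimension d N * σ ^ 2 := by
      simp [dimension, mul_comm]
    have h5 : 4 / T * (dimension d N * σ ^ 2) =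
        2 / T * (dimension d N * σ ^ 2 + dimension d N * σ ^ 2) := by ring
    rw [h5, h4]
    rw [h4] at h3
    gcongr
  have hinc := truncatedFunctional_increment hGc hC hp hpq hG hT N sd (fun _ => 0) a' (fun _ => σ)
    (Real.sqrt_nonneg _ : 0 ≤ pathScale β T d) hr (pathScale_sq_ge hβ hT N) h'
  have e : ∀ w : (Fin N × Fin d → ℝ) × (Fin N × Fin d → ℝ),
      truncatedFunctional T G N (fun i => combine sd (fun _ => 0) w i +
        combine a' (fun _ => σ) w i) - truncatedFunctional T G N (combine sd (fun _ => 0) w) =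
      -(truncatedFunctional T G N (rescale sd w.1) -
        truncatedFunctional T G N (proposal alg sd σ (rescale sd w.1) w.2)) := by
    intro w
    rw [neg_sub, rescale_eq_combine]
    congr 2
    ext i
    rw [← rescale_eq_combine, proposal_eq alg hsd0]
    simp only [rescale, combine, ha']
    ring
  simp_rw [e, abs_neg] at hinc
  refine ⟨?_, hinc.2⟩
  exact hinc.1.neg.congr (Eventually.of_forall fun w => by simp)

end Uniform

/-! ### Asymptotics of the step-sizes -/

section Asymptotics

variable {d : ℕ} {β T l ρ : ℝ}

theorem tendsto_dimension (hd : 0 < d) : Tendsto (dimension d) atTop atTop := by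
  unfold dimension
  exact tendsto_natCast_atTop_atTop.comp (tendsto_id.const_mul_atTop' hd)

theorem dimension_pos (hd : 0 < d) {N : ℕ} (hN : 0 < N) : 0 < dimension d N := by
  unfold dimension
  exact_mod_cast Nat.mul_pos hd hN

theorem stepSize_sq (d : ℕ) (l ρ : ℝ) (N : ℕ) :
    stepSize d l ρ N ^ 2 = l ^ 2 * dimension d N ^ (-ρ) := by
  have : 0 ≤ dimension d N := by unfold dimension; positivity
  rw [stepSize, Real.sq_sqrt (by positivity)]

theorem stepSize_eq (hl : 0 < l) {N : ℕ} (hn : 0 < dimension d N) :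
    stepSize d l ρ N = l * dimension d N ^ (-ρ / 2) := by
  rw [stepSize, Real.sqrt_mul (sq_nonneg l), Real.sqrt_sq hl.le, Real.sqrt_eq_rpow,
    ← Real.rpow_mul hn.le]
  ring_nf

theorem stepSize_pos (hl : 0 < l) {N : ℕ} (hn : 0 < dimension d N) : 0 < stepSize d l ρ N := by
  rw [stepSize_eq hl hn]
  positivity

theorem tendsto_dimension_rpow (hd : 0 < d) {e : ℝ} (he : e < 0) :
    Tendsto (fun N => dimension d N ^ e) atTop (𝓝 0) := by
  have := (tendsto_rpow_neg_atTop (neg_pos.2 he)).comp (tendsto_dimension hd)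
  simpa [Function.comp_def] using this

/-- The bound of the ratios of the step-size and the standard deviations. -/
def maxRatio (d : ℕ) (β T l ρ : ℝ) (N : ℕ) : ℝ :=
  l * dimension d N ^ (1 - ρ / 2) / bridgeScale β T

theorem tendsto_maxRatio (hd : 0 < d) (hρ : 2 < ρ) :
    Tendsto (maxRatio d β T l ρ) atTop (𝓝 0) := by
  have := ((tendsto_dimension_rpow hd (e := 1 - ρ / 2) (by linarith)).const_mul l).div_const
    (bridgeScale β T)
  rw [mul_zero, zero_div] at this
  exact this

theorem ratio_le_maxRatio (hβ : 0 < β) (hT : 0 < T) (hd : 0 < d) (hl : 0 < l) (N : ℕ)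
    (i : Fin N × Fin d) :
    stepSize d l ρ N / bridgeSD β T N d i ≤ maxRatio d β T l ρ N := by
  have hN : 0 < N := i.1.pos
  have hn := dimension_pos hd hN
  have h0 := bridgeScale_pos hβ hT
  have hk : (((i.1 : ℕ) : ℝ) + 1) ≤ dimension d N := by
    unfold dimension
    have h1 : (i.1 : ℕ) + 1 ≤ d * N := (Nat.succ_le_of_lt i.1.isLt).trans (Nat.le_mul_of_pos_left N hd)
    exact_mod_cast h1
  have e : dimension d N ^ (1 - ρ / 2) = dimension d N ^ (-ρ / 2) * dimension d N := by
    rw [← Real.rpow_add_one hn.ne']; ring_nf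
  rw [bridgeSD_eq hβ, stepSize_eq hl hn, maxRatio, e, div_div_eq_mul_div]
  refine div_le_div_of_nonneg_right ?_ h0.le
  rw [mul_assoc]
  gcongr

/-- The scale of the increments of the truncated paths. -/
def incrementScale (d : ℕ) (T l ρ : ℝ) (N : ℕ) : ℝ :=
  Real.sqrt (4 / T * (dimension d N * stepSize d l ρ N ^ 2))

theorem tendsto_incrementScale (hd : 0 < d) (hρ : 2 < ρ) :
    Tendsto (incrementScale d T l ρ) atTop (𝓝 0) := by
  have h := ((tendsto_dimension_rpow hd (e := 1 - ρ) (by linarith)).const_mul (4 / T * l ^ 2)).sqrt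
  rw [mul_zero, Real.sqrt_zero] at h
  refine h.congr' ?_
  filter_upwards [eventually_gt_atTop 0] with N hN
  have hn := dimension_pos hd hN
  have e : dimension d N ^ (1 - ρ) = dimension d N * dimension d N ^ (-ρ) := by
    rw [mul_comm, ← Real.rpow_add_one hn.ne']; ring_nf
  rw [incrementScale, stepSize_sq, e]
  ring_nf

theorem incrementScale_sq (hT : 0 < T) (N : ℕ) :
    incrementScale d T l ρ N ^ 2 = 4 / T * (dimension d N * stepSize d l ρ N ^ 2) := by
  have : 0 ≤ dimension d N := by unfold dimension; positivity
  rw [incrementScale, Real.sq_sqrt (by positivity)]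

theorem incrementScale_pos (hT : 0 < T) (hl : 0 < l) {N : ℕ} (hn : 0 < dimension d N) :
    0 < incrementScale d T l ρ N := by
  have := stepSize_pos (ρ := ρ) hl hn
  exact Real.sqrt_pos.2 (by positivity)

theorem tendsto_incrementBound (d q : ℕ) (C R : ℝ) {r : ℕ → ℝ} (hr : Tendsto r atTop (𝓝 0)) :
    Tendsto (fun N => incrementBound d q C R (r N)) atTop (𝓝 0) := by
  have e : ∀ x : ℝ, incrementBound d q C R x = C * (3 * ((d : ℝ) ^ 1 * absMoment 1 * x ^ 1) +
      (d : ℝ) ^ (q + 2) * absMoment (q + 2) * x ^ (q + 2) +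
      (x * ((d : ℝ) ^ (2 * q + 2) * absMoment (2 * q + 2) * R ^ (2 * q + 2)) +
        (d : ℝ) ^ 2 * absMoment 2 * x) / 2) := by
    intro x
    -- Because `0⁻¹ = 0`, the cancellation also holds at `x = 0`, and the bound is a polynomial
    -- vanishing there.
    have : x⁻¹ * ((d : ℝ) ^ 2 * absMoment 2 * x ^ 2) = (d : ℝ) ^ 2 * absMoment 2 * x := by
      rcases eq_or_ne x 0 with h | h
      · simp [h]
      · field_simp
    rw [incrementBound, this]
  have hc : Continuous fun x : ℝ => incrementBound d q C R x := by
    simp_rw [e]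
    fun_prop
  have := (hc.tendsto 0).comp hr
  simpa [e, Function.comp_def] using this

/-- The sum of powers of the ratios of the step-size and the standard deviations. -/
def ratioSum (alg : Algorithm) (d : ℕ) (β T l ρ : ℝ) (N : ℕ) : ℝ :=
  ∑ i : Fin N × Fin d, (stepSize d l ρ N / bridgeSD β T N d i) ^ alg.power

theorem Algorithm.index_mul_power (alg : Algorithm) : alg.index * (alg.power : ℝ) = 2 := by
  cases alg <;> simp only [index, power] <;> norm_num

theorem Algorithm.power_pos (alg : Algorithm) : (0 : ℝ) < alg.power := by
  cases alg <;> simp only [power] <;> norm_num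

/-- The relation `I * r = 2` makes the exponent vanish exactly at `ρ = 2 + I`. -/
theorem ratioSum_eq (alg : Algorithm) (hl : 0 < l) {N : ℕ} (hn : 0 < dimension d N) :
    ratioSum alg d β T l ρ N = l ^ alg.power *
      dimension d N ^ ((alg.power : ℝ) / 2 * (2 + alg.index - ρ)) * tauSeq alg β T d N := by
  have h := alg.index_mul_power
  have e : ((alg.power : ℝ) / 2 * (2 + alg.index - ρ)) + (-((alg.power : ℝ) * 1 + 1)) =
      -ρ / 2 * (alg.power : ℝ) := by linear_combination h / 2
  rw [tauSeq, mul_assoc, ← mul_assoc (dimension d N ^ _), ← Real.rpow_add hn, e,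
    Real.rpow_mul_natCast hn.le, ← mul_assoc, ← mul_pow, ← stepSize_eq hl hn, ratioSum,
    Finset.mul_sum]
  refine Finset.sum_congr rfl fun i _ => ?_
  rw [div_eq_mul_inv, mul_pow]

end Asymptotics

/-! ### The three scaling regimes of the truncated bridge -/

section Scaling

variable {d : ℕ} {G : EuclideanSpace ℝ (Fin d) → ℝ} {β T l ρ : ℝ}

/-- The estimates that hold for all large `N`. -/
structure StepEstimate (alg : Algorithm) (β T : ℝ) (G : EuclideanSpace ℝ (Fin d) → ℝ)
    (l ρ c K ε : ℝ) (N : ℕ) : Prop where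
  pos : 0 < N
  ratio_le_one : maxRatio d β T l ρ N ≤ 1
  lower : ∀ x, c ≤ truncatedFunctional T G N x
  norm_pos : 0 < ∫ x, Real.exp (-truncatedFunctional T G N x) ∂(refMeasure (bridgeSD β T N d))
  norm_le : Real.exp (-c) /
    (∫ x, Real.exp (-truncatedFunctional T G N x) ∂(refMeasure (bridgeSD β T N d))) ≤ K
  step_integrable : Integrable (fun w =>
    truncatedFunctional T G N (rescale (bridgeSD β T N d) w.1) -
      truncatedFunctional T G N (proposal alg (bridgeSD β T N d) (stepSize d l ρ N)
        (rescale (bridgeSD β T N d) w.1) w.2)) (noisePair (Fin N × Fin d))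
  step_le : ∫ w, |truncatedFunctional T G N (rescale (bridgeSD β T N d) w.1) -
      truncatedFunctional T G N (proposal alg (bridgeSD β T N d) (stepSize d l ρ N)
        (rescale (bridgeSD β T N d) w.1) w.2)| ∂(noisePair (Fin N × Fin d)) ≤ ε

theorem StepEstimate.relDensity_le {alg : Algorithm} {c K ε : ℝ} {N : ℕ}
    (h : StepEstimate alg β T G l ρ c K ε N) (ξ : Fin N × Fin d → ℝ) :
    relDensity (bridgeSD β T N d) (truncatedFunctional T G N) ξ ≤ K := by
  refine le_trans ?_ h.norm_le
  exact div_le_div_of_nonneg_right (Real.exp_le_exp.2 (neg_le_neg (h.lower _))) h.norm_pos.le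

theorem exists_stepEstimate (alg : Algorithm) (hβ : 0 < β) (hT : 0 < T) (hd : 0 < d)
    (hG : GrowthCondition G) (hl : 0 < l) (hρ : 2 < ρ) :
    ∃ (c K : ℝ) (ε : ℕ → ℝ), Tendsto ε atTop (𝓝 0) ∧
      ∀ᶠ N in atTop, StepEstimate alg β T G l ρ c K (ε N) N := by
  obtain ⟨c, z, hz, hc, hZ⟩ := exists_normalization hβ hT hd hG
  have hGc := continuous_of_growthCondition hG
  obtain ⟨-, C, p, hC, hp, h⟩ := hG
  obtain ⟨q, hq⟩ := exists_nat_ge p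
  refine ⟨c, Real.exp (-c) / z,
    fun N => T * incrementBound d q C (pathScale β T d) (incrementScale d T l ρ N), ?_, ?_⟩
  · simpa using (tendsto_incrementBound d q C (pathScale β T d)
      (tendsto_incrementScale (T := T) (l := l) hd hρ)).const_mul T
  have hm := (tendsto_maxRatio (β := β) (T := T) (l := l) hd hρ).eventually_le_const
    (show (0 : ℝ) < 1 by norm_num)
  filter_upwards [eventually_gt_atTop 0, hm] with N hN hmN
  have hn := dimension_pos hd hN
  have hstep := functional_step_bound alg hβ hT hGc hC hp (q := q) (by linarith) h N
    (stepSize_pos (ρ := ρ) hl hn) (fun i => (ratio_le_maxRatio hβ hT hd hl N i).trans hmN)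
    (incrementScale_pos (ρ := ρ) hT hl hn) (incrementScale_sq hT N).ge
  exact ⟨hN, hmN, hc N, hz.trans_le (hZ N),
    div_le_div_of_nonneg_left (Real.exp_pos _).le hz (hZ N), hstep.1, hstep.2⟩

theorem tendsto_ratioSum_critical (alg : Algorithm) (hd : 0 < d) (hl : 0 < l) {τ : ℝ}
    (hτ : Tendsto (tauSeq alg β T d) atTop (𝓝 τ)) (hρ : ρ = 2 + alg.index) :
    Tendsto (ratioSum alg d β T l ρ) atTop (𝓝 (l ^ alg.power * τ)) := by
  refine (hτ.const_mul (l ^ alg.power)).congr' ?_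
  filter_upwards [eventually_gt_atTop 0] with N hN
  rw [ratioSum_eq alg hl (dimension_pos hd hN), hρ]
  simp

theorem tendsto_ratioSum_small (alg : Algorithm) (hd : 0 < d) (hl : 0 < l) {τ : ℝ}
    (hτ : Tendsto (tauSeq alg β T d) atTop (𝓝 τ)) (hρ : 2 + alg.index < ρ) :
    Tendsto (ratioSum alg d β T l ρ) atTop (𝓝 0) := by
  have he : (alg.power : ℝ) / 2 * (2 + alg.index - ρ) < 0 :=
    mul_neg_of_pos_of_neg (by linarith [alg.power_pos]) (by linarith)
  have h := ((tendsto_dimension_rpow hd he).const_mul (l ^ alg.power)).mul hτ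
  rw [mul_zero, zero_mul] at h
  refine h.congr' ?_
  filter_upwards [eventually_gt_atTop 0] with N hN
  rw [ratioSum_eq alg hl (dimension_pos hd hN)]

theorem Algorithm.index_pos (alg : Algorithm) : 0 < alg.index := by
  cases alg <;> simp only [index] <;> norm_num

theorem Algorithm.power_ne_zero (alg : Algorithm) : alg.power ≠ 0 := by
  cases alg <;> simp only [power] <;> norm_num

/-- The variance of the leading part of the acceptance ratio without one coordinate. -/
def reducedVariance (alg : Algorithm) (d : ℕ) (β T l ρ : ℝ) (k N : ℕ) : ℝ :=
  alg.varFactor * ratioSum alg d β T l ρ N -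
    alg.lead (stepSize d l ρ N / (bridgeScale β T / ((k : ℝ) + 1))) ^ 2

/-- The ratio of the deleted coordinate is at most `maxRatio`, so its contribution vanishes. -/
theorem tendsto_reducedVariance (alg : Algorithm) (hβ : 0 < β) (hT : 0 < T) (hd : 0 < d)
    (hl : 0 < l) (hρ : 2 < ρ) {s : ℝ} (hs : Tendsto (ratioSum alg d β T l ρ) atTop (𝓝 s)) (k : ℕ) :
    Tendsto (reducedVariance alg d β T l ρ k) atTop (𝓝 (alg.varFactor * s)) := by
  have hm := tendsto_maxRatio (β := β) (T := T) (l := l) hd hρ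
  have h0 := bridgeScale_pos hβ hT
  have h1 : Tendsto (fun N => stepSize d l ρ N / (bridgeScale β T / ((k : ℝ) + 1))) atTop
      (𝓝 0) := by
    refine squeeze_zero' ?_ ?_ hm
    · filter_upwards [eventually_gt_atTop 0] with N hN
      have := stepSize_pos (ρ := ρ) hl (dimension_pos hd hN)
      positivity
    · filter_upwards [eventually_gt_atTop k] with N hN
      have := ratio_le_maxRatio (ρ := ρ) hβ hT hd hl N (⟨k, hN⟩, ⟨0, hd⟩)
      rwa [bridgeSD_eq hβ] at this
  have hc : Continuous fun η : ℝ => alg.lead η ^ 2 := by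
    simp_rw [alg.lead_sq]
    fun_prop
  have h2 := (hc.tendsto 0).comp h1
  have h3 := (hs.const_mul alg.varFactor).sub h2
  simp only [alg.lead_sq, zero_pow alg.power_ne_zero, mul_zero, sub_zero, Function.comp_def] at h3
  unfold reducedVariance
  simp only [alg.lead_sq]
  exact h3

theorem tendsto_acceptanceError (K Q : ℝ) {ε m s : ℕ → ℝ} {s₀ : ℝ} (hε : Tendsto ε atTop (𝓝 0))
    (hm : Tendsto m atTop (𝓝 0)) (hs : Tendsto s atTop (𝓝 s₀)) :
    Tendsto (fun N => acceptanceError K Q (ε N) (m N) (s N)) atTop (𝓝 0) := by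
  have hc : Continuous fun q : ℝ × ℝ × ℝ => acceptanceError K Q q.1 q.2.1 q.2.2 := by
    unfold acceptanceError
    fun_prop
  have := (hc.tendsto (0, 0, s₀)).comp (hε.prodMk_nhds (hm.prodMk_nhds hs))
  simpa [acceptanceError, Function.comp_def] using this

/-- Serves both the critical regime and the small steps, where `s = 0` gives the limit `1`. Any
coordinate can be deleted; the first one is taken. -/
theorem tendsto_bridgeAcceptance (alg : Algorithm) (hβ : 0 < β) (hT : 0 < T) (hd : 0 < d)
    (hG : GrowthCondition G) (hl : 0 < l) (hρ : 2 < ρ) {s : ℝ}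
    (hs : Tendsto (ratioSum alg d β T l ρ) atTop (𝓝 s)) :
    Tendsto (bridgeAcceptance alg β T G l ρ) atTop
      (𝓝 (gaussianAcceptance (alg.varFactor * s))) := by
  obtain ⟨c, K, ε, hε, hest⟩ := exists_stepEstimate alg hβ hT hd hG hl hρ
  have hGc := continuous_of_growthCondition hG
  have hv := (continuous_gaussianAcceptance.tendsto _).comp
    (tendsto_reducedVariance alg hβ hT hd hl hρ hs 0)
  have herr := tendsto_acceptanceError K 1 hε
    (tendsto_maxRatio (β := β) (T := T) (l := l) hd hρ) hs
  have hdiff : Tendsto (fun N => bridgeAcceptance alg β T G l ρ N -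
      gaussianAcceptance (reducedVariance alg d β T l ρ 0 N)) atTop (𝓝 0) := by
    refine squeeze_zero_norm' ?_ herr
    filter_upwards [hest] with N h
    have := abs_acceptance_sub_le alg (fun i => bridgeSD_pos hβ hT N d i)
      (stepSize_pos (ρ := ρ) hl (dimension_pos hd h.pos)) (measurable_truncatedFunctional hGc T N)
      h.norm_pos h.relDensity_le
      (integral_relDensity _ (measurable_truncatedFunctional hGc T N) h.norm_pos)
      h.ratio_le_one (fun i => ratio_le_maxRatio hβ hT hd hl N i) h.step_integrable h.step_le
      (⟨0, h.pos⟩, ⟨0, hd⟩)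
    rw [bridgeSD_eq hβ N d (⟨0, h.pos⟩, ⟨0, hd⟩)] at this
    rw [Real.norm_eq_abs]
    exact this
  simpa [Function.comp_def] using hdiff.add hv

theorem isLittleO_bridgeJump (alg : Algorithm) (hβ : 0 < β) (hT : 0 < T) (hd : 0 < d)
    (hG : GrowthCondition G) (hl : 0 < l) (hρ : 2 < ρ) {s : ℝ}
    (hs : Tendsto (ratioSum alg d β T l ρ) atTop (𝓝 s)) (k : ℕ) (j : Fin d) :
    (fun N => bridgeJump alg β T G l ρ k j N -
      l ^ 2 * gaussianAcceptance (alg.varFactor * s) * dimension d N ^ (-ρ))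
      =o[atTop] fun N => dimension d N ^ (-ρ) := by
  obtain ⟨c, K, ε, hε, hest⟩ := exists_stepEstimate alg hβ hT hd hG hl hρ
  have hGc := continuous_of_growthCondition hG
  have hv := (continuous_gaussianAcceptance.tendsto _).comp
    (tendsto_reducedVariance alg hβ hT hd hl hρ hs k)
  have herr := tendsto_acceptanceError K fourthMoment hε
    (tendsto_maxRatio (β := β) (T := T) (l := l) hd hρ) hs
  set a := gaussianAcceptance (alg.varFactor * s)
  -- The total relative error after division by `n ^ (-ρ)`: the Gaussian approximation, then the
  -- convergence of the reduced variance.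
  set δ : ℕ → ℝ := fun N => l ^ 2 * (acceptanceError K fourthMoment (ε N) (maxRatio d β T l ρ N)
    (ratioSum alg d β T l ρ N) + |gaussianAcceptance (reducedVariance alg d β T l ρ k N) - a|)
    with hδ
  have hδ0 : Tendsto δ atTop (𝓝 0) := by
    have h1 : Tendsto (fun N => |gaussianAcceptance (reducedVariance alg d β T l ρ k N) - a|) atTop
        (𝓝 0) := by
      have := (hv.sub_const a).abs
      simpa [Function.comp_def, a] using this
    simpa using (herr.add h1).const_mul (l ^ 2)
  have hO : (fun N => bridgeJump alg β T G l ρ k j N - l ^ 2 * a * dimension d N ^ (-ρ))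
      =O[atTop] fun N => δ N * dimension d N ^ (-ρ) := by
    refine IsBigO.of_bound 1 ?_
    filter_upwards [hest, eventually_gt_atTop k] with N h hk
    have hn := dimension_pos hd h.pos
    have := abs_squaredJump_sub_le alg (fun i => bridgeSD_pos hβ hT N d i)
      (stepSize_pos (ρ := ρ) hl hn) (measurable_truncatedFunctional hGc T N)
      h.norm_pos h.relDensity_le
      (integral_relDensity _ (measurable_truncatedFunctional hGc T N) h.norm_pos)
      h.ratio_le_one (fun i => ratio_le_maxRatio hβ hT hd hl N i) h.step_integrable h.step_le
      (⟨k, hk⟩, j)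
    rw [bridgeSD_eq hβ N d (⟨k, hk⟩, j)] at this
    have e1 : bridgeJump alg β T G l ρ k j N = squaredJump alg (bridgeSD β T N d)
        (truncatedFunctional T G N) (stepSize d l ρ N) (⟨k, hk⟩, j) := by
      rw [bridgeJump, dif_pos hk]
    change |_ - _ * gaussianAcceptance (reducedVariance alg d β T l ρ k N)| ≤
      _ * acceptanceError K fourthMoment (ε N) (maxRatio d β T l ρ N)
        (ratioSum alg d β T l ρ N) at this
    rw [← e1, stepSize_sq] at this
    have hp : 0 < dimension d N ^ (-ρ) := Real.rpow_pos_of_pos hn _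
    rw [one_mul, Real.norm_eq_abs]
    refine le_trans ?_ (le_abs_self _)
    set A := gaussianAcceptance (reducedVariance alg d β T l ρ k N)
    calc |bridgeJump alg β T G l ρ k j N - l ^ 2 * a * dimension d N ^ (-ρ)|
        = |(bridgeJump alg β T G l ρ k j N - l ^ 2 * dimension d N ^ (-ρ) * A) +
            l ^ 2 * dimension d N ^ (-ρ) * (A - a)| := by ring_nf
      _ ≤ l ^ 2 * dimension d N ^ (-ρ) * acceptanceError K fourthMoment (ε N)
            (maxRatio d β T l ρ N) (ratioSum alg d β T l ρ N) +
          l ^ 2 * dimension d N ^ (-ρ) * |A - a| := by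
          refine (abs_add_le _ _).trans (add_le_add this (le_of_eq ?_))
          rw [abs_mul, abs_of_pos (mul_pos (pow_pos hl 2) hp)]
      _ = δ N * dimension d N ^ (-ρ) := by rw [hδ]; ring
  refine hO.trans_isLittleO ?_
  have := ((isLittleO_one_iff ℝ).2 hδ0).mul_isBigO (isBigO_refl (fun N => dimension d N ^ (-ρ)) atTop)
  simpa using this

theorem bridgeAcceptance_nonneg_le (alg : Algorithm) (hβ : 0 < β) (hT : 0 < T) (hd : 0 < d)
    (hGc : Continuous G) (hl : 0 < l) {c K ε : ℝ} {N : ℕ}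
    (h : StepEstimate alg β T G l ρ c K ε N) :
    0 ≤ bridgeAcceptance alg β T G l ρ N ∧ bridgeAcceptance alg β T G l ρ N ≤
      K * Real.exp (-(ratioSum alg d β T l ρ N) / 256) := by
  have := meanAcceptance_nonneg_le alg (fun i => bridgeSD_pos hβ hT N d i)
    (stepSize_pos (ρ := ρ) hl (dimension_pos hd h.pos)) (measurable_truncatedFunctional hGc T N)
    h.lower h.norm_pos fun i => (ratio_le_maxRatio hβ hT hd hl N i).trans h.ratio_le_one
  exact ⟨this.1, this.2.trans (mul_le_mul_of_nonneg_right h.norm_le (Real.exp_pos _).le)⟩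

theorem tendsto_dimension_mul_bridgeAcceptance (alg : Algorithm) (hβ : 0 < β) (hT : 0 < T)
    (hd : 0 < d) (hG : GrowthCondition G) (hl : 0 < l) (hρ : 2 < ρ) (hρ' : ρ < 2 + alg.index)
    {τ : ℝ} (hτ0 : 0 < τ) (hτ : Tendsto (tauSeq alg β T d) atTop (𝓝 τ)) (p : ℝ) :
    Tendsto (fun N => dimension d N ^ p * bridgeAcceptance alg β T G l ρ N) atTop (𝓝 0) := by
  obtain ⟨c, K, ε, hε, hest⟩ := exists_stepEstimate alg hβ hT hd hG hl hρ
  have hGc := continuous_of_growthCondition hG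
  set e := (alg.power : ℝ) / 2 * (2 + alg.index - ρ) with he
  have he0 : 0 < e := mul_pos (by linarith [alg.power_pos]) (by linarith)
  set b := l ^ alg.power * (τ / 2) / 256 with hb
  have hb0 : 0 < b := by positivity
  -- With `u = n ^ e` the factor `n ^ p` is `u ^ (p / e)`, which `exp (-b u)` dominates. The `τ / 2`
  -- in `b` is a lower bound of `tauSeq` for all large `N`.
  have h1 := ((tendsto_rpow_mul_exp_neg_mul_atTop_nhds_zero (p / e) b hb0).comp
    ((tendsto_rpow_atTop he0).comp (tendsto_dimension hd))).const_mul K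
  rw [mul_zero] at h1
  refine squeeze_zero' ?_ ?_ h1
  · filter_upwards [hest] with N h
    exact mul_nonneg (Real.rpow_nonneg (dimension_pos hd h.pos).le _)
      (bridgeAcceptance_nonneg_le alg hβ hT hd hGc hl h).1
  · filter_upwards [hest, hτ.eventually_const_le (show τ / 2 < τ by linarith)] with N h hτN
    have hn := dimension_pos hd h.pos
    have hb1 := (bridgeAcceptance_nonneg_le alg hβ hT hd hGc hl h).2
    have hK : 0 ≤ K := le_trans (div_nonneg (Real.exp_pos _).le h.norm_pos.le) h.norm_le
    simp only [Function.comp_apply]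
    rw [← Real.rpow_mul hn.le, mul_div_cancel₀ _ he0.ne']
    have h2 : b * dimension d N ^ e ≤ ratioSum alg d β T l ρ N / 256 := by
      rw [ratioSum_eq alg hl hn, ← he, hb]
      have h3 : 0 ≤ l ^ alg.power * dimension d N ^ e := by positivity
      nlinarith [mul_le_mul_of_nonneg_left hτN h3]
    calc dimension d N ^ p * bridgeAcceptance alg β T G l ρ N
        ≤ dimension d N ^ p * (K * Real.exp (-(b * dimension d N ^ e))) := by
          refine mul_le_mul_of_nonneg_left (hb1.trans (mul_le_mul_of_nonneg_left
            (Real.exp_le_exp.2 ?_) hK)) (by positivity)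
          rw [neg_div]
          exact neg_le_neg h2
      _ = _ := by ring_nf

theorem isBigO_bridgeJump (alg : Algorithm) (hβ : 0 < β) (hT : 0 < T)
    (hd : 0 < d) (hG : GrowthCondition G) (hl : 0 < l) (hρ : 2 < ρ) (hρ' : ρ < 2 + alg.index)
    {τ : ℝ} (hτ0 : 0 < τ) (hτ : Tendsto (tauSeq alg β T d) atTop (𝓝 τ)) (k : ℕ) (j : Fin d)
    (p : ℝ) :
    (bridgeJump alg β T G l ρ k j) =O[atTop] fun N => dimension d N ^ (-p) := by
  obtain ⟨c, K, ε, hε, hest⟩ := exists_stepEstimate alg hβ hT hd hG hl hρ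
  have hGc := continuous_of_growthCondition hG
  -- The exponent is doubled because the jump is bounded by the square root of the acceptance.
  have hacc := (tendsto_dimension_mul_bridgeAcceptance alg hβ hT hd hG hl hρ hρ' hτ0 hτ
    (2 * p)).eventually_le_const (show (0 : ℝ) < 1 by norm_num)
  have hσ := (tendsto_dimension_rpow hd (e := -ρ) (by linarith)).eventually_le_const
    (show (0 : ℝ) < 1 by norm_num)
  refine IsBigO.of_bound (l ^ 2 * (Real.sqrt (16 * fourthMoment) * Real.sqrt K)) ?_
  filter_upwards [hest, eventually_gt_atTop k, hacc, hσ] with N h hk hN hσN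
  have hn := dimension_pos hd h.pos
  have hK : 0 ≤ K := le_trans (div_nonneg (Real.exp_pos _).le h.norm_pos.le) h.norm_le
  have hj := squaredJump_nonneg_le alg (fun i => bridgeSD_pos hβ hT N d i)
    (stepSize_pos (ρ := ρ) hl hn) (measurable_truncatedFunctional hGc T N) h.norm_pos
    h.relDensity_le (⟨k, hk⟩, j) ((ratio_le_maxRatio hβ hT hd hl N _).trans h.ratio_le_one)
  have e1 : bridgeJump alg β T G l ρ k j N = squaredJump alg (bridgeSD β T N d)
      (truncatedFunctional T G N) (stepSize d l ρ N) (⟨k, hk⟩, j) := by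
    rw [bridgeJump, dif_pos hk]
  change _ ∧ _ ≤ _ * (_ * Real.sqrt (K * bridgeAcceptance alg β T G l ρ N)) at hj
  rw [← e1, stepSize_sq] at hj
  have hp : 0 < dimension d N ^ (-p) := Real.rpow_pos_of_pos hn _
  have hs : Real.sqrt (bridgeAcceptance alg β T G l ρ N) ≤ dimension d N ^ (-p) := by
    refine Real.sqrt_le_iff.2 ⟨hp.le, ?_⟩
    have e2 : (dimension d N ^ (-p)) ^ 2 = (dimension d N ^ (2 * p))⁻¹ := by
      rw [← Real.rpow_natCast, ← Real.rpow_mul hn.le, ← Real.rpow_neg hn.le]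
      congr 1
      push_cast
      ring
    rw [e2, inv_eq_one_div, le_div_iff₀ (by positivity), mul_comm]
    exact hN
  rw [Real.norm_of_nonneg hj.1, Real.norm_of_nonneg hp.le]
  refine hj.2.trans ?_
  rw [Real.sqrt_mul hK]
  calc l ^ 2 * dimension d N ^ (-ρ) * (Real.sqrt (16 * fourthMoment) *
        (Real.sqrt K * Real.sqrt (bridgeAcceptance alg β T G l ρ N)))
      ≤ l ^ 2 * 1 * (Real.sqrt (16 * fourthMoment) *
        (Real.sqrt K * dimension d N ^ (-p))) := by gcongr
    _ = _ := by ring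

theorem scalingLimits (alg : Algorithm) (hβ : 0 < β) (hT : 0 < T) (hd : 0 < d)
    (hG : GrowthCondition G) {τ : ℝ} (hτ0 : 0 < τ)
    (hτ : Tendsto (tauSeq alg β T d) atTop (𝓝 τ)) : ScalingLimits alg β T G 1 τ where
  decay := bridgeSD_decay hβ hT hd
  tau_limit := hτ
  acceptance_critical l ρ hl _ hρ := by
    rw [mul_one] at hρ
    rw [limitAcceptance_eq alg hτ0.le hl]
    exact tendsto_bridgeAcceptance alg hβ hT hd hG hl (by linarith [alg.index_pos])
      (tendsto_ratioSum_critical alg hd hl hτ hρ)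
  acceptance_small_step l ρ hl _ hρ := by
    rw [mul_one] at hρ
    have := tendsto_bridgeAcceptance alg hβ hT hd hG hl (by linarith [alg.index_pos])
      (tendsto_ratioSum_small alg hd hl hτ hρ)
    rwa [mul_zero, gaussianAcceptance_zero] at this
  acceptance_large_step l ρ hl _ hρ hρ' p _ := by
    rw [mul_one] at hρ hρ'
    exact tendsto_dimension_mul_bridgeAcceptance alg hβ hT hd hG hl hρ hρ' hτ0 hτ p
  jump_critical l ρ hl _ hρ k j := by
    rw [mul_one] at hρ
    have e : -(2 * 1) - alg.index = -ρ := by rw [hρ]; ring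
    rw [limitAcceptance_eq alg hτ0.le hl]
    simp only [e]
    exact isLittleO_bridgeJump alg hβ hT hd hG hl (by linarith [alg.index_pos])
      (tendsto_ratioSum_critical alg hd hl hτ hρ) k j
  jump_small_step l ρ hl _ hρ k j := by
    rw [mul_one] at hρ
    have := isLittleO_bridgeJump alg hβ hT hd hG hl (by linarith [alg.index_pos])
      (tendsto_ratioSum_small alg hd hl hτ hρ) k j
    simpa only [mul_zero, gaussianAcceptance_zero, mul_one] using this
  jump_large_step l ρ hl _ hρ hρ' k j p _ := by
    rw [mul_one] at hρ hρ'
    exact isBigO_bridgeJump alg hβ hT hd hG hl hρ hρ' hτ0 hτ k j p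

end Scaling

end DiffusionBridge

end

/-! ### The explicit values of `τ` -/

theorem proposition1 (d : ℕ) (hd : 0 < d) (β T : ℝ) (hβ : 0 < β) (hT : 0 < T)
    (V : EuclideanSpace ℝ (Fin d) → ℝ) (hV : ContDiff ℝ 2 V)
    (hG : DiffusionBridge.GrowthCondition (DiffusionBridge.pathPotential β V)) :
    DiffusionBridge.ScalingLimits .rwm β T (DiffusionBridge.pathPotential β V)
      1 (β * Real.pi ^ 2 / (6 * T ^ 2 * (d : ℝ) ^ 2)) ∧
    DiffusionBridge.ScalingLimits .sla β T (DiffusionBridge.pathPotential β V)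
      1 (β ^ 3 * Real.pi ^ 6 / (56 * T ^ 6 * (d : ℝ) ^ 6)) := by
  have hd' : (0 : ℝ) < d := by exact_mod_cast hd
  have hpi := Real.pi_pos
  have h0 := DiffusionBridge.bridgeScale_pos hβ hT
  -- Dividing this by `3 d²` gives the constant `6` of RWM; dividing its cube by `7 d⁶` gives `56 =
  -- 8 * 7` for SLA.
  have hs : (DiffusionBridge.bridgeScale β T)⁻¹ ^ 2 = β * Real.pi ^ 2 / (2 * T ^ 2) := by
    rw [inv_pow, DiffusionBridge.bridgeScale_sq hβ]
    field_simp
  refine ⟨DiffusionBridge.scalingLimits .rwm hβ hT hd hG (by positivity) ?_,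
    DiffusionBridge.scalingLimits .sla hβ hT hd hG (by positivity) ?_⟩
  · have h := DiffusionBridge.tendsto_tauSeq .rwm hβ hT hd
    convert h using 2
    simp only [DiffusionBridge.Algorithm.power, hs]
    push_cast
    field_simp
    norm_num
  · have h := DiffusionBridge.tendsto_tauSeq .sla hβ hT hd
    convert h using 2
    have hs6 : (DiffusionBridge.bridgeScale β T)⁻¹ ^ 6 = (β * Real.pi ^ 2 / (2 * T ^ 2)) ^ 3 := by
      rw [← hs]; ring
    simp only [DiffusionBridge.Algorithm.power, hs6]
    push_cast
    field_simp
    norm_num
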